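/- **Setting.** Let $\mathcal A$ be an essential (real, complexified) toric arrangement: a finite set of pairwise distinct connected hypertori $H=\{[v] : \chi_H(v)\in a_H+\mathbb Z\}$ in a compact torus $T=V/\Gamma$ of dimension $d$ ($\Gamma$ a lattice in $V\cong\mathbb R^d$, $\chi_H$ a primitive character, $a_H\in\mathbb R$), such that the hyperplanes $H_0=\ker\chi_H$ intersect in $\{0\}$ only. Let $\mathcal A_0=\{H_0 : H\in\mathcal A\}$ be the associated linear arrangement. A *layer* is a connected component of an intersection of elements of $\mathcal A$. For a layer $L$ let $X_L=\bigcap_{H\supseteq L}H_0$ and let $L_0\subseteq T$ be the image of $X_L$. *Arrangements of hyperplanes.* For a finite central arrangement in $V$ with faces $\mathcal F$ and chambers $\mathcal T$, write $F\le G$ if $F\subseteq\overline G$. For a face $G$ and a chamber $C$, the chamber $C_G\geq G$ is the one lying on the same side as $C$ of every hyperplane containing $G$. The poset $\mathcal S$ consists of all $[G,C]$ with $G\in\mathcal F$, $C\in\mathcal T$, $G\le C$, ordered by $[G',C']\le[G,C]$ iff $G\le G'$ and no hyperplane containing $G'$ separates $C$ from $C'$. For $C\in\mathcal T$ let $\mathcal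 S_C=\{[G,C_G] : G\in\mathcal F\}$, and for $G\in\mathcal F$ let $\mathcal S^{G}=\bigcup_{C\ge G}\mathcal S_C$. *The toric Salvetti complex.* $\mathcal A$ lifts to a $\Gamma$-periodic affine arrangement in $V$. The objects of the face category $\mathcal F(\mathcal A)$ are the images in $T$ of its faces; a morphism $m:F\to G$ is a pair $f\le g$ of faces over $F$ and $G$, up to translation by $\Gamma$. The support $\operatorname{supp}(F)$ is the smallest layer containing $F$. Let $\mathcal A[F]=\{H_0 : H\in\mathcal A,\ H\supseteq F\}$. A morphism $m:F\to G$ determines the face $F_m$ of $\mathcal A[F]$ into which $g$ points from $f$, and an inclusion $i_m:\mathcal F(\mathcal A[G])\to\mathcal F(\mathcal A[F])$ (position as given with respect to the hyperplanes of $\mathcal A[G]$, and as for $F_m$ with respect to the others). With the maps $[K,C]\mapsto[i_m(K),i_m(C)]$, the posets $\mathcal S(\mathcal A[F])$ form a diagram $\mathscr D$ on $\mathcal F(\mathcal A)^{op}$, and $\operatorname{Sal}(\mathcal A)$ is the nerve of $\int\mathscr D$, whose objects are the pairs $(F,[K,C])$ with $[K,C]\in\mathcal S(\mathcal A[F])$.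 Homology is simplicial, with integral coefficients. For a face or chamber $E$ of $\mathcal A_0$ let $E(F)$ be the smallest face of $\mathcal A[F]$ containing it. Below, a set of objects of $\int\mathscr D$ stands for the full subcomplex of the nerve that it spans. *The map $\Phi_L$.* For a layer $L$ let $\overline{\mathcal A}_L=\{H/L_0 : H\in\mathcal A,\ H\supseteq L\}$, a toric arrangement in $T/L_0$. Taking the face of $\overline{\mathcal A}_L$ that contains the image of a face of $\mathcal A$ defines a functor $\pi_L:\mathcal F(\mathcal A)\to\mathcal F(\overline{\mathcal A}_L)$. Taking the smallest face that contains the image defines $\pi_L:\mathcal F(\mathcal A_0)\to\mathcal F((\overline{\mathcal A}_L)_0)$ and $\pi_L^F:\mathcal F(\mathcal A[F])\to\mathcal F(\overline{\mathcal A}_L[\pi_L(F)])$. For a layer $Y$ of $\mathcal A$ let $\pi_L(Y)$ be the smallest layer of $\overline{\mathcal A}_L$ containing the image of $Y$ (so $\pi_L(H)=H/L_0$ if $H\in\mathcal A$, $H\supseteq L$). The assignment $(F,[K,C])\mapsto(\pi_L(F),[\pi_L^F(K),\pi_L^F(C)])$ is a functor and induces the cellular map $\Phi_L:\operatorname{Sal}(\mathcal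 A)\to\operatorname{Sal}(\overline{\mathcal A}_L)$. *The loops $\Lambda_B^M$.* Let $M$ be a one-dimensional layer and $B\in\mathcal T(\mathcal A_0)$. Choose a chamber ${}^MC\in\mathcal T(\mathcal A_0)$ adjacent to $X_M$ (having a face with linear hull $X_M$) and a minimal gallery $C_0={}^MC,\dots,C_k=\operatorname{op}_{X_M}(-{}^MC)$ of $\mathcal A_0$, where $\operatorname{op}_{X_M}(C)$ is the chamber separated from $C$ by exactly the hyperplanes of $\mathcal A_0$ containing $X_M$. The complex $\Lambda_B^M$ is spanned by all $(F,[C_n(F),C_n(F)])$, $0\le n\le k$, and $(F,[W,B(F)_W])$, where $F\subseteq M$ is a face and $W$ is the common wall of $C_n(F)\ne C_{n+1}(F)$. Write $v_n=[C_n(P),C_n(P)]$ for a vertex $P$ of $M$, and $e_n=[W,B(P)_W]$ if $W$ is the wall of $C_n(P)\neq C_{n+1}(P)$. The cycle $[\Lambda_B^M]$ has coefficient $1$ on $(P,v_n)\to(P,e_n)$, $-1$ on $(P,v_{n+1})\to(P,e_n)$, and, for an edge $G\subseteq M$ with $v=[C_0(G),C_0(G)]$, coefficient $1$ on $(G,v)\to(P,v_0)$,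 $-1$ on $(G,v)\to(P,v_k)$, and $0$ on all other arrows. Its class is $\widehat\lambda_B^M\in H_1(\operatorname{Sal}(\mathcal A))$. *The classes $\widehat\omega_H$.* For $H\in\mathcal A$ choose ${}^HC\in\mathcal T(\mathcal A_0)$. For a morphism $m:F\to G$ with $\operatorname{supp}(G)=H$ let $C_1=({}^HC(F))_{F_m}$ and $C_2=(-{}^HC(F))_{F_m}$, the two chambers of $\mathcal A[F]$ adjacent to $F_m$. The circle $\Omega^{(m)}$ is spanned by $(F,[C_1,C_1])$, $(F,[F_m,C_1])$, $(F,[C_2,C_2])$, $(F,[F_m,C_2])$, and the cycle $[\Omega^{(m)}]$ on it has coefficient $1$ on $(F,[C_1,C_1])\to(F,[F_m,C_1])$. The class $\widehat\omega_H\in H_1(\operatorname{Sal}(\mathcal A))$ is the class of $[\Omega^{(m)}]$ for any such $m$. *The complexes $\mathcal S_{Y,F_0}$.* For a layer $Y$ and $F_0\in\mathcal F(\mathcal A_0)$, $\mathcal S_{Y,F_0}$ is spanned by all $(F,x)$ with $F\subseteq Y$ a face and $x\in\mathcal S^{F_0(F)}(\mathcal A[F])$. **Lemma.** Let $L$ be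 a layer of $\mathcal A$. (1) For every one-dimensional layer $M$ with $X_M\subseteq X_L$, every choice of ${}^MC$ and of the gallery, and every $B\in\mathcal T(\mathcal A_0)$, $\Phi_L(\Lambda_B^M)$ is a single vertex; the chain $[\Lambda_B^M]$ is a cycle and $(\Phi_L)_*(\widehat\lambda_B^M)=0$. (2) Let chambers ${}^HC$ $(H\in\mathcal A)$ be chosen, and for $H\supseteq L$ put ${}^{\pi_L(H)}C=\pi_L({}^HC)$. If $G\in\mathcal F(\mathcal A)$ and $\operatorname{supp}(G)=H\in\mathcal A$ with $H\supseteq L$, then $\Phi_L(\Omega^{(\mathrm{id}_G)})=\Omega^{(\mathrm{id}_{\pi_L(G)})}$. For every $H\in\mathcal A$, $$(\Phi_L)_*(\widehat\omega_H)=\begin{cases}\widehat\omega_{\pi_L(H)}&\text{if }H\supseteq L,\\0&\text{if }H\not\supseteq L,\end{cases}$$ whichever morphisms $m$ are used to represent $\widehat\omega_H$ and $\widehat\omega_{\pi_L(H)}$. (3) For every layer $Y$ and every $F_0\in\mathcal F(\mathcal A_0)$, $\Phi_L(\mathcal S_{Y,F_0})\subseteq\mathcal S_{\pi_L(Y),\pi_L(F_0)}$.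 -/

import Mathlib

open CategoryTheory Simplicial Opposite

universe u v

noncomputable section

namespace ToricSalvetti

/-! ### Faces of arrangements of affine hyperplanes -/

/-- A face of the arrangement of the affine hyperplanes `{ℓ j = 0}`, `j ∈ J`, in a real vector
space, given by its sign vector. -/
@[ext]
structure Face {J : Type*} {V : Type*} [AddCommGroup V] [Module ℝ V] (ℓ : J → V →ᵃ[ℝ] ℝ) where
  sign : J → SignType
  realized : ∃ x : V, ∀ j, SignType.sign (ℓ j x) = sign j

namespace Face

section
variable {J : Type*} {V : Type*} [AddCommGroup V] [Module ℝ V] {ℓ : J → V →ᵃ[ℝ] ℝ}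

/-- The face as a set of points. -/
def carrier (F : Face ℓ) : Set V := {x | ∀ j, SignType.sign (ℓ j x) = F.sign j}

/-- The face that contains the point `x`. -/
@[simps]
def ofPoint (ℓ : J → V →ᵃ[ℝ] ℝ) (x : V) : Face ℓ where
  sign j := SignType.sign (ℓ j x)
  realized := ⟨x, fun _ => rfl⟩

/-- `F ≤ G` if `F` is contained in the closure of `G`: the sign vector of `F` arises from that of
`G` by changing some entries to zero. -/
instance : PartialOrder (Face ℓ) where
  le F G := ∀ j, F.sign j = 0 ∨ F.sign j = G.sign j
  le_refl F j := Or.inr rfl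
  le_trans F G H h₁ h₂ j := by
    rcases h₁ j with h | h
    · exact Or.inl h
    · rcases h₂ j with h' | h'
      · exact Or.inl (h.trans h')
      · exact Or.inr (h.trans h')
  le_antisymm F G h₁ h₂ := by
    ext j
    rcases h₁ j with h | h
    · rcases h₂ j with h' | h'
      · rw [h, h']
      · exact h'.symm
    · exact h

theorem le_def {F G : Face ℓ} : F ≤ G ↔ ∀ j, F.sign j = 0 ∨ F.sign j = G.sign j := Iff.rfl

/-- A chamber is a face that lies on none of the hyperplanes. -/
def IsChamber (C : Face ℓ) : Prop := ∀ j, C.sign j ≠ 0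

/-- The linear hull of a face (of a central arrangement). -/
def hull (F : Face ℓ) : Submodule ℝ V := Submodule.span ℝ F.carrier

/-- The smallest face, of an arrangement in `V'` whose hyperplanes pull back under `p : V → V'` to
hyperplanes of the given arrangement in `V`, that contains the image of a face. For `p = id` this
is the smallest face of a subarrangement that contains a given face. -/
@[simps]
def push {J' V' : Type*} [AddCommGroup V'] [Module ℝ V'] {ℓ' : J' → V' →ᵃ[ℝ] ℝ}
    (e : J' → J) (p : V → V') (h : ∀ j v, ℓ' j (p v) = ℓ (e j) v) (F : Face ℓ) : Face ℓ' where
  sign j := F.sign (e j)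
  realized := by
    obtain ⟨x, hx⟩ := F.realized
    exact ⟨p x, fun j => by rw [h, hx]⟩

theorem sign_lineMap_eventually (a b : ℝ) :
    ∀ᶠ t : ℝ in nhdsWithin 0 (Set.Ioi 0), SignType.sign ((1 - t) * a + t * b) =
      if SignType.sign a = 0 then SignType.sign b else SignType.sign a := by
  have hc : Filter.Tendsto (fun t : ℝ => (1 - t) * a + t * b) (nhdsWithin 0 (Set.Ioi 0))
      (nhds a) := by
    have : ContinuousAt (fun t : ℝ => (1 - t) * a + t * b) 0 := by fun_prop
    simpa using this.tendsto.mono_left nhdsWithin_le_nhds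
  rcases lt_trichotomy a 0 with ha | ha | ha
  · filter_upwards [hc.eventually (gt_mem_nhds ha)] with t ht
    rw [sign_neg ht, sign_neg ha]; rfl
  · subst ha
    filter_upwards [self_mem_nhdsWithin] with t ht
    have ht' : (0 : ℝ) < t := ht
    simp [sign_mul, sign_pos ht']
  · filter_upwards [hc.eventually (lt_mem_nhds ha)] with t ht
    rw [sign_pos ht, sign_pos ha]; rfl

/-- For a face `G` and a face `C`, the face `C_G` that is entered when one moves from `G` a little
in the direction of `C`: a hyperplane that contains `G` has the same sign on `C_G` as on `C`, any
other one the same sign as on `G`. -/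
@[simps]
def proj [Finite J] (C G : Face ℓ) : Face ℓ where
  sign j := if G.sign j = 0 then C.sign j else G.sign j
  realized := by
    obtain ⟨g, hg⟩ := G.realized
    obtain ⟨c, hc⟩ := C.realized
    have h : ∀ᶠ t : ℝ in nhdsWithin 0 (Set.Ioi 0), ∀ j,
        SignType.sign ((1 - t) * ℓ j g + t * ℓ j c) =
          if SignType.sign (ℓ j g) = 0 then SignType.sign (ℓ j c) else SignType.sign (ℓ j g) :=
      Filter.eventually_all.2 fun j => sign_lineMap_eventually _ _
    obtain ⟨t, ht⟩ := h.exists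
    refine ⟨AffineMap.lineMap g c t, fun j => ?_⟩
    rw [AffineMap.apply_lineMap, AffineMap.lineMap_apply_module, smul_eq_mul, smul_eq_mul, ht,
      hg, hc]

end

section
variable {J : Type*} {V : Type*} [AddCommGroup V] [Module ℝ V]

/-- The family of linear forms `ℓ`, as a family of affine functions: a central arrangement. -/
abbrev _root_.ToricSalvetti.central (ℓ : J → V →ₗ[ℝ] ℝ) : J → V →ᵃ[ℝ] ℝ :=
  fun j => (ℓ j).toAffineMap

/-- The negative of a face of a central arrangement. -/
@[simps]
def neg {ℓ : J → V →ₗ[ℝ] ℝ} (C : Face (central ℓ)) : Face (central ℓ) where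
  sign j := - C.sign j
  realized := by
    obtain ⟨x, hx⟩ := C.realized
    exact ⟨-x, fun j => by
      rw [← hx j]
      simpa using Left.sign_neg (ℓ j x)⟩

end

end Face

/-- The chambers of an arrangement. -/
abbrev Chamber {J : Type*} {V : Type*} [AddCommGroup V] [Module ℝ V] (ℓ : J → V →ᵃ[ℝ] ℝ) :=
  {C : Face ℓ // C.IsChamber}

/-- The negative of a chamber of a central arrangement. -/
def Chamber.neg {J : Type*} {V : Type*} [AddCommGroup V] [Module ℝ V] {ℓ : J → V →ₗ[ℝ] ℝ}
    (C : Chamber (central ℓ)) : Chamber (central ℓ) :=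
  ⟨C.1.neg, fun j h => C.2 j (by
    rw [Face.neg_sign] at h
    revert h
    generalize C.1.sign j = t
    revert t
    decide)⟩

/-- An element `[G, C]` of the Salvetti poset: a chamber `C` and a face `G ≤ C`. -/
@[ext]
structure Cell {J : Type*} {V : Type*} [AddCommGroup V] [Module ℝ V] (ℓ : J → V →ᵃ[ℝ] ℝ) where
  face : Face ℓ
  chamber : Face ℓ
  isChamber : chamber.IsChamber
  face_le : face ≤ chamber

namespace Cell

variable {J : Type*} {V : Type*} [AddCommGroup V] [Module ℝ V] {ℓ : J → V →ᵃ[ℝ] ℝ}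

/-- `[G', C'] ≤ [G, C]` if `G ≤ G'` and no hyperplane containing `G'` separates `C` from `C'`. -/
instance : PartialOrder (Cell ℓ) where
  le x y := y.face ≤ x.face ∧ ∀ j, x.face.sign j = 0 → y.chamber.sign j = x.chamber.sign j
  le_refl x := ⟨le_rfl, fun _ _ => rfl⟩
  le_trans x y z h₁ h₂ := ⟨h₂.1.trans h₁.1, fun j hj => by
    have hy : y.face.sign j = 0 := by
      rcases h₁.1 j with h | h
      · exact h
      · exact h.trans hj
    rw [h₂.2 j hy, h₁.2 j hj]⟩
  le_antisymm x y h₁ h₂ := by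
    have hf : x.face = y.face := le_antisymm h₂.1 h₁.1
    refine Cell.ext hf (Face.ext (funext fun j => ?_))
    by_cases hj : x.face.sign j = 0
    · exact (h₁.2 j hj).symm
    · rcases x.face_le j with h | h
      · exact absurd h hj
      · rcases y.face_le j with h' | h'
        · exact absurd (hf ▸ h') hj
        · rw [← h, ← h', hf]

theorem le_def {x y : Cell ℓ} : x ≤ y ↔
    y.face ≤ x.face ∧ ∀ j, x.face.sign j = 0 → y.chamber.sign j = x.chamber.sign j := Iff.rfl

/-- The vertex `[C, C]`. -/
@[simps]
def vertex (C : Chamber ℓ) : Cell ℓ := ⟨C.1, C.1, C.2, le_rfl⟩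

theorem vertex_le {C : Chamber ℓ} {x : Cell ℓ} (h : x.face ≤ C.1) : vertex C ≤ x :=
  ⟨h, fun j hj => absurd hj (C.2 j)⟩

/-- The element `[G, C_G]`. -/
@[simps]
def edge [Finite J] (G : Face ℓ) (C : Chamber ℓ) : Cell ℓ where
  face := G
  chamber := C.1.proj G
  isChamber j := by
    rw [Face.proj_sign]
    split_ifs with h
    · exact C.2 j
    · exact h
  face_le j := by
    rw [Face.proj_sign]
    split_ifs with h
    · exact Or.inl h
    · exact Or.inr rfl

/-- The subposet `𝒮_C` of all `[G, C_G]`, for a chamber `C`. -/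
def around [Finite J] (C : Chamber ℓ) : Set (Cell ℓ) := {x | x.chamber = C.1.proj x.face}

/-- The subposet `𝒮^G`, the union of the `𝒮_C` over all chambers `C ≥ G`. -/
def star [Finite J] (G : Face ℓ) : Set (Cell ℓ) :=
  {x | ∃ C : Chamber ℓ, G ≤ C.1 ∧ x ∈ around C}

end Cell

/-- `W` is a common wall, that is a common face of codimension one, of `C` and `C'`. -/
def IsWall {J : Type*} {V : Type*} [AddCommGroup V] [Module ℝ V] {ℓ : J → V →ᵃ[ℝ] ℝ}
    (W : Face ℓ) (C C' : Chamber ℓ) : Prop := W ⋖ C.1 ∧ W ⋖ C'.1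

/-- A gallery `C 0, …, C k`: consecutive chambers have a common wall. -/
def IsGallery {J : Type*} {V : Type*} [AddCommGroup V] [Module ℝ V] {ℓ : J → V →ᵃ[ℝ] ℝ}
    (k : ℕ) (C : ℕ → Chamber ℓ) : Prop :=
  ∀ n < k, ∃ W : Face ℓ, IsWall W (C n) (C (n + 1))

/-- A gallery of minimal length among those with the same first and last chamber. -/
def IsMinimalGallery {J : Type*} {V : Type*} [AddCommGroup V] [Module ℝ V]
    {ℓ : J → V →ᵃ[ℝ] ℝ} (k : ℕ) (C : ℕ → Chamber ℓ) : Prop :=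
  IsGallery k C ∧
    ∀ (k' : ℕ) (C' : ℕ → Chamber ℓ), IsGallery k' C' → C' 0 = C 0 → C' k' = C k → k ≤ k'

/-! ### Toric arrangements -/

/-- A toric arrangement in the compact torus `V / Γ`, where `Γ` is a lattice in `V`: a finite set,
indexed by `ι`, of pairwise distinct connected hypertori. The hypertorus with index `i` consists
of the classes of all `v` with `χ i v ∈ a i + ℤ`; here `χ i` is a primitive character, that is it
maps `Γ` onto `ℤ`. -/
structure ToricArrangement {V : Type u} [AddCommGroup V] [Module ℝ V] (Γ : Submodule ℤ V)
    (ι : Type v) where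
  χ : ι → V →ₗ[ℝ] ℝ
  a : ι → ℝ
  primitive : ∀ i, (fun γ => χ i γ) '' (Γ : Set V) = Set.range (Int.cast : ℤ → ℝ)
  distinct : ∀ i j : ι,
    ({v | ∃ k : ℤ, χ i v = a i + k} : Set V) = {v | ∃ k : ℤ, χ j v = a j + k} → i = j

namespace ToricArrangement

section
variable {V : Type u} [AddCommGroup V] [Module ℝ V] {Γ : Submodule ℤ V} {ι : Type v}
  (A : ToricArrangement Γ ι)

/-- The hypertorus with index `i`. -/
def hyp (i : ι) : Set (V ⧸ Γ) := Γ.mkQ '' {v | ∃ k : ℤ, A.χ i v = A.a i + k}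

/-- The arrangement is essential if the hyperplanes `ker (χ i)` intersect in the origin only. -/
def Essential : Prop := ∀ v : V, (∀ i, A.χ i v = 0) → v = 0

/-- The periodic affine arrangement in the universal cover `V`. -/
def lifted : ι × ℤ → V →ᵃ[ℝ] ℝ :=
  fun p => (A.χ p.1).toAffineMap - AffineMap.const ℝ V (A.a p.1 + p.2)

@[simp]
theorem lifted_apply (i : ι) (k : ℤ) (v : V) : A.lifted (i, k) v = A.χ i v - (A.a i + k) := rfl

/-- The linear arrangement `𝒜₀` of the hyperplanes `ker (χ i)`. (Parallel hypertori define the same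
hyperplane; repetitions change neither the faces nor the galleries.) -/
abbrev linear : ι → V →ᵃ[ℝ] ℝ := central A.χ

/-- A layer: a connected component of an intersection of hypertori of the arrangement. -/
def IsLayer [TopologicalSpace V] (L : Set (V ⧸ Γ)) : Prop :=
  ∃ (S : Set ι) (x : V ⧸ Γ), x ∈ (⋂ i ∈ S, A.hyp i) ∧ L = connectedComponentIn (⋂ i ∈ S, A.hyp i) x

/-- The subspace `X_L`: the intersection of the hyperplanes `ker (χ i)` that belong to the
hypertori containing `L`. -/
def tangent (L : Set (V ⧸ Γ)) : Submodule ℝ V :=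
  ⨅ (i : ι) (_ : L ⊆ A.hyp i), LinearMap.ker (A.χ i)

/-- A face of the stratification of the torus induced by the arrangement: the image of a face of
the periodic arrangement. -/
@[ext]
structure TFace where
  carrier : Set (V ⧸ Γ)
  isFace : ∃ f : Face A.lifted, carrier = Γ.mkQ '' f.carrier

variable {A}

/-- The support of a face: the smallest layer containing it. -/
def TFace.supp [TopologicalSpace V] (F : A.TFace) : Set (V ⧸ Γ) :=
  ⋂₀ {L | A.IsLayer L ∧ F.carrier ⊆ L}

/-- The index set of the local arrangement at `F`: the hypertori containing `F`. -/
abbrev TFace.Loc (F : A.TFace) : Type v := {i : ι // F.carrier ⊆ A.hyp i}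

/-- The local linear arrangement `𝒜[F]`. -/
abbrev TFace.arr (F : A.TFace) : F.Loc → V →ᵃ[ℝ] ℝ := central fun i => A.χ i

theorem TFace.arr_apply (F : A.TFace) (i : F.Loc) (v : V) : F.arr i (id v) = A.linear i.1 v := rfl

/-- The smallest face of `𝒜[F]` that contains a given face of `𝒜₀`. -/
def TFace.localize (F : A.TFace) (G : Face A.linear) : Face F.arr :=
  G.push (fun i => i.1) id (F.arr_apply)

/-- The unique chamber `C(F)` of `𝒜[F]` that contains a given chamber `C` of `𝒜₀`. -/
def TFace.localizeChamber (F : A.TFace) (C : Chamber A.linear) : Chamber F.arr :=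
  ⟨F.localize C.1, fun i => C.2 i.1⟩

variable (A)

/-- The face that contains the class of `v`. -/
def faceAt (v : V) : A.TFace where
  carrier := Γ.mkQ '' (Face.ofPoint A.lifted v).carrier
  isFace := ⟨_, rfl⟩

variable {A}

/-! ### The face category -/

/-- A morphism `m : F → G` is a pair of faces `f ≤ g` of the periodic arrangement that lie over
`F` and `G`, up to translation by the lattice. It is recorded by `F_m`, the face of the local
arrangement `𝒜[F]` into which `g` points from `f`. (The pair is determined by `F_m` up to
translation, as `g` has the sign of `F_m` on the hyperplanes through `f`, and that of `f` on all
others.) -/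
@[ext]
structure TFace.Hom (F G : A.TFace) where
  dir : Face F.arr
  lifts : ∃ f g : Face A.lifted, f ≤ g ∧ F.carrier = Γ.mkQ '' f.carrier ∧
    G.carrier = Γ.mkQ '' g.carrier ∧
    ∀ (i : F.Loc) (k : ℤ), f.sign (i.1, k) = 0 → g.sign (i.1, k) = dir.sign i

theorem sign_eq_zero_unique {f : Face A.lifted} {i : ι} {k k' : ℤ} (h : f.sign (i, k) = 0)
    (h' : f.sign (i, k') = 0) : k = k' := by
  obtain ⟨x, hx⟩ := f.realized
  have h1 := hx (i, k)
  have h2 := hx (i, k')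
  rw [h, sign_eq_zero_iff, lifted_apply] at h1
  rw [h', sign_eq_zero_iff, lifted_apply] at h2
  have : (k : ℝ) = k' := by linarith
  exact_mod_cast this

theorem exists_int (i : ι) {γ : V} (hγ : γ ∈ Γ) : ∃ n : ℤ, A.χ i γ = n := by
  have : A.χ i γ ∈ Set.range (Int.cast : ℤ → ℝ) := by
    rw [← A.primitive i]
    exact ⟨γ, hγ, rfl⟩
  obtain ⟨n, hn⟩ := this
  exact ⟨n, hn.symm⟩

theorem subset_hyp_iff (f : Face A.lifted) (i : ι) :
    Γ.mkQ '' f.carrier ⊆ A.hyp i ↔ ∃ k : ℤ, f.sign (i, k) = 0 := by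
  constructor
  · intro h
    obtain ⟨x, hx⟩ := f.realized
    obtain ⟨y, ⟨k, hk⟩, hy⟩ := h ⟨x, hx, rfl⟩
    have hγ : x - y ∈ Γ := by
      rw [← Submodule.Quotient.eq]
      exact hy.symm
    obtain ⟨n, hn⟩ := exists_int (A := A) i hγ
    refine ⟨k + n, ?_⟩
    rw [← hx, sign_eq_zero_iff, lifted_apply]
    rw [map_sub] at hn
    push_cast
    linarith
  · rintro ⟨k, hk⟩ _ ⟨x, hx, rfl⟩
    refine ⟨x, ⟨k, ?_⟩, rfl⟩
    have := hx (i, k)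
    rw [hk, sign_eq_zero_iff, lifted_apply] at this
    linarith

theorem exists_translate {g g' h : Face A.lifted}
    (e : Γ.mkQ '' g.carrier = Γ.mkQ '' g'.carrier) (hle : g' ≤ h) :
    ∃ h' : Face A.lifted, Γ.mkQ '' h'.carrier = Γ.mkQ '' h.carrier ∧ g ≤ h' ∧
      ∀ i k k', g.sign (i, k) = 0 → g'.sign (i, k') = 0 → h'.sign (i, k) = h.sign (i, k') := by
  obtain ⟨x, hx⟩ := g.realized
  obtain ⟨z, hz⟩ := h.realized
  have hxg : Γ.mkQ x ∈ Γ.mkQ '' g'.carrier := e ▸ ⟨x, hx, rfl⟩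
  obtain ⟨y, hy, hxy⟩ := hxg
  have hγ : x - y ∈ Γ := by
    rw [← Submodule.Quotient.eq]
    exact hxy.symm
  choose n hn using fun i => exists_int (A := A) i hγ
  have key : ∀ (w : V) i (k : ℤ), A.lifted (i, k) (w + (x - y)) = A.lifted (i, k - n i) w := by
    intro w i k
    rw [lifted_apply, lifted_apply, map_add, hn]
    push_cast
    ring
  have hg : ∀ i k, g.sign (i, k) = g'.sign (i, k - n i) := by
    intro i k
    rw [← hx, ← hy, ← key]
    simp
  have hh : ∀ i k, (Face.ofPoint A.lifted (z + (x - y))).sign (i, k) = h.sign (i, k - n i) := by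
    intro i k
    rw [Face.ofPoint_sign, key, hz]
  refine ⟨Face.ofPoint A.lifted (z + (x - y)), ?_, ?_, ?_⟩
  · apply Set.Subset.antisymm
    · rintro _ ⟨w, hw, rfl⟩
      refine ⟨w - (x - y), ?_, ?_⟩
      · rintro ⟨i, k⟩
        have h1 := hw (i, k + n i)
        rw [hh, add_sub_cancel_right] at h1
        rw [← h1]
        have h2 := key (w - (x - y)) i (k + n i)
        rw [add_sub_cancel_right, sub_add_cancel] at h2
        rw [h2]
      · rw [map_sub, sub_eq_self]
        exact (Submodule.Quotient.mk_eq_zero _).2 hγ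
    · rintro _ ⟨w, hw, rfl⟩
      refine ⟨w + (x - y), ?_, ?_⟩
      · rintro ⟨i, k⟩
        rw [hh, key, hw]
      · rw [map_add, add_eq_left]
        exact (Submodule.Quotient.mk_eq_zero _).2 hγ
  · rintro ⟨i, k⟩
    rw [hh, hg]
    exact hle _
  · intro i k k' h1 h2
    rw [hg] at h1
    rw [hh, sign_eq_zero_unique h1 h2]

/-- A morphism `F → G` makes `𝒜[G]` a subarrangement of `𝒜[F]`. -/
theorem TFace.Hom.loc {F G : A.TFace} (m : F.Hom G) {i : ι} (h : G.carrier ⊆ A.hyp i) :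
    F.carrier ⊆ A.hyp i := by
  obtain ⟨f, g, hle, hF, hG, -⟩ := m.lifts
  rw [hG, subset_hyp_iff] at h
  obtain ⟨k, hk⟩ := h
  rw [hF, subset_hyp_iff]
  refine ⟨k, ?_⟩
  rcases hle (i, k) with h | h
  · exact h
  · exact h.trans hk

theorem TFace.Hom.dir_eq_zero_iff {F G : A.TFace} (m : F.Hom G) (i : F.Loc) :
    m.dir.sign i = 0 ↔ G.carrier ⊆ A.hyp i.1 := by
  obtain ⟨f, g, hle, hF, hG, hd⟩ := m.lifts
  have hi : Γ.mkQ '' f.carrier ⊆ A.hyp i.1 := hF ▸ i.2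
  rw [subset_hyp_iff] at hi
  obtain ⟨k, hk⟩ := hi
  rw [hG, subset_hyp_iff, ← hd i k hk]
  constructor
  · intro h
    exact ⟨k, h⟩
  · rintro ⟨k', hk'⟩
    have : f.sign (i.1, k') = 0 := by
      rcases hle (i.1, k') with h | h
      · exact h
      · exact h.trans hk'
    rwa [sign_eq_zero_unique hk this]

open Classical in
/-- The inclusion `i_m : ℱ(𝒜[G]) → ℱ(𝒜[F])` induced by a morphism `m : F → G`. -/
@[simps]
def TFace.Hom.incl [Finite ι] {F G : A.TFace} (m : F.Hom G) (K : Face G.arr) : Face F.arr where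
  sign i := if h : G.carrier ⊆ A.hyp i.1 then K.sign ⟨i.1, h⟩ else m.dir.sign i
  realized := by
    obtain ⟨w, hw⟩ := K.realized
    obtain ⟨x, hx⟩ := (Face.proj (Face.ofPoint F.arr w) m.dir).realized
    refine ⟨x, fun i => ?_⟩
    rw [hx, Face.proj_sign]
    by_cases h : G.carrier ⊆ A.hyp i.1
    · rw [if_pos ((m.dir_eq_zero_iff i).2 h), dif_pos h]
      exact hw ⟨i.1, h⟩
    · rw [if_neg (fun h' => h ((m.dir_eq_zero_iff i).1 h')), dif_neg h]

variable [Finite ι]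

instance : Category A.TFace where
  Hom F G := F.Hom G
  id F :=
    { dir := Face.ofPoint F.arr 0
      lifts := by
        obtain ⟨f, hf⟩ := F.isFace
        refine ⟨f, f, le_rfl, hf, hf, fun i k h => ?_⟩
        rw [h]
        simp }
  comp {F G H} m n :=
    { dir := m.incl n.dir
      lifts := by
        obtain ⟨f, g, hfg, hF, hG, hm⟩ := m.lifts
        obtain ⟨g', h, hgh, hG', hH, hn⟩ := n.lifts
        obtain ⟨h', hh', hgh', hs⟩ := exists_translate (hG.symm.trans hG') hgh
        refine ⟨f, h', hfg.trans hgh', hF, hH.trans hh'.symm, fun i k hk => ?_⟩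
        rw [TFace.Hom.incl_sign]
        split_ifs with hi
        · have h2 := hi
          rw [hG', subset_hyp_iff] at h2
          obtain ⟨k', hk'⟩ := h2
          have h3 := hi
          rw [hG, subset_hyp_iff] at h3
          obtain ⟨k'', hk''⟩ := h3
          have h4 : f.sign (i.1, k'') = 0 := by
            rcases hfg (i.1, k'') with h | h
            · exact h
            · exact h.trans hk''
          obtain rfl := sign_eq_zero_unique hk h4
          rw [hs i.1 k k' hk'' hk']
          exact hn ⟨i.1, hi⟩ k' hk'
        · rw [← hm i k hk]
          rcases hgh' (i.1, k) with h | h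
          · exact absurd (by rw [hG, subset_hyp_iff]; exact ⟨k, h⟩) hi
          · exact h.symm }
  id_comp {F G} m := by
    apply TFace.Hom.ext
    ext i
    rw [TFace.Hom.incl_sign, dif_pos i.2]
  comp_id {F G} m := by
    apply TFace.Hom.ext
    ext i
    rw [TFace.Hom.incl_sign]
    split_ifs with h
    · rw [(m.dir_eq_zero_iff i).2 h]
      simp
    · rfl
  assoc {F G H K} m n p := by
    apply TFace.Hom.ext
    ext i
    simp only [TFace.Hom.incl_sign]
    by_cases h : H.carrier ⊆ A.hyp i.1
    · simp [h, n.loc h]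
    · by_cases h' : G.carrier ⊆ A.hyp i.1
      · simp [h, h']
      · simp [h, h']

theorem TFace.id_dir (F : A.TFace) : TFace.Hom.dir (𝟙 F) = Face.ofPoint F.arr 0 := rfl

theorem TFace.comp_dir {F G H : A.TFace} (m : F ⟶ G) (n : G ⟶ H) :
    TFace.Hom.dir (m ≫ n) = TFace.Hom.incl m (TFace.Hom.dir n) := rfl

/-- The order preserving map `[K, C] ↦ [i_m(K), i_m(C)]`. -/
@[simps]
def TFace.Hom.inclCell {F G : A.TFace} (m : F.Hom G) (x : Cell G.arr) : Cell F.arr where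
  face := m.incl x.face
  chamber := m.incl x.chamber
  isChamber i := by
    rw [TFace.Hom.incl_sign]
    split_ifs with h
    · exact x.isChamber _
    · exact fun h' => h ((m.dir_eq_zero_iff i).1 h')
  face_le i := by
    rw [TFace.Hom.incl_sign, TFace.Hom.incl_sign]
    split_ifs with h
    · exact x.face_le _
    · exact Or.inr rfl

theorem TFace.Hom.inclCell_mono {F G : A.TFace} (m : F.Hom G) : Monotone m.inclCell := by
  intro x y hxy
  constructor
  · intro i
    rw [inclCell_face, inclCell_face, incl_sign, incl_sign]
    split_ifs with h
    · exact hxy.1 _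
    · exact Or.inr rfl
  · intro i
    rw [inclCell_face, inclCell_chamber, inclCell_chamber, incl_sign, incl_sign, incl_sign]
    split_ifs with h
    · exact hxy.2 _
    · exact fun _ => rfl

variable (A)

/-- The diagram `𝒟` of posets on `ℱ(𝒜)ᵒᵖ` with `𝒟(F) = 𝒮(𝒜[F])`. -/
def diagram : A.TFaceᵒᵖ ⥤ Preord.{v} where
  obj F := Preord.of (Cell F.unop.arr)
  map m := Preord.ofHom ⟨TFace.Hom.inclCell m.unop, TFace.Hom.inclCell_mono m.unop⟩
  map_id F := by
    refine Preord.hom_ext (OrderHom.ext _ _ (funext fun x => Cell.ext ?_ ?_))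
    · ext i
      exact dif_pos i.2
    · ext i
      exact dif_pos i.2
  map_comp {F G H} m n := by
    have key : ∀ K : Face F.unop.arr, TFace.Hom.incl (n.unop ≫ m.unop) K =
        TFace.Hom.incl n.unop (TFace.Hom.incl m.unop K) := by
      intro K
      ext i
      simp only [TFace.Hom.incl_sign, TFace.comp_dir]
      by_cases h : F.unop.carrier ⊆ A.hyp i.1
      · simp [h, TFace.Hom.loc m.unop h]
      · by_cases h' : G.unop.carrier ⊆ A.hyp i.1
        · simp [h, h']
        · simp [h, h']
    exact Preord.hom_ext (OrderHom.ext _ _ (funext fun x => Cell.ext (key _) (key _)))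

/-- The acyclic category `∫ 𝒟`, whose nerve is the toric Salvetti complex. -/
abbrev SalCat := Grothendieck (A.diagram ⋙ preordToCat)

/-- The toric Salvetti complex `Sal(𝒜)`. -/
abbrev Sal : SSet := nerve A.SalCat

variable {A}

/-- The object `(F, x)` of `∫ 𝒟`. -/
abbrev obj (F : A.TFace) (x : Cell F.arr) : A.SalCat := ⟨op F, x⟩

/-- The arrow `(F, x) → (F, y)` given by `x ≤ y`. -/
def arrow (F : A.TFace) {x y : Cell F.arr} (h : x ≤ y) : obj F x ⟶ obj F y :=
  (Grothendieck.ι (A.diagram ⋙ preordToCat) (op F)).map (X := x) (Y := y)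
    (homOfLE (X := Cell F.arr) h)

end

/-! ### The quotient arrangement and the map `Φ_L` -/

section
variable {V : Type u} [AddCommGroup V] [Module ℝ V] {Γ : Submodule ℤ V} {ι : Type v}
  (A : ToricArrangement Γ ι) (L : Set (V ⧸ Γ))

/-- The lattice of the torus `T / L₀ = (V / X_L) / (image of Γ)`, where `L₀`, the image of `X_L`
in `T = V / Γ`, is the translate of `L` through the identity. -/
abbrev quotLattice : Submodule ℤ (V ⧸ A.tangent L) :=
  Γ.map (A.tangent L).mkQ.toAddMonoidHom.toIntLinearMap

variable {A L} in
theorem tangent_le_ker {i : ι} (h : L ⊆ A.hyp i) : A.tangent L ≤ LinearMap.ker (A.χ i) :=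
  iInf₂_le i h

/-- The quotient arrangement in `T / L₀`: the images `H / L₀` of the hypertori `H` containing
`L`. -/
def quot : ToricArrangement (A.quotLattice L) {i : ι // L ⊆ A.hyp i} where
  χ i := (A.tangent L).liftQ (A.χ i.1) (tangent_le_ker i.2)
  a i := A.a i.1
  primitive i := by
    rw [← A.primitive i.1]
    ext t
    constructor
    · rintro ⟨_, ⟨γ, hγ, rfl⟩, rfl⟩
      exact ⟨γ, hγ, rfl⟩
    · rintro ⟨γ, hγ, rfl⟩
      exact ⟨_, ⟨γ, hγ, rfl⟩, rfl⟩
  distinct i j h := by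
    refine Subtype.ext (A.distinct i.1 j.1 ?_)
    ext v
    exact Set.ext_iff.1 h ((A.tangent L).mkQ v)

theorem quot_lifted (i : {i : ι // L ⊆ A.hyp i}) (k : ℤ) (v : V) :
    (A.quot L).lifted (i, k) ((A.tangent L).mkQ v) = A.lifted (i.1, k) v := rfl

/-- The image in `T / L₀` of a subset of `T`. -/
def image (Y : Set (V ⧸ Γ)) : Set ((V ⧸ A.tangent L) ⧸ A.quotLattice L) :=
  (fun v => (A.quotLattice L).mkQ ((A.tangent L).mkQ v)) '' (Γ.mkQ ⁻¹' Y)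

/-- The map `π_L` on layers: the smallest layer of the quotient arrangement that contains the image
of a given layer. -/
def projLayer [TopologicalSpace V] (Y : Set (V ⧸ Γ)) :
    Set ((V ⧸ A.tangent L) ⧸ A.quotLattice L) :=
  ⋂₀ {Z | (A.quot L).IsLayer Z ∧ A.image L Y ⊆ Z}

theorem quot_linear (i : {i : ι // L ⊆ A.hyp i}) (v : V) :
    (A.quot L).linear i ((A.tangent L).mkQ v) = A.linear i.1 v := rfl

/-- The map `π_L` from the faces of `𝒜₀` to those of the linear arrangement of the quotient: the
smallest face that contains the image. -/
def projLinear (F : Face A.linear) : Face (A.quot L).linear :=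
  F.push (fun i => i.1) (A.tangent L).mkQ (A.quot_linear L)

/-- The map `π_L` on chambers. -/
def projChamber (C : Chamber A.linear) : Chamber (A.quot L).linear :=
  ⟨A.projLinear L C.1, fun i => C.2 i.1⟩

variable {A} in
theorem TFace.exists_point (F : A.TFace) : ∃ v : V, F = A.faceAt v := by
  obtain ⟨f, hf⟩ := F.isFace
  obtain ⟨x, hx⟩ := f.realized
  refine ⟨x, TFace.ext ?_⟩
  have : f = Face.ofPoint A.lifted x := by
    ext j
    exact (hx j).symm
  rw [hf, this]
  rfl

variable {A} in
/-- A point of `V` over a face of the torus. -/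
def TFace.point (F : A.TFace) : V := F.exists_point.choose

variable {A} in
theorem TFace.faceAt_point (F : A.TFace) : A.faceAt F.point = F := F.exists_point.choose_spec.symm

/-- The map `π_L` on faces: the face of the quotient arrangement that contains the image. -/
def projFace (F : A.TFace) : (A.quot L).TFace := (A.quot L).faceAt ((A.tangent L).mkQ F.point)

theorem projFace_eq {F : A.TFace} {f : Face A.lifted} (hF : F.carrier = Γ.mkQ '' f.carrier)
    {x : V} (hx : x ∈ f.carrier) : A.projFace L F = (A.quot L).faceAt ((A.tangent L).mkQ x) := by
  have h1 : Γ.mkQ x ∈ Γ.mkQ '' (Face.ofPoint A.lifted F.point).carrier := by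
    have h2 : (A.faceAt F.point).carrier = F.carrier := by rw [F.faceAt_point]
    have h3 : Γ.mkQ x ∈ F.carrier := hF ▸ ⟨x, hx, rfl⟩
    rw [← h2] at h3
    exact h3
  obtain ⟨y, hy, hxy⟩ := h1
  have hγ : x - y ∈ Γ := by
    rw [← Submodule.Quotient.eq]
    exact hxy.symm
  have e1 : A.projFace L F = (A.quot L).faceAt ((A.tangent L).mkQ y) := by
    have : Face.ofPoint (A.quot L).lifted ((A.tangent L).mkQ F.point) =
        Face.ofPoint (A.quot L).lifted ((A.tangent L).mkQ y) := by
      ext j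
      exact (hy (j.1.1, j.2)).symm
    apply TFace.ext
    simp only [projFace, faceAt, this]
  rw [e1]
  apply TFace.ext
  have hδ : (A.tangent L).mkQ (x - y) ∈ A.quotLattice L := ⟨_, hγ, rfl⟩
  have key : ∀ j k, (A.quot L).lifted (j, k) ((A.tangent L).mkQ x) =
      (A.quot L).lifted (j, k) ((A.tangent L).mkQ y + (A.tangent L).mkQ (x - y)) := by
    intro j k
    rw [← map_add, add_sub_cancel]
  choose n hn using fun j => exists_int (A := A.quot L) j hδ
  have shift : ∀ (w : V ⧸ A.tangent L) j (k : ℤ), (A.quot L).lifted (j, k)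
      (w + (A.tangent L).mkQ (x - y)) = (A.quot L).lifted (j, k - n j) w := by
    intro w j k
    rw [lifted_apply, lifted_apply, map_add, hn]
    push_cast
    ring
  apply Set.Subset.antisymm
  · rintro _ ⟨w, hw, rfl⟩
    refine ⟨w + (A.tangent L).mkQ (x - y), ?_, ?_⟩
    · rintro ⟨j, k⟩
      rw [shift, Face.ofPoint_sign, key, shift]
      exact hw _
    · rw [map_add, add_eq_left]
      exact (Submodule.Quotient.mk_eq_zero _).2 hδ
  · rintro _ ⟨w, hw, rfl⟩
    refine ⟨w - (A.tangent L).mkQ (x - y), ?_, ?_⟩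
    · rintro ⟨j, k⟩
      have h1 := hw (j, k + n j)
      rw [Face.ofPoint_sign, key, shift, add_sub_cancel_right] at h1
      rw [Face.ofPoint_sign, ← h1]
      have h2 := shift (w - (A.tangent L).mkQ (x - y)) j (k + n j)
      rw [add_sub_cancel_right, sub_add_cancel] at h2
      rw [h2]
    · rw [map_sub, sub_eq_self]
      exact (Submodule.Quotient.mk_eq_zero _).2 hδ

theorem projFace_subset_iff (F : A.TFace) (i : {i : ι // L ⊆ A.hyp i}) :
    (A.projFace L F).carrier ⊆ (A.quot L).hyp i ↔ F.carrier ⊆ A.hyp i.1 := by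
  obtain ⟨f, hf⟩ := F.isFace
  obtain ⟨x, hx⟩ := f.realized
  rw [projFace_eq A L hf hx]
  change (A.quotLattice L).mkQ '' _ ⊆ _ ↔ _
  rw [hf, subset_hyp_iff, subset_hyp_iff]
  refine exists_congr fun k => ?_
  rw [Face.ofPoint_sign, quot_lifted, hx]

/-- The inclusion of the index set of the local arrangement at `π_L(F)` into that at `F`. -/
def locMap (F : A.TFace) (i : (A.projFace L F).Loc) : F.Loc :=
  ⟨i.1.1, (A.projFace_subset_iff L F i.1).1 i.2⟩

theorem projFace_arr (F : A.TFace) (i : (A.projFace L F).Loc) (v : V) :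
    (A.projFace L F).arr i ((A.tangent L).mkQ v) = F.arr (A.locMap L F i) v := rfl

/-- The map `π_L^F : ℱ(𝒜[F]) → ℱ(𝒜̄_L[π_L(F)])`: the smallest face that contains the image. -/
def projLocal (F : A.TFace) (K : Face F.arr) : Face (A.projFace L F).arr :=
  K.push (A.locMap L F) (A.tangent L).mkQ (A.projFace_arr L F)

@[simp]
theorem projLocal_sign (F : A.TFace) (K : Face F.arr) (i : (A.projFace L F).Loc) :
    (A.projLocal L F K).sign i = K.sign (A.locMap L F i) := rfl

/-- The map `𝒮(𝒜[F]) → 𝒮(𝒜̄_L[π_L(F)])`, `[K, C] ↦ [π_L^F(K), π_L^F(C)]`. -/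
@[simps]
def projCell (F : A.TFace) (x : Cell F.arr) : Cell (A.projFace L F).arr where
  face := A.projLocal L F x.face
  chamber := A.projLocal L F x.chamber
  isChamber _ := x.isChamber _
  face_le _ := x.face_le _

variable [Finite ι]

theorem projLocal_incl {F G : A.TFace} (m : F ⟶ G) (m' : A.projFace L F ⟶ A.projFace L G)
    (h : TFace.Hom.dir m' = A.projLocal L F (TFace.Hom.dir m)) (K : Face G.arr) :
    A.projLocal L F (TFace.Hom.incl m K) = TFace.Hom.incl m' (A.projLocal L G K) := by
  ext i
  rw [projLocal_sign, TFace.Hom.incl_sign, TFace.Hom.incl_sign]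
  by_cases hG : G.carrier ⊆ A.hyp i.1.1
  · rw [dif_pos (show G.carrier ⊆ A.hyp (A.locMap L F i).1 from hG),
      dif_pos ((A.projFace_subset_iff L G i.1).2 hG)]
    rfl
  · rw [dif_neg (show ¬ G.carrier ⊆ A.hyp (A.locMap L F i).1 from hG),
      dif_neg (fun h' => hG ((A.projFace_subset_iff L G i.1).1 h')), h]
    rfl

/-- The functor `π_L` from the face category of the arrangement to that of the quotient. -/
def projFunctor : A.TFace ⥤ (A.quot L).TFace where
  obj F := A.projFace L F
  map {F G} m :=
    { dir := A.projLocal L F (TFace.Hom.dir m)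
      lifts := by
        obtain ⟨f, g, hfg, hF, hG, hm⟩ := TFace.Hom.lifts m
        obtain ⟨x, hx⟩ := f.realized
        obtain ⟨y, hy⟩ := g.realized
        refine ⟨Face.ofPoint _ ((A.tangent L).mkQ x), Face.ofPoint _ ((A.tangent L).mkQ y), ?_,
          ?_, ?_, ?_⟩
        · rintro ⟨j, k⟩
          rw [Face.ofPoint_sign, Face.ofPoint_sign, quot_lifted, quot_lifted, hx, hy]
          exact hfg _
        · rw [projFace_eq A L hF hx]
          rfl
        · rw [projFace_eq A L hG hy]
          rfl
        · intro i k
          rw [Face.ofPoint_sign, Face.ofPoint_sign, quot_lifted, quot_lifted, hx, hy]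
          exact hm (A.locMap L F i) k }
  map_id F := by
    apply TFace.Hom.ext
    ext i
    change (TFace.Hom.dir (𝟙 F)).sign _ = (TFace.Hom.dir (𝟙 (A.projFace L F))).sign i
    rw [TFace.id_dir, TFace.id_dir, Face.ofPoint_sign, Face.ofPoint_sign]
    simp
  map_comp {F G H} m n := by
    apply TFace.Hom.ext
    exact A.projLocal_incl L m (G := G) _ rfl _

/-- The natural transformation with components
`𝒮(𝒜[F]) → 𝒮(𝒜̄_L[π_L(F)])`, `[K, C] ↦ [π_L^F(K), π_L^F(C)]`. -/
def projNat : A.diagram ⟶ (A.projFunctor L).op ⋙ (A.quot L).diagram where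
  app F := Preord.ofHom
    ⟨A.projCell L F.unop, fun _ _ h => ⟨fun _ => h.1 _, fun _ => h.2 _⟩⟩
  naturality _ _ m :=
    Preord.hom_ext (OrderHom.ext _ _ (funext fun x => Cell.ext
      (A.projLocal_incl L m.unop ((A.projFunctor L).map m.unop) rfl x.face)
      (A.projLocal_incl L m.unop ((A.projFunctor L).map m.unop) rfl x.chamber)))

/-- The functor `∫ 𝒟(𝒜) → ∫ 𝒟(𝒜̄_L)` induced by the natural transformation. -/
def PhiFunctor : A.SalCat ⥤ (A.quot L).SalCat :=
  Grothendieck.map (F := A.diagram ⋙ preordToCat)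
      (G := (A.projFunctor L).op ⋙ ((A.quot L).diagram ⋙ preordToCat))
      (Functor.whiskerRight (A.projNat L) preordToCat) ⋙
    Grothendieck.pre ((A.quot L).diagram ⋙ preordToCat) (A.projFunctor L).op

/-- The cellular map `Φ_L : Sal(𝒜) → Sal(𝒜̄_L)`. -/
def Phi : A.Sal ⟶ (A.quot L).Sal := nerveMap (A.PhiFunctor L)

end

end ToricArrangement

/-! ### Full subcomplexes and first homology -/

/-- The full subcomplex of the nerve of a category on a set of objects: the nerve of the full
subcategory on these objects. -/
def fullSubcomplex {C : Type*} [Category C] (S : Set C) : (nerve C).Subcomplex where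
  obj n := fun s : ComposableArrows C n.unop.len => ∀ i : Fin (n.unop.len + 1), s.obj i ∈ S
  map f _ hs i := hs ((SimplexCategory.toCat.map f.unop).toFunctor.obj i)

universe w

/-- The module `ℤ`; an element of a `ℤ`-module `M` is the same as a morphism `ℤ ⟶ M`. -/
abbrev intModule : ModuleCat.{w} ℤ := ModuleCat.of ℤ (ULift.{w} ℤ)

/-- The first simplicial homology group with integral coefficients. -/
abbrev H₁ (X : SSet.{w}) : ModuleCat.{w} ℤ := X.homology intModule 1

/-- The map induced on first homology. -/
abbrev H₁map {X Y : SSet.{w}} (f : X ⟶ Y) : H₁ X ⟶ H₁ Y := SSet.homologyMap f intModule 1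

/-- The simplicial `1`-chains of `X`. -/
abbrev Chain₁ (X : SSet.{w}) : ModuleCat.{w} ℤ := (X.chainComplex intModule).X 1

/-- The simplicial `1`-chain with given coefficients. -/
def chain {X : SSet.{w}} (c : X _⦋1⦌ →₀ ℤ) : intModule ⟶ Chain₁ X :=
  c.sum fun e n => n • X.ιChainComplex e

/-- A `1`-chain is a cycle if its boundary vanishes. -/
def IsCycle {X : SSet.{w}} (z : intModule ⟶ Chain₁ X) : Prop :=
  z ≫ (X.chainComplex intModule).d 1 0 = 0

/-- The homology class of a `1`-cycle. -/
def homologyClass {X : SSet.{w}} (z : intModule ⟶ Chain₁ X) (hz : IsCycle z) :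
    intModule ⟶ H₁ X :=
  (X.chainComplex intModule).liftCycles z 0 (by simp) hz ≫ (X.chainComplex intModule).homologyπ 1

/-- The `1`-simplex of the nerve given by an arrow. -/
abbrev edgeOf {C : Type*} [Category C] {x y : C} (f : x ⟶ y) : (nerve C) _⦋1⦌ :=
  ComposableArrows.mk₁ f

theorem edgeOf_d {C : Type*} [Category C] {x y : C} (f : x ⟶ y) :
    (nerve C).ιChainComplex (R := intModule) (edgeOf f) ≫
      ((nerve C).chainComplex intModule).d 1 0 =
      (nerve C).ιChainComplex (n := 0) (ComposableArrows.mk₀ y) -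
        (nerve C).ιChainComplex (n := 0) (ComposableArrows.mk₀ x) := by
  have h0 : (nerve C).δ (0 : Fin 2) (edgeOf f) = ComposableArrows.mk₀ y :=
    ComposableArrows.ext₀ rfl
  have h1 : (nerve C).δ (1 : Fin 2) (edgeOf f) = ComposableArrows.mk₀ x :=
    ComposableArrows.ext₀ rfl
  rw [SSet.ιChainComplex_d, Fin.sum_univ_two, h0, h1]
  simp [sub_eq_add_neg]

namespace ToricArrangement

variable {V : Type u} [AddCommGroup V] [Module ℝ V] {Γ : Submodule ℤ V} {ι : Type v} [Finite ι]
  (A : ToricArrangement Γ ι)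

/-! ### The subcomplexes `𝒮_{Y, F₀}` -/

/-- The objects of `𝒮_{Y, F₀} = ∫ 𝒟_{Y, F₀}`: the pairs `(F, x)` with `F ⊆ Y` and
`x ∈ 𝒮^{F₀}(𝒜[F])`. -/
def starObjects (Y : Set (V ⧸ Γ)) (F₀ : Face A.linear) : Set A.SalCat :=
  {x | ∃ F : A.TFace, F.carrier ⊆ Y ∧ ∃ y ∈ Cell.star (F.localize F₀), x = obj F y}

/-- The subcomplex `𝒮_{Y, F₀}` of the toric Salvetti complex. -/
def starComplex (Y : Set (V ⧸ Γ)) (F₀ : Face A.linear) : A.Sal.Subcomplex :=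
  fullSubcomplex (A.starObjects Y F₀)

/-! ### The loops `Λ_B^M` -/

/-- `D` is the chamber separated from `C` by exactly the hyperplanes of `𝒜₀` containing `X`. If `C`
is adjacent to `X` this is `op_X(C)`. -/
def IsOp (X : Submodule ℝ V) (C D : Chamber A.linear) : Prop :=
  ∀ i, (X ≤ LinearMap.ker (A.χ i) → D.1.sign i = - C.1.sign i) ∧
    (¬ X ≤ LinearMap.ker (A.χ i) → D.1.sign i = C.1.sign i)

/-- The choices that enter the construction of `Λ_B^M`: a chamber `C 0` adjacent to `X_M` (some
face of `C 0` has linear hull `X_M`) and a minimal gallery `C 0, …, C k = op_{X_M}(-C 0)`. -/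
def IsLoopGallery (M : Set (V ⧸ Γ)) (k : ℕ) (C : ℕ → Chamber A.linear) : Prop :=
  (∃ R : Face A.linear, R ≤ (C 0).1 ∧ R.hull = A.tangent M) ∧
    A.IsOp (A.tangent M) (C 0).neg (C k) ∧ IsMinimalGallery k C

section
variable {A}

/-- `W` is the wall of `𝒜[F]` that separates the chambers `C(F) ≠ C'(F)`. -/
def TFace.IsLocalWall (F : A.TFace) (C C' : Chamber A.linear) (W : Face F.arr) : Prop :=
  F.localizeChamber C ≠ F.localizeChamber C' ∧
    IsWall W (F.localizeChamber C) (F.localizeChamber C')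

/-- The vertex `(F, [C(F), C(F)])`. -/
abbrev TFace.vertexObj (F : A.TFace) (C : Chamber A.linear) : A.SalCat :=
  obj F (Cell.vertex (F.localizeChamber C))

/-- The object `(F, [W, B(F)_W])`. -/
abbrev TFace.edgeObj (F : A.TFace) (W : Face F.arr) (B : Chamber A.linear) : A.SalCat :=
  obj F (Cell.edge W (F.localizeChamber B))

end

/-- The objects of `Λ_B^M`: all pairs `(F, X)` with `F ⊆ M` and `X ∈ Path(B; M, F)`. -/
def loopObjects (M : Set (V ⧸ Γ)) (k : ℕ) (C : ℕ → Chamber A.linear) (B : Chamber A.linear) :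
    Set A.SalCat :=
  {x | ∃ F : A.TFace, F.carrier ⊆ M ∧
    ((∃ n ≤ k, x = F.vertexObj (C n)) ∨
      ∃ n < k, ∃ W : Face F.arr, F.IsLocalWall (C n) (C (n + 1)) W ∧ x = F.edgeObj W B)}

/-- The loop `Λ_B^M`, as a subcomplex of the toric Salvetti complex. -/
def loopComplex (M : Set (V ⧸ Γ)) (k : ℕ) (C : ℕ → Chamber A.linear) (B : Chamber A.linear) :
    A.Sal.Subcomplex :=
  fullSubcomplex (A.loopObjects M k C B)

open Classical in
/-- The coefficient in the fundamental cycle `[Λ_B^M]` of an arrow `x → y` of `∫ 𝒟`. The cycle runs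
through the arrows
`(P, v_n) → (P, e_n)` with coefficient `1`, `(P, v_{n+1}) → (P, e_n)` with coefficient `-1`,
`(G, v) → (P, v_0)` with coefficient `1` and `(G, v) → (P, v_k)` with coefficient `-1`,
for the vertices `P` and the edges `G` of `M`. -/
def loopCoeff (M : Set (V ⧸ Γ)) (k : ℕ) (C : ℕ → Chamber A.linear) (B : Chamber A.linear)
    (x y : A.SalCat) : ℤ :=
  (if ∃ P : A.TFace, P.carrier ⊆ M ∧ ∃ n < k, ∃ W : Face P.arr,
      P.IsLocalWall (C n) (C (n + 1)) W ∧ x = P.vertexObj (C n) ∧ y = P.edgeObj W B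
    then 1 else 0) -
  (if ∃ P : A.TFace, P.carrier ⊆ M ∧ ∃ n < k, ∃ W : Face P.arr,
      P.IsLocalWall (C n) (C (n + 1)) W ∧ x = P.vertexObj (C (n + 1)) ∧ y = P.edgeObj W B
    then 1 else 0) +
  (if ∃ G P : A.TFace, G.carrier ⊆ M ∧ P.carrier ⊆ M ∧ G ≠ P ∧
      x = G.vertexObj (C 0) ∧ y = P.vertexObj (C 0) then 1 else 0) -
  (if ∃ G P : A.TFace, G.carrier ⊆ M ∧ P.carrier ⊆ M ∧ G ≠ P ∧
      x = G.vertexObj (C 0) ∧ y = P.vertexObj (C k) then 1 else 0)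

/-- `c` is the family of coefficients of the fundamental cycle `[Λ_B^M]`. -/
def IsLoopChain (M : Set (V ⧸ Γ)) (k : ℕ) (C : ℕ → Chamber A.linear) (B : Chamber A.linear)
    (c : A.Sal _⦋1⦌ →₀ ℤ) : Prop :=
  ∀ e : ComposableArrows A.SalCat 1, c e = A.loopCoeff M k C B e.left e.right

/-! ### The loops `Ω^{(m)}` and the classes of loops around hypertori -/

section
variable {A}

/-- The chamber `C_1 = C(F)_{F_m}` of `𝒜[F]`. -/
def TFace.Hom.side₁ {F G : A.TFace} (m : F.Hom G) (C : Chamber A.linear) : Chamber F.arr :=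
  ⟨_, (Cell.edge m.dir (F.localizeChamber C)).isChamber⟩

/-- The chamber `C_2 = (-C(F))_{F_m}` of `𝒜[F]`. -/
def TFace.Hom.side₂ {F G : A.TFace} (m : F.Hom G) (C : Chamber A.linear) : Chamber F.arr :=
  ⟨_, (Cell.edge m.dir (F.localizeChamber C).neg).isChamber⟩

theorem TFace.Hom.dir_le_side₁ {F G : A.TFace} (m : F.Hom G) (C : Chamber A.linear) :
    m.dir ≤ (m.side₁ C).1 := (Cell.edge m.dir (F.localizeChamber C)).face_le

theorem TFace.Hom.dir_le_side₂ {F G : A.TFace} (m : F.Hom G) (C : Chamber A.linear) :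
    m.dir ≤ (m.side₂ C).1 := (Cell.edge m.dir (F.localizeChamber C).neg).face_le

/-- The element `[F_m, C_1]`. -/
def TFace.Hom.cell₁ {F G : A.TFace} (m : F.Hom G) (C : Chamber A.linear) : Cell F.arr :=
  ⟨m.dir, (m.side₁ C).1, (m.side₁ C).2, m.dir_le_side₁ C⟩

/-- The element `[F_m, C_2]`. -/
def TFace.Hom.cell₂ {F G : A.TFace} (m : F.Hom G) (C : Chamber A.linear) : Cell F.arr :=
  ⟨m.dir, (m.side₂ C).1, (m.side₂ C).2, m.dir_le_side₂ C⟩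

/-- The subcomplex `Ω^{(m)}`, with vertices `(F, [C_1, C_1])`, `(F, [F_m, C_1])`, `(F, [C_2, C_2])`
and `(F, [F_m, C_2])`. -/
def TFace.Hom.circle {F G : A.TFace} (m : F.Hom G) (C : Chamber A.linear) : A.Sal.Subcomplex :=
  fullSubcomplex {obj F (Cell.vertex (m.side₁ C)), obj F (m.cell₁ C),
    obj F (Cell.vertex (m.side₂ C)), obj F (m.cell₂ C)}

/-- The `1`-cycle `[Ω^{(m)}]`, in which the edge from `(F, [C_1, C_1])` to `(F, [F_m, C_1])` has
coefficient `1`. -/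
def TFace.Hom.circleChain {F G : A.TFace} (m : F.Hom G) (C : Chamber A.linear) :
    intModule ⟶ Chain₁ A.Sal :=
  A.Sal.ιChainComplex (edgeOf (arrow F (x := Cell.vertex (m.side₁ C)) (y := m.cell₁ C)
      (Cell.vertex_le (m.dir_le_side₁ C)))) -
    A.Sal.ιChainComplex (edgeOf (arrow F (x := Cell.vertex (m.side₂ C)) (y := m.cell₁ C)
      (Cell.vertex_le (m.dir_le_side₂ C)))) +
    A.Sal.ιChainComplex (edgeOf (arrow F (x := Cell.vertex (m.side₂ C)) (y := m.cell₂ C)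
      (Cell.vertex_le (m.dir_le_side₂ C)))) -
    A.Sal.ιChainComplex (edgeOf (arrow F (x := Cell.vertex (m.side₁ C)) (y := m.cell₂ C)
      (Cell.vertex_le (m.dir_le_side₁ C))))

theorem TFace.Hom.circleChain_isCycle {F G : A.TFace} (m : F.Hom G) (C : Chamber A.linear) :
    IsCycle (m.circleChain C) := by
  unfold IsCycle circleChain
  rw [Preadditive.sub_comp, Preadditive.add_comp, Preadditive.sub_comp, edgeOf_d, edgeOf_d,
    edgeOf_d, edgeOf_d]
  abel

/-- The homology class of `[Ω^{(m)}]`. -/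
def TFace.Hom.circleClass {F G : A.TFace} (m : F.Hom G) (C : Chamber A.linear) :
    intModule ⟶ H₁ A.Sal :=
  homologyClass (m.circleChain C) (m.circleChain_isCycle C)

end

/-- `w` is the class `ω̂_H` of the hypertorus `H` with index `i` (for the choice `C` of a chamber of
`𝒜₀`): the class of the cycle `[Ω^{(m)}]` of a morphism `m : F → G` with `supp(G) = H`. -/
def IsOmegaHat [TopologicalSpace V] (i : ι) (C : Chamber A.linear) (w : intModule ⟶ H₁ A.Sal) :
    Prop :=
  ∃ (F G : A.TFace) (m : F ⟶ G), G.supp = A.hyp i ∧ w = TFace.Hom.circleClass m C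

end ToricArrangement

end ToricSalvetti

end

open ToricSalvetti

/-!
The functor inducing `Φ_L` forgets the signs of faces and chambers on the hyperplanes of hypertori
that do not contain `L`, and projects faces of the torus along `X_L`. All three parts follow from
this description and from one-dimensional homology of nerves, for which it suffices to compute
`1`-chains modulo boundaries: there an identity arrow is zero and composition of arrows becomes
addition (`arrowClass_comp`).

For the loops `Λ_B^M` with `X_M ⊆ X_L`, a minimal gallery crosses only hyperplanes that separate its
ends, and each of them once (`IsMinimalGallery.crossing`). The ends of the gallery of a loop are not
separated by the hyperplanes containing `X_M`, so that after projection neither the chambers nor the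
walls of the gallery can be told apart; and all points over `M` differ by tangent vectors of `M`
modulo the lattice, so that all faces of `M` have the same projection (`IsLayer.projFace_eq`). Hence
the functor is constant on the loop. That the fundamental chain is a cycle with finite support rests
on the finiteness of the set of faces (`finite_tFace`), on telescoping along the gallery over each
vertex of `M` (`sum_crossing_eq`), and on a description of the arrows between objects over different
faces of `M`: they correspond to the edges of the circle `M` starting at a vertex in a given
direction. Since the arrangement is essential, each vertex is the start of one edge and each edge
starts at one vertex (`IsLayer.exists_starts_of_isEdgeOf`, `Starts.vertex_unique`), in either
direction (`sum_start_eq`).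

For the circles, a face with support `H` lies in no other hypertorus than `H`, so that the projection
identifies the local arrangements whenever `H ⊇ L`, and otherwise makes `F_m` a chamber, which
collapses the circle. The homology class of `Ω^{(m)}` does not depend on `m`
(`chainClass_circleChain_eq`): passing from `F` to a bigger face within `H` is a natural
transformation between two inclusions of posets, and for two facets of `H` at a common face `F` the
two circles are compared through the cones `𝒮_D`, `𝒮_{D'}` over a pair of chambers that differ in
`H` only; the class is thus locally constant along the hyperplane over `H`, which is convex and hence
connected.

The statement about `𝒮_{Y, F₀}` is a comparison of signs, together with the fact that a face that
meets a layer is contained in it (`IsLayer.face_subset`).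
-/

namespace ToricSalvetti

/-! ### Walls and minimal galleries of central arrangements -/

/-- An affine function `a - t * b` of `t` changes its sign only at a zero. -/
theorem sign_sub_mul_eq_or_exists_zero {a b t₀ : ℝ} (h0 : 0 < t₀) (ha : a ≠ 0) :
    SignType.sign (a - t₀ * b) = 0 ∨ SignType.sign (a - t₀ * b) = SignType.sign a ∨
      ∃ t, 0 < t ∧ t < t₀ ∧ a = t * b := by
  by_contra! hcon
  obtain ⟨hne, hne', hz⟩ := hcon
  have hs : a * (a - t₀ * b) < 0 := by
    rcases lt_or_gt_of_ne ha with h1 | h1 <;>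
      rcases lt_trichotomy (a - t₀ * b) 0 with h2 | h2 | h2
    · exact absurd (by rw [sign_neg h1, sign_neg h2]) hne'
    · exact absurd (by rw [h2, sign_zero]) hne
    · exact mul_neg_of_neg_of_pos h1 h2
    · exact mul_neg_of_pos_of_neg h1 h2
    · exact absurd (by rw [h2, sign_zero]) hne
    · exact absurd (by rw [sign_pos h1, sign_pos h2]) hne'
  have hb : b ≠ 0 := by
    rintro hb
    rw [hb] at hs
    nlinarith [mul_self_pos.2 ha]
  have hpos : 0 < a * b := by
    by_contra! hle
    nlinarith [mul_self_pos.2 ha]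
  refine hz (a / b) ?_ ?_ (by field_simp)
  · rcases pos_and_pos_or_neg_and_neg_of_mul_pos hpos with ⟨h1, h2⟩ | ⟨h1, h2⟩
    · exact div_pos h1 h2
    · exact div_pos_of_neg_of_neg h1 h2
  · rcases pos_and_pos_or_neg_and_neg_of_mul_pos hpos with ⟨h1, h2⟩ | ⟨h1, h2⟩
    · rw [div_lt_iff₀ h2]
      nlinarith
    · rw [div_lt_iff_of_neg h2]
      nlinarith

/-- Among finitely many affine functions `a l - t * b l` of `t` that do not vanish at `t = 0`, take
the first positive time at which one of them vanishes: until then no sign changes. -/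
theorem exists_first_zero {J : Type*} [Finite J] (s : Set J) (a b : J → ℝ)
    (ha : ∀ l ∈ s, a l ≠ 0) (h : ∃ l ∈ s, ∃ t : ℝ, 0 < t ∧ a l = t * b l) :
    ∃ t : ℝ, 0 < t ∧ (∃ l ∈ s, a l = t * b l) ∧
      ∀ l ∈ s, SignType.sign (a l - t * b l) = 0 ∨
        SignType.sign (a l - t * b l) = SignType.sign (a l) := by
  have hfin : Set.Finite {t | (0 : ℝ) < t ∧ ∃ l ∈ s, a l = t * b l} := by
    refine (Set.finite_range fun l => a l / b l).subset ?_
    rintro t ⟨ht, l, hl, e⟩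
    have hb : b l ≠ 0 := by
      rintro hb
      exact ha l hl (by rw [e, hb, mul_zero])
    exact ⟨l, by simp only; rw [e]; field_simp⟩
  obtain ⟨l, hl, t, ht, e⟩ := h
  obtain ⟨t₀, ⟨h0, l₀, hl₀, e₀⟩, hmin⟩ := hfin.exists_minimal ⟨t, ht, l, hl, e⟩
  refine ⟨t₀, h0, ⟨l₀, hl₀, e₀⟩, fun l hl => ?_⟩
  rcases sign_sub_mul_eq_or_exists_zero (b := b l) h0 (ha l hl) with h | h | ⟨t, ht, htt, h⟩
  · exact Or.inl h
  · exact Or.inr h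
  · exact absurd (hmin ⟨ht, l, hl, h⟩ htt.le) (not_le.2 htt)

section Central

variable {J : Type*} {V : Type*} [AddCommGroup V] [Module ℝ V] {χ : J → V →ₗ[ℝ] ℝ}

/-- If two forms of a central arrangement have the same kernel, either both of them or none
separates two given chambers. -/
theorem Chamber.sign_eq_of_ker_eq {i j : J} (h : LinearMap.ker (χ i) = LinearMap.ker (χ j))
    {C D : Face (central χ)} (hC : C.IsChamber) (hD : D.IsChamber) (hj : C.sign j = D.sign j) :
    C.sign i = D.sign i := by
  obtain ⟨c, hc⟩ := C.realized
  obtain ⟨d, hd⟩ := D.realized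
  have hcj : χ j c ≠ 0 := fun h0 => hC j (by rw [← hc j]; simp [h0])
  have hdj : χ j d ≠ 0 := fun h0 => hD j (by rw [← hd j]; simp [h0])
  have hci : χ i c ≠ 0 := fun h0 => hC i (by rw [← hc i]; simp [h0])
  have hsgn : SignType.sign (χ j c) = SignType.sign (χ j d) := by
    have := hc j; have := hd j
    simp_all
  have ht : 0 < χ j c / χ j d := by
    rcases lt_or_gt_of_ne hcj with h1 | h1
    · rw [sign_neg h1, eq_comm, sign_eq_neg_one_iff] at hsgn
      exact div_pos_of_neg_of_neg h1 hsgn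
    · rw [sign_pos h1, eq_comm, sign_eq_one_iff] at hsgn
      exact div_pos h1 hsgn
  have hk : c - (χ j c / χ j d) • d ∈ LinearMap.ker (χ i) := by
    rw [h, LinearMap.mem_ker, map_sub, map_smul, smul_eq_mul]
    field_simp
    simp
  rw [LinearMap.mem_ker, map_sub, map_smul, smul_eq_mul, sub_eq_zero] at hk
  rw [← hc i, ← hd i]
  change SignType.sign (χ i c) = SignType.sign (χ i d)
  rw [hk, sign_mul, sign_pos ht, one_mul]

theorem Face.sign_eq_zero_iff_mem_ker {F : Face (central χ)} {x : V} (hx : x ∈ F.carrier) (j : J) :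
    F.sign j = 0 ↔ x ∈ LinearMap.ker (χ j) := by
  rw [← hx j, sign_eq_zero_iff]
  rfl

theorem Face.sign_eq_zero_of_ker_eq {i j : J} (h : LinearMap.ker (χ i) = LinearMap.ker (χ j))
    {F : Face (central χ)} (hj : F.sign j = 0) : F.sign i = 0 := by
  obtain ⟨x, hx⟩ := F.realized
  rw [Face.sign_eq_zero_iff_mem_ker hx] at hj ⊢
  rwa [h]

variable [Finite J]

/-- The hyperplanes containing a wall of a chamber coincide. -/
theorem ker_le_of_covBy {W C : Face (central χ)} (hC : C.IsChamber) (hW : W ⋖ C) {i j : J}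
    (hi : W.sign i = 0) (hj : W.sign j = 0) : LinearMap.ker (χ i) ≤ LinearMap.ker (χ j) := by
  by_contra hcon
  obtain ⟨u, hui, huj⟩ := SetLike.not_le_iff_exists.1 hcon
  rw [LinearMap.mem_ker] at hui huj
  obtain ⟨c, hc⟩ := C.realized
  have hc0 : ∀ l, χ l c ≠ 0 := fun l h0 => hC l (by rw [← hc l]; simp [h0])
  -- moving from `c` along a multiple of `u` one meets the hyperplane `j`, but not `i`
  obtain ⟨t, ht, ⟨l₀, hl₀, e₀⟩, hs⟩ := exists_first_zero {l | W.sign l = 0} (fun l => χ l c)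
    (fun l => χ l ((χ j c / χ j u) • u)) (fun l _ => hc0 l)
    ⟨j, hj, 1, one_pos, by rw [map_smul, smul_eq_mul]; field_simp⟩
  set z := c - t • ((χ j c / χ j u) • u) with hz
  have hzl : ∀ l, χ l z = χ l c - t * χ l ((χ j c / χ j u) • u) := by
    intro l
    rw [hz, map_sub, map_smul, smul_eq_mul]
  set G := (Face.ofPoint (central χ) z).proj W with hG
  have hGs : ∀ l, W.sign l = 0 → G.sign l = SignType.sign (χ l z) := by
    intro l hl
    rw [hG, Face.proj_sign, if_pos hl]
    rfl
  have hWG : W ≤ G := by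
    intro l
    by_cases hl : W.sign l = 0
    · exact Or.inl hl
    · right
      rw [hG, Face.proj_sign, if_neg hl]
  have hGC : G ≤ C := by
    intro l
    by_cases hl : W.sign l = 0
    · rw [hGs l hl, hzl, ← hc l]
      exact hs l hl
    · right
      rw [hG, Face.proj_sign, if_neg hl]
      exact (hW.1.le l).resolve_left hl
  have hWG' : W ≠ G := by
    intro e
    have h1 : G.sign i = 0 := e ▸ hi
    rw [hGs i hi, sign_eq_zero_iff, hzl, map_smul, hui] at h1
    exact hc0 i (by simpa using h1)
  have hGC' : G ≠ C := by
    intro e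
    refine hC l₀ ?_
    rw [← e, hGs l₀ hl₀, hzl, e₀, sub_self, sign_zero]
  exact hW.2 (lt_of_le_of_ne hWG hWG') (lt_of_le_of_ne hGC hGC')

theorem ker_eq_of_covBy {W C : Face (central χ)} (hC : C.IsChamber) (hW : W ⋖ C) {i j : J}
    (hi : W.sign i = 0) (hj : W.sign j = 0) : LinearMap.ker (χ i) = LinearMap.ker (χ j) :=
  le_antisymm (ker_le_of_covBy hC hW hi hj) (ker_le_of_covBy hC hW hj hi)

omit [Finite J] in
theorem Face.exists_sign_ne_of_lt {F G : Face (central χ)} (h : F < G) :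
    ∃ j, F.sign j = 0 ∧ G.sign j ≠ 0 := by
  by_contra! hcon
  refine h.ne (Face.ext (funext fun j => ?_))
  rcases h.le j with hj | hj
  · rw [hj, hcon j hj]
  · exact hj

omit [Finite J] in
/-- A proper face of a chamber that lies in a single hyperplane is a wall. -/
theorem covBy_of_ker_eq {W C : Face (central χ)} (hC : C.IsChamber) (hle : W ≤ C)
    (hex : ∃ j, W.sign j = 0)
    (hker : ∀ i j, W.sign i = 0 → W.sign j = 0 → LinearMap.ker (χ i) = LinearMap.ker (χ j)) :
    W ⋖ C := by
  obtain ⟨j, hj⟩ := hex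
  refine ⟨lt_of_le_of_ne hle fun e => hC j (e ▸ hj), fun G hWG hGC => ?_⟩
  obtain ⟨i, hi, hi'⟩ := Face.exists_sign_ne_of_lt hWG
  obtain ⟨l, hl, -⟩ := Face.exists_sign_ne_of_lt hGC
  have hWl : W.sign l = 0 := by
    rcases hWG.le l with h | h
    · exact h
    · exact h.trans hl
  exact hi' (Face.sign_eq_zero_of_ker_eq (hker i l hi hWl) hl)

/-- Of two different chambers, the first has a wall that separates it from the second. -/
theorem exists_separating_wall {C D : Face (central χ)} (hC : C.IsChamber) (hD : D.IsChamber)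
    (hne : C ≠ D) : ∃ W : Face (central χ), W ⋖ C ∧ ∃ j, W.sign j = 0 ∧ C.sign j ≠ D.sign j := by
  -- a face of `C` in a separating hyperplane, contained in as few hyperplanes as possible
  have hne' : Set.Nonempty {W | W ≤ C ∧ ∃ j, W.sign j = 0 ∧ C.sign j ≠ D.sign j} := by
    obtain ⟨j, hj⟩ : ∃ j, C.sign j ≠ D.sign j := by
      by_contra! h
      exact hne (Face.ext (funext h))
    exact ⟨Face.ofPoint _ 0, fun l => Or.inl (by simp), j, by simp, hj⟩
  obtain ⟨W, ⟨hWC, j, hj, hjD⟩, hmin⟩ := exists_minimalFor_of_wellFoundedLT _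
    (fun W : Face (central χ) => {l | W.sign l = 0}.ncard) hne'
  refine ⟨W, ⟨lt_of_le_of_ne hWC fun e => hC j (e ▸ hj), fun G hWG hGC => ?_⟩, j, hj, hjD⟩
  obtain ⟨i, hi, hi'⟩ := Face.exists_sign_ne_of_lt hWG
  obtain ⟨l, hl, -⟩ := Face.exists_sign_ne_of_lt hGC
  have hzero : ∀ l, G.sign l = 0 → W.sign l = 0 := by
    intro l hl
    rcases hWG.le l with h | h
    · exact h
    · exact h.trans hl
  have hsmaller : ∀ F : Face (central χ), F ≤ C → (∃ j, F.sign j = 0 ∧ C.sign j ≠ D.sign j) →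
      (∀ l, F.sign l = 0 → W.sign l = 0) → ∀ l, W.sign l = 0 → F.sign l = 0 := by
    intro F hF hF' hsub l hl
    have h1 : {l | F.sign l = 0} ⊆ {l | W.sign l = 0} := hsub
    have h2 := hmin (j := F) ⟨hF, hF'⟩ (Set.ncard_le_ncard h1)
    have h3 := Set.eq_of_subset_of_ncard_le h1 h2
    exact h3.symm.subset hl
  by_cases hsep : ∃ j, G.sign j = 0 ∧ C.sign j ≠ D.sign j
  · exact hi' (hsmaller G hGC.le hsep hzero i hi)
  push Not at hsep
  obtain ⟨g, hg⟩ := G.realized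
  obtain ⟨d, hd⟩ := D.realized
  have hGj : G.sign j ≠ 0 := fun h => hjD (hsep j h)
  have hga : ∀ l, SignType.sign (χ l g) = G.sign l := hg
  have hda : ∀ l, SignType.sign (χ l d) = D.sign l := hd
  -- leave `G` in the direction of `D`: one enters `C`, and leaves it through the required face
  obtain ⟨t, ht, ⟨l₀, ⟨hl₀, hl₀'⟩, e₀⟩, hs⟩ := exists_first_zero
    {l | W.sign l = 0 ∧ G.sign l ≠ 0} (fun l => χ l g) (fun l => - χ l d)
    (fun l hl h0 => hl.2 (by rw [← hga l]; simp [h0]))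
    ⟨j, ⟨hj, hGj⟩, - χ j g / χ j d, by
      have h1 : G.sign j = C.sign j := (hGC.le j).resolve_left hGj
      have h2 := hga j
      have h3 := hda j
      rw [h1] at h2
      rcases lt_trichotomy (χ j g) 0 with h4 | h4 | h4
      · rcases lt_trichotomy (χ j d) 0 with h5 | h5 | h5
        · exact absurd (by rw [← h2, ← h3, sign_neg h4, sign_neg h5]) hjD
        · exact absurd (by rw [← h3, h5, sign_zero]) (hD j)
        · exact div_pos (neg_pos.2 h4) h5
      · exact absurd (by rw [← h2, h4, sign_zero]) (hC j)
      · rcases lt_trichotomy (χ j d) 0 with h5 | h5 | h5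
        · exact div_pos_of_neg_of_neg (neg_neg_of_pos h4) h5
        · exact absurd (by rw [← h3, h5, sign_zero]) (hD j)
        · exact absurd (by rw [← h2, ← h3, sign_pos h4, sign_pos h5]) hjD, by
      have h3 : χ j d ≠ 0 := fun h0 => hD j (by rw [← hda j, h0, sign_zero])
      field_simp⟩
  set z := g + t • d with hz
  have hzl : ∀ l, χ l z = χ l g - t * -χ l d := by
    intro l
    rw [hz, map_add, map_smul, smul_eq_mul]
    ring
  set F := (Face.ofPoint (central χ) z).proj W with hF
  have hFs : ∀ l, W.sign l = 0 → F.sign l = SignType.sign (χ l z) := by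
    intro l hl
    rw [hF, Face.proj_sign, if_pos hl]
    rfl
  have hFs' : ∀ l, W.sign l ≠ 0 → F.sign l = W.sign l := by
    intro l hl
    rw [hF, Face.proj_sign, if_neg hl]
  have hG0 : ∀ l, G.sign l = 0 → F.sign l = C.sign l := by
    intro l hl
    have h1 : χ l g = 0 := by rw [← sign_eq_zero_iff, hga, hl]
    rw [hFs l (hzero l hl), hzl, h1, hsep l hl, ← hda l]
    simp [sign_mul, sign_pos ht]
  have hFC : F ≤ C := by
    intro l
    by_cases hl : W.sign l = 0
    · by_cases hl' : G.sign l = 0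
      · exact Or.inr (hG0 l hl')
      · rcases hs l ⟨hl, hl'⟩ with h | h
        · left
          rw [hFs l hl, hzl, h]
        · right
          rw [hFs l hl, hzl, h, hga]
          exact (hGC.le l).resolve_left hl'
    · right
      rw [hFs' l hl]
      exact (hWC l).resolve_left hl
  have hFl₀ : F.sign l₀ = 0 := by
    rw [hFs l₀ hl₀, hzl, e₀, sub_self, sign_zero]
  refine hC l ?_
  rw [← hG0 l hl]
  refine hsmaller F hFC ⟨l₀, hFl₀, fun h => ?_⟩ (fun l hl => ?_) l (hzero l hl)
  · rw [← (hGC.le l₀).resolve_left hl₀', ← hga, ← hda, e₀] at h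
    rw [← hga, e₀] at hl₀'
    rw [sign_mul, sign_pos ht, one_mul, Left.sign_neg] at h hl₀'
    revert h hl₀'
    generalize SignType.sign (χ l₀ d) = s
    revert s
    decide
  · by_contra hl'
    exact hl' ((hFs' l hl').symm.trans hl)

variable (χ) in
/-- The hyperplanes that separate two faces. -/
def separating (C D : Face (central χ)) : Set (Submodule ℝ V) :=
  (fun j => LinearMap.ker (χ j)) '' {j | C.sign j ≠ D.sign j}

theorem finite_separating (C D : Face (central χ)) : (separating χ C D).Finite :=
  (Set.toFinite _).image _

/-- Two chambers are joined by a gallery that is not longer than the number of hyperplanes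
separating them. -/
theorem exists_gallery (C D : Chamber (central χ)) :
    ∃ (k : ℕ) (E : ℕ → Chamber (central χ)), IsGallery k E ∧ E 0 = C ∧ E k = D ∧
      k ≤ (separating χ C.1 D.1).ncard := by
  induction hn : (separating χ C.1 D.1).ncard using Nat.strong_induction_on generalizing C with
  | _ n ih =>
  by_cases hCD : C = D
  · exact ⟨0, fun _ => C, fun n hn => absurd hn (Nat.not_lt_zero n), rfl, hCD, Nat.zero_le _⟩
  obtain ⟨W, hW, j, hj, hjD⟩ := exists_separating_wall C.2 D.2 (fun h => hCD (Subtype.ext h))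
  let C' : Chamber (central χ) := ⟨D.1.proj W, (Cell.edge W D).isChamber⟩
  have hC' : ∀ l, C'.1.sign l = if W.sign l = 0 then D.1.sign l else W.sign l := fun l => rfl
  have hW' : W ⋖ C'.1 := covBy_of_ker_eq C'.2 (Cell.edge W D).face_le ⟨j, hj⟩
    fun i l hi hl => ker_eq_of_covBy C.2 hW hi hl
  have hsub : separating χ C'.1 D.1 ⊂ separating χ C.1 D.1 := by
    rw [Set.ssubset_iff_exists]
    refine ⟨?_, LinearMap.ker (χ j), ⟨j, hjD, rfl⟩, ?_⟩
    · rintro _ ⟨l, hl, rfl⟩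
      refine ⟨l, ?_, rfl⟩
      rw [Set.mem_ofPred_eq, hC'] at hl
      split_ifs at hl with h
      · exact absurd rfl hl
      · rwa [(hW.le l).resolve_left h] at hl
    · rintro ⟨l, hl, e⟩
      refine hl ?_
      rw [hC', if_pos (Face.sign_eq_zero_of_ker_eq e hj)]
  have hlt := Set.ncard_lt_ncard hsub (finite_separating _ _)
  obtain ⟨k, E, hE, h0, hk, hle⟩ := ih _ (hn ▸ hlt) C' rfl
  refine ⟨k + 1, fun m => Nat.casesOn m C E, ?_, rfl, hk, by omega⟩
  rintro (_ | m) hm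
  · refine ⟨W, hW, ?_⟩
    change W ⋖ (E 0).1
    rw [h0]
    exact hW'
  · exact hE m (by omega)

theorem separating_subsingleton_of_isWall {W : Face (central χ)} {C D : Chamber (central χ)}
    (h : IsWall W C D) : (separating χ C.1 D.1).Subsingleton := by
  have key : ∀ l, C.1.sign l ≠ D.1.sign l → W.sign l = 0 := by
    intro l hl
    by_contra hW
    exact hl (((h.1.le l).resolve_left hW).symm.trans ((h.2.le l).resolve_left hW))
  rintro _ ⟨i, hi, rfl⟩ _ ⟨j, hj, rfl⟩
  exact ker_eq_of_covBy C.2 h.1 (key i hi) (key j hj)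

omit [Finite J] in
theorem exists_step_of_sign_ne {E : ℕ → Chamber (central χ)} {j : J} {m n : ℕ} (hmn : m ≤ n)
    (h : (E m).1.sign j ≠ (E n).1.sign j) :
    ∃ p, m ≤ p ∧ p < n ∧ (E p).1.sign j ≠ (E (p + 1)).1.sign j := by
  by_contra! hcon
  refine h ?_
  induction n, hmn using Nat.le_induction with
  | base => rfl
  | succ n hn ih =>
    have h1 : (E m).1.sign j = (E n).1.sign j := by
      by_contra h2
      exact h2 (ih h2 fun p hp hp' => hcon p hp (by omega))
    exact h1.trans (hcon n hn (by omega))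

/-- A minimal gallery from `C` to `D` only crosses hyperplanes that separate `C` from `D`, each of
them once: otherwise some step could be left out in counting the separating hyperplanes, and there
is a shorter gallery. -/
theorem IsMinimalGallery.crossing {k : ℕ} {E : ℕ → Chamber (central χ)}
    (hE : IsMinimalGallery k E) {n : ℕ} (hn : n < k) {j : J}
    (hj : (E n).1.sign j ≠ (E (n + 1)).1.sign j) :
    (E 0).1.sign j ≠ (E k).1.sign j ∧
      ∀ m < k, m ≠ n → (E m).1.sign j = (E (m + 1)).1.sign j := by
  classical
  by_contra hcon
  have hstep : ∀ m < k, (separating χ (E m).1 (E (m + 1)).1).Subsingleton := by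
    intro m hm
    obtain ⟨W, hW⟩ := hE.1 m hm
    exact separating_subsingleton_of_isWall hW
  -- every separating hyperplane is crossed in some step other than the `n`-th
  have hcover : separating χ (E 0).1 (E k).1 ⊆
      ⋃ m ∈ (Finset.range k).erase n, separating χ (E m).1 (E (m + 1)).1 := by
    rintro _ ⟨l, hl, rfl⟩
    obtain ⟨p, -, hp, hpl⟩ := exists_step_of_sign_ne (Nat.zero_le k) hl
    by_cases hpn : p = n
    · subst hpn
      have hker : LinearMap.ker (χ l) = LinearMap.ker (χ j) :=
        hstep p hp ⟨l, hpl, rfl⟩ ⟨j, hj, rfl⟩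
      have h0 : (E 0).1.sign j ≠ (E k).1.sign j :=
        fun h => hl (Chamber.sign_eq_of_ker_eq hker (E 0).2 (E k).2 h)
      push Not at hcon
      obtain ⟨m, hm, hmp, hmj⟩ := hcon h0
      refine Set.mem_biUnion (x := m) (by simp [hm, hmp]) ⟨j, hmj, hker.symm⟩
    · exact Set.mem_biUnion (x := p) (by simp [hp, hpn]) ⟨l, hpl, rfl⟩
  have hcard : (separating χ (E 0).1 (E k).1).ncard ≤ k - 1 := by
    calc (separating χ (E 0).1 (E k).1).ncard
        ≤ (⋃ m ∈ (Finset.range k).erase n, separating χ (E m).1 (E (m + 1)).1).ncard :=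
          Set.ncard_le_ncard hcover
            (Set.Finite.biUnion (Finset.finite_toSet _) fun _ _ => finite_separating _ _)
      _ ≤ ∑ m ∈ (Finset.range k).erase n, (separating χ (E m).1 (E (m + 1)).1).ncard :=
          Finset.set_ncard_biUnion_le _ _
      _ ≤ ∑ m ∈ (Finset.range k).erase n, 1 := by
          refine Finset.sum_le_sum fun m hm => ?_
          rw [Finset.mem_erase, Finset.mem_range] at hm
          have := (finite_separating (E m).1 (E (m + 1)).1).to_subtype
          exact Set.ncard_le_one_iff_subsingleton.2 (hstep m hm.2)
      _ = k - 1 := by simp [hn]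
  obtain ⟨k', E', hE', h0, hk, hle⟩ := exists_gallery (E 0) (E k)
  have := hE.2 k' E' hE' h0 hk
  omega

/-- A minimal gallery stays on one side of a hyperplane that does not separate its ends. -/
theorem IsMinimalGallery.sign_eq {k : ℕ} {E : ℕ → Chamber (central χ)}
    (hE : IsMinimalGallery k E) {j : J} (hj : (E 0).1.sign j = (E k).1.sign j) {n : ℕ}
    (hn : n ≤ k) : (E n).1.sign j = (E 0).1.sign j := by
  by_contra h
  obtain ⟨p, -, hp, hpj⟩ := exists_step_of_sign_ne (Nat.zero_le n) (Ne.symm h)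
  exact (hE.crossing (by omega) hpj).1 hj

end Central

/-! ### One-chains of a nerve modulo boundaries -/

universe w w₁ w₂

/-- The boundaries among the `1`-chains of a simplicial set. -/
noncomputable def boundaries₁ (X : SSet.{w}) : AddSubgroup (intModule.{w} ⟶ Chain₁ X) :=
  (Preadditive.rightComp intModule ((X.chainComplex intModule).d 2 1)).range

/-- The class of a `1`-chain, not necessarily a cycle, modulo boundaries. -/
noncomputable def chainClass {X : SSet.{w}} (z : intModule.{w} ⟶ Chain₁ X) :
    (intModule.{w} ⟶ Chain₁ X) ⧸ boundaries₁ X :=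
  QuotientAddGroup.mk' _ z

theorem chainClass_add {X : SSet.{w}} (z z' : intModule.{w} ⟶ Chain₁ X) :
    chainClass (z + z') = chainClass z + chainClass z' := map_add _ _ _

theorem chainClass_sub {X : SSet.{w}} (z z' : intModule.{w} ⟶ Chain₁ X) :
    chainClass (z - z') = chainClass z - chainClass z' := map_sub _ _ _

theorem liftCycles_homologyπ_congr {K : ChainComplex (ModuleCat.{w} ℤ) ℕ} {R : ModuleCat.{w} ℤ}
    {z z' : R ⟶ K.X 1} (hz : z ≫ K.d 1 0 = 0) (hz' : z' ≫ K.d 1 0 = 0) (b : R ⟶ K.X 2)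
    (hb : z - z' = b ≫ K.d 2 1) :
    K.liftCycles z 0 (by simp) hz ≫ K.homologyπ 1 =
      K.liftCycles z' 0 (by simp) hz' ≫ K.homologyπ 1 := by
  have h0 := K.liftCycles_homologyπ_eq_zero_of_boundary (i := 1) (z - z') 0 (by simp) b hb
  rw [← sub_eq_zero, ← Preadditive.sub_comp, ← h0]
  congr 1
  rw [← cancel_mono (K.iCycles 1), Preadditive.sub_comp, HomologicalComplex.liftCycles_i,
    HomologicalComplex.liftCycles_i, HomologicalComplex.liftCycles_i]

theorem homologyClass_congr {X : SSet.{w}} {z z' : intModule.{w} ⟶ Chain₁ X} (hz : IsCycle z)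
    (hz' : IsCycle z') (h : chainClass z = chainClass z') :
    homologyClass z hz = homologyClass z' hz' := by
  obtain ⟨b, hb⟩ : z - z' ∈ boundaries₁ X := by
    rw [← QuotientAddGroup.eq_zero_iff]
    change chainClass (z - z') = 0
    rw [chainClass_sub, h, sub_self]
  exact liftCycles_homologyπ_congr hz hz' b hb.symm

theorem IsCycle.zero {X : SSet.{w}} : IsCycle (0 : intModule.{w} ⟶ Chain₁ X) :=
  Limits.zero_comp

theorem homologyClass_eq_zero {X : SSet.{w}} {z : intModule.{w} ⟶ Chain₁ X} (hz : IsCycle z)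
    (h : chainClass z = 0) : homologyClass z hz = 0 := by
  rw [homologyClass_congr hz IsCycle.zero (h.trans (map_zero _).symm)]
  refine (HomologicalComplex.liftCycles_homologyπ_eq_zero_of_boundary _ (i := 1) 0 0 (by simp)
    (0 : _ ⟶ (X.chainComplex intModule).X 2) ?_)
  rw [Limits.zero_comp]

theorem IsCycle.map {X Y : SSet.{w}} {z : intModule.{w} ⟶ Chain₁ X} (hz : IsCycle z) (f : X ⟶ Y) :
    IsCycle (z ≫ (SSet.chainComplexMap f intModule).f 1) := by
  unfold IsCycle at hz ⊢
  rw [Category.assoc, (SSet.chainComplexMap f intModule).comm, ← Category.assoc, hz,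
    Limits.zero_comp]

theorem homologyClass_map {X Y : SSet.{w}} {z : intModule.{w} ⟶ Chain₁ X} (hz : IsCycle z)
    (f : X ⟶ Y) : homologyClass z hz ≫ H₁map f =
      homologyClass (z ≫ (SSet.chainComplexMap f intModule).f 1) (hz.map f) := by
  unfold homologyClass
  rw [Category.assoc, HomologicalComplex.homologyπ_naturality, ← Category.assoc]
  congr 1
  exact HomologicalComplex.liftCycles_comp_cyclesMap _ _ _ _ _

section
variable {𝒞 : Type w₁} [Category.{w₂} 𝒞]

/-- The `2`-simplex of the nerve given by two composable arrows. -/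
abbrev triangleOf {x y z : 𝒞} (f : x ⟶ y) (g : y ⟶ z) : (nerve 𝒞) _⦋2⦌ :=
  ComposableArrows.mk₂ f g

/-- The class, modulo boundaries, of the `1`-simplex of the nerve given by an arrow. It takes
composition to addition. -/
noncomputable def arrowClass {x y : 𝒞} (f : x ⟶ y) :
    (intModule ⟶ Chain₁ (nerve 𝒞)) ⧸ boundaries₁ (nerve 𝒞) :=
  chainClass ((nerve 𝒞).ιChainComplex (edgeOf f))

theorem arrowClass_comp {x y z : 𝒞} (f : x ⟶ y) (g : y ⟶ z) :
    arrowClass (f ≫ g) = arrowClass f + arrowClass g := by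
  rw [arrowClass, arrowClass, arrowClass, ← chainClass_add, ← sub_eq_zero, ← neg_eq_zero, neg_sub,
    ← chainClass_sub]
  refine (QuotientAddGroup.eq_zero_iff _).2 ⟨(nerve 𝒞).ιChainComplex (triangleOf f g), ?_⟩
  have h0 : (nerve 𝒞).δ (0 : Fin 3) (triangleOf f g) = edgeOf g := nerve.δ₀_mk₂_eq f g
  have h1 : (nerve 𝒞).δ (1 : Fin 3) (triangleOf f g) = edgeOf (f ≫ g) := nerve.δ₁_mk₂_eq f g
  have h2 : (nerve 𝒞).δ (2 : Fin 3) (triangleOf f g) = edgeOf f := nerve.δ₂_mk₂_eq f g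
  refine (SSet.ιChainComplex_d (X := nerve 𝒞) (R := intModule) (x := triangleOf f g)).trans ?_
  rw [Fin.sum_univ_three, h0, h1, h2]
  simp
  abel

theorem arrowClass_id (x : 𝒞) : arrowClass (𝟙 x) = 0 := by
  have h := arrowClass_comp (𝟙 x) (𝟙 x)
  rw [Category.comp_id] at h
  exact left_eq_add.1 h

theorem ιChainComplex_edgeOf_map {𝒟 : Type w₁} [Category.{w₂} 𝒟] (Ψ : 𝒞 ⥤ 𝒟) {x y : 𝒞}
    (f : x ⟶ y) : (nerve 𝒞).ιChainComplex (edgeOf f) ≫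
      (SSet.chainComplexMap (nerveMap Ψ) intModule).f 1 =
      (nerve 𝒟).ιChainComplex (edgeOf (Ψ.map f)) := by
  rw [SSet.ι_chainComplexMap_f]
  congr 1
  exact ComposableArrows.ext₁ rfl rfl ((Category.id_comp _).trans (Category.comp_id _)).symm

end

namespace ToricArrangement

/-! ### The category `∫ 𝒟` -/

section
variable {V : Type u} [AddCommGroup V] [Module ℝ V] {Γ : Submodule ℤ V} {ι : Type v} [Finite ι]
  {A : ToricArrangement Γ ι}

/-- The arrow `(G, x) → (F, i_m(x))` given by a morphism `m : F → G`. -/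
noncomputable def pushArrow {F G : A.TFace} (m : F ⟶ G) (x : Cell G.arr) :
    obj G x ⟶ obj F (TFace.Hom.inclCell m x) :=
  Grothendieck.Hom.mk (F := A.diagram ⋙ preordToCat) (X := obj G x)
    (Y := obj F (TFace.Hom.inclCell m x)) m.op
    (𝟙 ((A.diagram ⋙ preordToCat).map m.op |>.toFunctor.obj x))

theorem salCat_hom_ext {x y : A.SalCat} {f g : x ⟶ y} (h : f.base = g.base) : f = g :=
  Grothendieck.ext _ _ h (@Subsingleton.elim _
    (Preorder.subsingleton_hom (α := Cell y.base.unop.arr) _ _) _ _)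

/-- Over a face there is at most one arrow between two objects, as the only endomorphism of a face
is the identity. -/
theorem subsingleton_hom_obj {F : A.TFace} (x y : Cell F.arr) :
    Subsingleton (obj F x ⟶ obj F y) := by
  refine ⟨fun f g => salCat_hom_ext (Quiver.Hom.unop_inj (TFace.Hom.ext (Face.ext ?_)))⟩
  ext i
  rw [(TFace.Hom.dir_eq_zero_iff (F := F) (G := F) _ i).2 i.2,
    (TFace.Hom.dir_eq_zero_iff (F := F) (G := F) _ i).2 i.2]

/-- An arrow `(G, x) → (F, y)` consists of a morphism `m : F → G` with `i_m(x) ≤ y`. -/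
theorem inclCell_le_of_hom {F G : A.TFace} {x : Cell G.arr} {y : Cell F.arr}
    (f : obj G x ⟶ obj F y) : TFace.Hom.inclCell (F := F) (G := G) f.base.unop x ≤ y :=
  leOfHom (X := Cell F.arr) f.fiber

theorem incl_endo {F : A.TFace} (m : F ⟶ F) (K : Face F.arr) : TFace.Hom.incl m K = K := by
  ext i
  rw [TFace.Hom.incl_sign, dif_pos i.2]

theorem le_of_hom {F : A.TFace} {x y : Cell F.arr} (f : obj F x ⟶ obj F y) : x ≤ y := by
  have h := inclCell_le_of_hom f
  have e : TFace.Hom.inclCell (F := F) (G := F) f.base.unop x = x :=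
    Cell.ext (incl_endo _ _) (incl_endo _ _)
  rwa [e] at h

theorem obj_injective {F G : A.TFace} {x : Cell F.arr} {y : Cell G.arr} (h : obj F x = obj G y) :
    F = G ∧ HEq x y := by
  have h1 := congrArg Grothendieck.base h
  have h2 : F = G := congrArg unop h1
  subst h2
  refine ⟨rfl, ?_⟩
  injection h with _ h3
  exact heq_of_eq h3

/-- Arrows between equal objects are identities, hence degenerate. -/
theorem arrowClass_eq_zero {x y : A.SalCat} (f : x ⟶ y) (h : x = y) : arrowClass f = 0 := by
  subst h
  obtain ⟨F, x⟩ := x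
  have := subsingleton_hom_obj (F := F.unop) x x
  rw [Subsingleton.elim f (𝟙 _), arrowClass_id]

theorem chainClass_circleChain {F G : A.TFace} (m : F ⟶ G) (C : Chamber A.linear) :
    chainClass (TFace.Hom.circleChain m C) =
      arrowClass (arrow F (x := Cell.vertex (TFace.Hom.side₁ m C)) (y := TFace.Hom.cell₁ m C)
        (Cell.vertex_le (TFace.Hom.dir_le_side₁ m C))) -
      arrowClass (arrow F (x := Cell.vertex (TFace.Hom.side₂ m C)) (y := TFace.Hom.cell₁ m C)
        (Cell.vertex_le (TFace.Hom.dir_le_side₂ m C))) +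
      arrowClass (arrow F (x := Cell.vertex (TFace.Hom.side₂ m C)) (y := TFace.Hom.cell₂ m C)
        (Cell.vertex_le (TFace.Hom.dir_le_side₂ m C))) -
      arrowClass (arrow F (x := Cell.vertex (TFace.Hom.side₁ m C)) (y := TFace.Hom.cell₂ m C)
        (Cell.vertex_le (TFace.Hom.dir_le_side₁ m C))) := by
  rw [TFace.Hom.circleChain, chainClass_sub, chainClass_add, chainClass_sub]
  rfl

/-! ### The functor inducing `Φ_L` -/

variable (L : Set (V ⧸ Γ))

omit [Finite ι] in
theorem projCell_mono (F : A.TFace) {x y : Cell F.arr} (h : x ≤ y) :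
    A.projCell L F x ≤ A.projCell L F y := ⟨fun _ => h.1 _, fun _ => h.2 _⟩

theorem PhiFunctor_map_arrow (F : A.TFace) {x y : Cell F.arr} (h : x ≤ y) :
    (A.PhiFunctor L).map (arrow F h) = arrow (A.projFace L F) (projCell_mono L F h) :=
  (subsingleton_hom_obj _ _).elim _ _

theorem circleChain_Phi {F G : A.TFace} (m : F ⟶ G) (C : Chamber A.linear) :
    TFace.Hom.circleChain m C ≫ (SSet.chainComplexMap (A.Phi L) intModule).f 1 =
      TFace.Hom.circleChain ((A.projFunctor L).map m) (A.projChamber L C) := by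
  unfold TFace.Hom.circleChain
  rw [Preadditive.sub_comp, Preadditive.add_comp, Preadditive.sub_comp]
  unfold Phi
  rw [ιChainComplex_edgeOf_map, ιChainComplex_edgeOf_map, ιChainComplex_edgeOf_map,
    ιChainComplex_edgeOf_map, PhiFunctor_map_arrow, PhiFunctor_map_arrow, PhiFunctor_map_arrow,
    PhiFunctor_map_arrow]
  rfl

end
end ToricArrangement

/-! ### Faces along a segment -/

theorem eventually_sign_eq (c : ℝ) :
    ∀ᶠ y in nhds c, SignType.sign c = 0 ∨ SignType.sign c = SignType.sign y := by
  rcases lt_trichotomy c 0 with h | h | h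
  · filter_upwards [gt_mem_nhds h] with y hy
    right
    rw [sign_neg h, sign_neg hy]
  · exact Filter.Eventually.of_forall fun y => Or.inl (by rw [h, sign_zero])
  · filter_upwards [lt_mem_nhds h] with y hy
    right
    rw [sign_pos h, sign_pos hy]

theorem eventually_sign_sub_int_eq (c : ℝ) :
    ∀ᶠ y : ℝ in nhds c, ∀ k : ℤ, SignType.sign (c - k) = 0 ∨
      SignType.sign (c - k) = SignType.sign (y - k) := by
  have h1 : (⌈c⌉ - 1 : ℝ) < c := by linarith [Int.ceil_lt_add_one c]
  have h2 : c < (⌊c⌋ + 1 : ℝ) := Int.lt_floor_add_one c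
  filter_upwards [lt_mem_nhds h1, gt_mem_nhds h2] with y hy1 hy2 k
  rcases lt_trichotomy (k : ℝ) c with h | h | h
  · right
    have : (k : ℝ) ≤ ⌈c⌉ - 1 := by
      have : k < ⌈c⌉ := Int.lt_ceil.2 h
      exact_mod_cast Int.le_sub_one_of_lt this
    rw [sign_pos (sub_pos.2 h), sign_pos (by linarith)]
  · left
    rw [h, sub_self, sign_zero]
  · right
    have : (⌊c⌋ + 1 : ℝ) ≤ k := by
      have : ⌊c⌋ < k := Int.floor_lt.2 h
      exact_mod_cast this
    rw [sign_neg (sub_neg.2 h), sign_neg (by linarith)]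

theorem tendsto_lineMap_apply {V : Type*} [AddCommGroup V] [Module ℝ V] (f : V →ᵃ[ℝ] ℝ) (x v : V)
    (t : ℝ) : Filter.Tendsto (fun s : ℝ => f (x + s • v)) (nhds t) (nhds (f (x + t • v))) := by
  have h : ∀ s : ℝ, f (x + s • v) = f x + s * f.linear v := by
    intro s
    rw [add_comm x, ← vadd_eq_add, AffineMap.map_vadd, map_smul, vadd_eq_add, add_comm, smul_eq_mul]
  simp only [h]
  exact (by fun_prop : Continuous fun s : ℝ => f x + s * f.linear v).tendsto t

/-- The faces of an arrangement form a locally finite stratification along every line. -/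
def LocallyFiniteOnLines {J V : Type*} [AddCommGroup V] [Module ℝ V] (ℓ : J → V →ᵃ[ℝ] ℝ) : Prop :=
  ∀ (x v : V) (t : ℝ), ∀ᶠ s in nhds t, Face.ofPoint ℓ (x + t • v) ≤ Face.ofPoint ℓ (x + s • v)

theorem locallyFiniteOnLines_of_finite {J V : Type*} [AddCommGroup V] [Module ℝ V] [Finite J]
    (ℓ : J → V →ᵃ[ℝ] ℝ) : LocallyFiniteOnLines ℓ := fun x v t =>
  Filter.eventually_all.2 fun j => (tendsto_lineMap_apply (ℓ j) x v t).eventually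
    (eventually_sign_eq _)

theorem ToricArrangement.locallyFiniteOnLines_lifted {V : Type u} [AddCommGroup V] [Module ℝ V]
    {Γ : Submodule ℤ V} {ι : Type v} [Finite ι] (A : ToricArrangement Γ ι) :
    LocallyFiniteOnLines A.lifted := by
  intro x v t
  have h : ∀ᶠ s in nhds t, ∀ i : ι, ∀ k : ℤ,
      SignType.sign (A.χ i (x + t • v) - A.a i - k) = 0 ∨
      SignType.sign (A.χ i (x + t • v) - A.a i - k) =
        SignType.sign (A.χ i (x + s • v) - A.a i - k) :=
    Filter.eventually_all.2 fun i =>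
      ((tendsto_lineMap_apply (A.χ i).toAffineMap x v t).sub_const (A.a i)).eventually
        (eventually_sign_sub_int_eq _)
  filter_upwards [h] with s hs
  rintro ⟨i, k⟩
  rw [Face.ofPoint_sign, Face.ofPoint_sign, lifted_apply, lifted_apply, ← sub_sub, ← sub_sub]
  exact hs i k

/-- A function on a convex set that does not change when one passes from a face to a bigger one is
constant. -/
theorem LocallyFiniteOnLines.eq_of_face_le {J V α : Type*} [AddCommGroup V] [Module ℝ V]
    {ℓ : J → V →ᵃ[ℝ] ℝ} (hℓ : LocallyFiniteOnLines ℓ) {S : Set V} (hS : Convex ℝ S) {Q : V → α}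
    (hQ : ∀ x ∈ S, ∀ y ∈ S, Face.ofPoint ℓ x ≤ Face.ofPoint ℓ y → Q x = Q y) {x y : V}
    (hx : x ∈ S) (hy : y ∈ S) : Q x = Q y := by
  have hmem : ∀ t ∈ Set.Icc (0 : ℝ) 1, x + t • (y - x) ∈ S :=
    fun t ht => hS.add_smul_sub_mem hx hy ht
  have h := (isPreconnected_Icc (a := (0 : ℝ)) (b := 1)).induction₂
    (fun t s => Q (x + t • (y - x)) = Q (x + s • (y - x)))
    (fun t ht => by
      filter_upwards [self_mem_nhdsWithin, nhdsWithin_le_nhds (hℓ x (y - x) t)] with s hs hle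
      exact hQ _ (hmem t ht) _ (hmem s hs) hle)
    (fun _ _ _ _ _ _ h h' => h.trans h') (fun _ _ _ _ h => h.symm)
    (Set.left_mem_Icc.2 zero_le_one) (Set.right_mem_Icc.2 zero_le_one)
  simpa using h

namespace ToricArrangement

section
variable {V : Type u} [AddCommGroup V] [Module ℝ V] {Γ : Submodule ℤ V} {ι : Type v}
  {A : ToricArrangement Γ ι}

/-! ### Hypertori and facets -/

/-- Two hypertori with a common point are equal if one hyperplane contains the other one, as
primitive characters with the same kernel agree up to sign. -/
theorem eq_of_ker_le {i j : ι} (h : LinearMap.ker (A.χ i) ≤ LinearMap.ker (A.χ j)) {p : V} {k l : ℤ}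
    (hi : A.χ i p = A.a i + k) (hj : A.χ j p = A.a j + l) : i = j := by
  obtain ⟨γ, hγ, hγi⟩ : (1 : ℝ) ∈ (fun γ => A.χ i γ) '' (Γ : Set V) := by
    rw [A.primitive i]
    exact ⟨1, Int.cast_one⟩
  obtain ⟨δ, hδ, hδj⟩ : (1 : ℝ) ∈ (fun γ => A.χ j γ) '' (Γ : Set V) := by
    rw [A.primitive j]
    exact ⟨1, Int.cast_one⟩
  obtain ⟨n, hn⟩ := exists_int (A := A) j hγ
  obtain ⟨m, hm⟩ := exists_int (A := A) i hδ
  have hγi' : A.χ i γ = 1 := hγi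
  have hδj' : A.χ j δ = 1 := hδj
  have key : ∀ v, A.χ j v = A.χ i v * n := by
    intro v
    have h1 : v - A.χ i v • γ ∈ LinearMap.ker (A.χ i) := by
      rw [LinearMap.mem_ker, map_sub, map_smul, hγi', smul_eq_mul, mul_one, sub_self]
    have h2 := h h1
    rw [LinearMap.mem_ker, map_sub, map_smul, hn, smul_eq_mul, sub_eq_zero] at h2
    exact h2
  have hmn : m * n = 1 := by
    have := key δ
    rw [hδj', hm] at this
    exact_mod_cast this.symm
  refine A.distinct i j (Set.ext fun v => ?_)
  have hv := key v
  have hp := key p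
  rw [hi, hj] at hp
  constructor
  · rintro ⟨r, hr⟩
    refine ⟨l + (r - k) * n, ?_⟩
    rw [hv, hr]
    push_cast
    linear_combination -hp
  · rintro ⟨r, hr⟩
    refine ⟨k + (r - l) * m, ?_⟩
    have hmn' : (m : ℝ) * n = 1 := by exact_mod_cast hmn
    rw [hr] at hv
    push_cast
    linear_combination (-(m : ℝ)) * hv + (m : ℝ) * hp + (A.a i + k - A.χ i v) * hmn'

theorem faceAt_subset_hyp_iff (x : V) (i : ι) :
    (A.faceAt x).carrier ⊆ A.hyp i ↔ ∃ k : ℤ, A.χ i x = A.a i + k := by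
  change Γ.mkQ '' _ ⊆ _ ↔ _
  rw [subset_hyp_iff]
  refine exists_congr fun k => ?_
  rw [Face.ofPoint_sign, sign_eq_zero_iff, lifted_apply, sub_eq_zero]

/-- `G` lies in the hypertorus with index `i`, and in no other one. -/
def IsFacet (i : ι) (G : A.TFace) : Prop := ∀ j, G.carrier ⊆ A.hyp j ↔ j = i

variable [Finite ι]

/-- The morphism of the face category given by a pair of points in faces `f ≤ g`. -/
noncomputable def faceHom (x y : V) (h : Face.ofPoint A.lifted x ≤ Face.ofPoint A.lifted y) :
    A.faceAt x ⟶ A.faceAt y where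
  dir := Face.ofPoint _ (y - x)
  lifts := by
    refine ⟨_, _, h, rfl, rfl, fun i k hk => ?_⟩
    rw [Face.ofPoint_sign, sign_eq_zero_iff, lifted_apply, sub_eq_zero] at hk
    rw [Face.ofPoint_sign, Face.ofPoint_sign, lifted_apply, ← hk, ← map_sub]
    rfl

/-- Small displacements of a point lead to a bigger face. -/
theorem exists_ofPoint_le (x v : V) : ∃ t : ℝ, 0 < t ∧
    Face.ofPoint A.lifted x ≤ Face.ofPoint A.lifted (x + t • v) := by
  have h : ∀ᶠ t in nhdsWithin (0 : ℝ) (Set.Ioi 0), Face.ofPoint A.lifted (x + (0 : ℝ) • v) ≤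
      Face.ofPoint A.lifted (x + t • v) := nhdsWithin_le_nhds (A.locallyFiniteOnLines_lifted x v 0)
  rw [zero_smul, add_zero] at h
  obtain ⟨t, ht, ht'⟩ := (h.and self_mem_nhdsWithin).exists
  exact ⟨t, ht', ht⟩

/-- In the direction of a generic vector of the hyperplane, one leaves a face contained in a
hypertorus for a facet. -/
theorem exists_hom_facet {i : ι} {F : A.TFace} (hF : F.carrier ⊆ A.hyp i) :
    ∃ (G : A.TFace) (_ : F ⟶ G), IsFacet i G := by
  obtain ⟨x, rfl⟩ := F.exists_point
  have hF' := (faceAt_subset_hyp_iff x i).1 hF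
  obtain ⟨k, hk⟩ := hF'
  obtain ⟨w, hw, hw'⟩ := Module.Dual.exists_forall_mem_ne_zero_of_forall_exists
    (LinearMap.ker (A.χ i))
    (fun j : {j : ι // j ≠ i ∧ (A.faceAt x).carrier ⊆ A.hyp j} => A.χ j.1) (by
      rintro ⟨j, hj, hjF⟩
      obtain ⟨l, hl⟩ := (faceAt_subset_hyp_iff x j).1 hjF
      by_contra! hcon
      exact hj (eq_of_ker_le hcon hk hl).symm)
  obtain ⟨t, ht, hle⟩ := exists_ofPoint_le (A := A) x w
  refine ⟨A.faceAt (x + t • w), faceHom x _ hle, fun j => ⟨fun hj => ?_, ?_⟩⟩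
  · by_contra hji
    have hjF : (A.faceAt x).carrier ⊆ A.hyp j := TFace.Hom.loc (faceHom x _ hle) hj
    obtain ⟨l, hl⟩ := (faceAt_subset_hyp_iff _ j).1 hj
    have h1 : (Face.ofPoint A.lifted (x + t • w)).sign (j, l) = 0 := by
      rw [Face.ofPoint_sign, sign_eq_zero_iff, lifted_apply, hl, sub_self]
    have h2 : (Face.ofPoint A.lifted x).sign (j, l) = 0 := by
      rcases hle (j, l) with h | h
      · exact h
      · exact h.trans h1
    rw [Face.ofPoint_sign, sign_eq_zero_iff, lifted_apply, sub_eq_zero] at h2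
    rw [map_add, h2, map_smul, smul_eq_mul, add_eq_left] at hl
    exact (mul_ne_zero ht.ne' (hw' ⟨j, hji, hjF⟩)) hl
  · rintro rfl
    refine (faceAt_subset_hyp_iff _ j).2 ⟨k, ?_⟩
    rw [LinearMap.mem_ker] at hw
    rw [map_add, map_smul, hw, hk, smul_zero, add_zero]

/-! ### The class of the loop around a hypertorus -/

theorem arrowClass_arrow_trans (F : A.TFace) {x y z : Cell F.arr} (h : x ≤ y) (h' : y ≤ z) :
    arrowClass (arrow F (h.trans h')) = arrowClass (arrow F h) + arrowClass (arrow F h') := by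
  rw [← arrowClass_comp]
  congr 1
  exact (subsingleton_hom_obj _ _).elim _ _

theorem pushArrow_naturality {F G : A.TFace} (m : F ⟶ G) {x y : Cell G.arr} (h : x ≤ y) :
    arrow G h ≫ pushArrow m y = pushArrow m x ≫ arrow F (TFace.Hom.inclCell_mono m h) := by
  refine salCat_hom_ext ?_
  change 𝟙 _ ≫ m.op = m.op ≫ 𝟙 _
  rw [Category.id_comp, Category.comp_id]

theorem arrowClass_arrow (F : A.TFace) {x y x' y' : Cell F.arr} (h : x ≤ y) (h' : x' ≤ y')
    (hx : x = x') (hy : y = y') : arrowClass (arrow F h) = arrowClass (arrow F h') := by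
  subst hx hy
  rfl

theorem incl_proj {F G H : A.TFace} (m : F ⟶ G) (n : G ⟶ H) (C : Chamber A.linear) :
    TFace.Hom.incl m ((G.localize C.1).proj (TFace.Hom.dir n)) =
      (F.localize C.1).proj (TFace.Hom.dir (m ≫ n)) := by
  ext j
  rw [TFace.Hom.incl_sign, Face.proj_sign, TFace.comp_dir, TFace.Hom.incl_sign]
  by_cases h : G.carrier ⊆ A.hyp j.1
  · rw [dif_pos h, dif_pos h, Face.proj_sign]
    rfl
  · rw [dif_neg h, dif_neg h, if_neg fun h' => h ((TFace.Hom.dir_eq_zero_iff m j).1 h')]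

theorem inclCell_vertex_side₁ {F G H : A.TFace} (m : F ⟶ G) (n : G ⟶ H) (C : Chamber A.linear) :
    TFace.Hom.inclCell m (Cell.vertex (TFace.Hom.side₁ n C)) =
      Cell.vertex (TFace.Hom.side₁ (m ≫ n) C) :=
  Cell.ext (incl_proj m n C) (incl_proj m n C)

theorem inclCell_vertex_side₂ {F G H : A.TFace} (m : F ⟶ G) (n : G ⟶ H) (C : Chamber A.linear) :
    TFace.Hom.inclCell m (Cell.vertex (TFace.Hom.side₂ n C)) =
      Cell.vertex (TFace.Hom.side₂ (m ≫ n) C) :=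
  Cell.ext (incl_proj m n C.neg) (incl_proj m n C.neg)

theorem inclCell_cell₁ {F G H : A.TFace} (m : F ⟶ G) (n : G ⟶ H) (C : Chamber A.linear) :
    TFace.Hom.inclCell m (TFace.Hom.cell₁ n C) = TFace.Hom.cell₁ (m ≫ n) C :=
  Cell.ext rfl (incl_proj m n C)

theorem inclCell_cell₂ {F G H : A.TFace} (m : F ⟶ G) (n : G ⟶ H) (C : Chamber A.linear) :
    TFace.Hom.inclCell m (TFace.Hom.cell₂ n C) = TFace.Hom.cell₂ (m ≫ n) C :=
  Cell.ext rfl (incl_proj m n C.neg)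

theorem arrowClass_arrow_push {F G : A.TFace} (m : F ⟶ G) {x y : Cell G.arr} {x' y' : Cell F.arr}
    (h : x ≤ y) (h' : x' ≤ y') (hx : TFace.Hom.inclCell m x = x')
    (hy : TFace.Hom.inclCell m y = y') :
    arrowClass (arrow G h) + arrowClass (pushArrow m y) =
      arrowClass (pushArrow m x) + arrowClass (arrow F h') := by
  subst hx hy
  rw [← arrowClass_comp, ← arrowClass_comp, pushArrow_naturality]

/-- The circles `Ω^{(m ≫ n)}` and `Ω^{(n)}` are homologous: a morphism `m : F → G` gives a natural
transformation between the inclusion of `𝒮(𝒜[G])` over `G` and its image over `F`. -/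
theorem chainClass_circleChain_comp {F G H : A.TFace} (m : F ⟶ G) (n : G ⟶ H)
    (C : Chamber A.linear) : chainClass (TFace.Hom.circleChain (m ≫ n) C) =
      chainClass (TFace.Hom.circleChain n C) := by
  rw [chainClass_circleChain, chainClass_circleChain]
  have h1 := arrowClass_arrow_push m (Cell.vertex_le (TFace.Hom.dir_le_side₁ n C))
    (x := Cell.vertex (TFace.Hom.side₁ n C)) (y := TFace.Hom.cell₁ n C)
    (Cell.vertex_le (TFace.Hom.dir_le_side₁ (m ≫ n) C))
    (inclCell_vertex_side₁ m n C) (inclCell_cell₁ m n C)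
  have h2 := arrowClass_arrow_push m (Cell.vertex_le (TFace.Hom.dir_le_side₂ n C))
    (x := Cell.vertex (TFace.Hom.side₂ n C)) (y := TFace.Hom.cell₁ n C)
    (Cell.vertex_le (TFace.Hom.dir_le_side₂ (m ≫ n) C))
    (inclCell_vertex_side₂ m n C) (inclCell_cell₁ m n C)
  have h3 := arrowClass_arrow_push m (Cell.vertex_le (TFace.Hom.dir_le_side₂ n C))
    (x := Cell.vertex (TFace.Hom.side₂ n C)) (y := TFace.Hom.cell₂ n C)
    (Cell.vertex_le (TFace.Hom.dir_le_side₂ (m ≫ n) C))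
    (inclCell_vertex_side₂ m n C) (inclCell_cell₂ m n C)
  have h4 := arrowClass_arrow_push m (Cell.vertex_le (TFace.Hom.dir_le_side₁ n C))
    (x := Cell.vertex (TFace.Hom.side₁ n C)) (y := TFace.Hom.cell₂ n C)
    (Cell.vertex_le (TFace.Hom.dir_le_side₁ (m ≫ n) C))
    (inclCell_vertex_side₁ m n C) (inclCell_cell₂ m n C)
  rw [eq_sub_of_add_eq h1, eq_sub_of_add_eq h2, eq_sub_of_add_eq h3, eq_sub_of_add_eq h4]
  abel

end

end ToricArrangement

/-- The cell `[0, D]` of a central arrangement. -/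
@[simps]
noncomputable def Cell.apex {J V : Type*} [AddCommGroup V] [Module ℝ V] {χ : J → V →ₗ[ℝ] ℝ}
    (D : Chamber (central χ)) : Cell (central χ) :=
  ⟨Face.ofPoint _ 0, D.1, D.2, fun j => Or.inl (by simp)⟩

/-- The elements below `[0, D]` are those of `𝒮_D`. -/
theorem Cell.le_apex {J V : Type*} [AddCommGroup V] [Module ℝ V] {χ : J → V →ₗ[ℝ] ℝ}
    {D : Chamber (central χ)} {x : Cell (central χ)}
    (h : ∀ j, x.face.sign j = 0 → D.1.sign j = x.chamber.sign j) : x ≤ Cell.apex D :=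
  ⟨fun j => Or.inl (by simp), h⟩

theorem Cell.edge_le_apex {J V : Type*} [AddCommGroup V] [Module ℝ V] {χ : J → V →ₗ[ℝ] ℝ} [Finite J]
    (K : Face (central χ)) (D : Chamber (central χ)) : Cell.edge K D ≤ Cell.apex D :=
  Cell.le_apex fun j hj => by
    rw [Cell.edge_face] at hj
    rw [Cell.edge_chamber, Face.proj_sign, if_pos hj]

namespace ToricArrangement
section
variable {V : Type u} [AddCommGroup V] [Module ℝ V] {Γ : Submodule ℤ V} {ι : Type v}
  {A : ToricArrangement Γ ι} [Finite ι]

/-- The class of the arrow from `[K, D_K]` to the apex of the cone `𝒮_D`. -/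
noncomputable def coneClass (F : A.TFace) (D : Chamber F.arr) (K : Face F.arr) :
    (intModule ⟶ Chain₁ A.Sal) ⧸ boundaries₁ A.Sal :=
  arrowClass (arrow F (Cell.edge_le_apex K D))

theorem edge_congr {F : A.TFace} {D D' : Chamber F.arr} {K : Face F.arr}
    (h : ∀ j, K.sign j = 0 → D.1.sign j = D'.1.sign j) : Cell.edge K D = Cell.edge K D' := by
  refine Cell.ext rfl (Face.ext (funext fun j => ?_))
  rw [Cell.edge_chamber, Cell.edge_chamber, Face.proj_sign, Face.proj_sign]
  split_ifs with hj
  · exact h j hj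
  · rfl

theorem edge_anti {F : A.TFace} (D : Chamber F.arr) {K K' : Face F.arr} (h : K ≤ K') :
    Cell.edge K' D ≤ Cell.edge K D := by
  refine ⟨h, fun j hj => ?_⟩
  rw [Cell.edge_face] at hj
  have hj' : K.sign j = 0 := by
    rcases h j with h | h
    · exact h
    · exact h.trans hj
  rw [Cell.edge_chamber, Cell.edge_chamber, Face.proj_sign, Face.proj_sign, if_pos hj, if_pos hj']

theorem coneClass_anti {F : A.TFace} (D : Chamber F.arr) {K K' : Face F.arr} (h : K ≤ K') :
    coneClass F D K' = arrowClass (arrow F (edge_anti D h)) + coneClass F D K :=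
  arrowClass_arrow_trans F _ _

/-- The difference of the cones over `D` and `D'` does not change when one passes to a bigger face
within the intersection of `𝒮_D` and `𝒮_{D'}`. -/
theorem coneClass_sub_eq_of_le {F : A.TFace} {D D' : Chamber F.arr} {K K' : Face F.arr} (h : K ≤ K')
    (hD : ∀ j, K.sign j = 0 → D.1.sign j = D'.1.sign j) :
    coneClass F D K - coneClass F D' K = coneClass F D K' - coneClass F D' K' := by
  have hD' : ∀ j, K'.sign j = 0 → D.1.sign j = D'.1.sign j := fun j hj => hD j (by
    rcases h j with h | h
    · exact h
    · exact h.trans hj)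
  rw [coneClass_anti D h, coneClass_anti D' h,
    arrowClass_arrow F (edge_anti D h) (edge_anti D' h) (edge_congr hD') (edge_congr hD)]
  abel

/-- If `D` and `D'` differ in the hyperplane `i` only, the difference of the cones over `D` and `D'`
is the same at all faces on the same side of this hyperplane. -/
theorem coneClass_sub_eq {F : A.TFace} {D D' : Chamber F.arr} {i : F.Loc}
    (hD : ∀ j, j ≠ i → D.1.sign j = D'.1.sign j) {C C' : Face F.arr} (hi : C.sign i ≠ 0)
    (hC : C.sign i = C'.sign i) :
    coneClass F D C - coneClass F D' C = coneClass F D C' - coneClass F D' C' := by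
  obtain ⟨c, hc⟩ := C.realized
  obtain ⟨c', hc'⟩ := C'.realized
  have e : C = Face.ofPoint F.arr c := Face.ext (funext fun j => (hc j).symm)
  have e' : C' = Face.ofPoint F.arr c' := Face.ext (funext fun j => (hc' j).symm)
  have hconv : Convex ℝ {x | SignType.sign (F.arr i x) = C.sign i} := by
    have hlin : ∀ x, F.arr i x = A.χ i x := fun x => rfl
    rcases lt_trichotomy (C.sign i) 0 with h | h | h
    · have h' : C.sign i = -1 := by
        revert h; generalize C.sign i = s; revert s; decide
      simp only [h', sign_eq_neg_one_iff, hlin]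
      exact convex_halfSpace_lt (A.χ i).isLinear 0
    · exact absurd h hi
    · have h' : C.sign i = 1 := by
        revert h; generalize C.sign i = s; revert s; decide
      simp only [h', sign_eq_one_iff, hlin]
      exact convex_halfSpace_gt (A.χ i).isLinear 0
  rw [e, e']
  refine (locallyFiniteOnLines_of_finite F.arr).eq_of_face_le hconv
    (Q := fun x => coneClass F D (Face.ofPoint F.arr x) - coneClass F D' (Face.ofPoint F.arr x))
    (fun x hx y _ hxy => coneClass_sub_eq_of_le hxy fun j hj => hD j ?_) (hc i)
    ((hc' i).trans hC.symm)
  rintro rfl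
  exact hi (hx.symm.trans hj)

theorem edge_chamber_eq_vertex {F : A.TFace} (C D : Chamber F.arr) :
    Cell.edge C.1 D = Cell.vertex C := by
  refine Cell.ext rfl (Face.ext (funext fun j => ?_))
  rw [Cell.edge_chamber, Face.proj_sign, if_neg (C.2 j)]
  rfl

/-- The circle `Ω^{(m)}` consists of a path in each of the cones over `D₁` and `D₂`. -/
theorem chainClass_circleChain_eq_coneClass {F G : A.TFace} (m : F ⟶ G) (C : Chamber A.linear)
    {D₁ D₂ : Chamber F.arr}
    (h₁ : ∀ j, (TFace.Hom.dir m).sign j = 0 → D₁.1.sign j = C.1.sign j.1)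
    (h₂ : ∀ j, (TFace.Hom.dir m).sign j = 0 → D₂.1.sign j = - C.1.sign j.1) :
    chainClass (TFace.Hom.circleChain m C) =
      (coneClass F D₁ (TFace.Hom.side₁ m C).1 - coneClass F D₂ (TFace.Hom.side₁ m C).1) -
      (coneClass F D₁ (TFace.Hom.side₂ m C).1 - coneClass F D₂ (TFace.Hom.side₂ m C).1) := by
  rw [chainClass_circleChain]
  have hc₁ : TFace.Hom.cell₁ m C ≤ Cell.apex D₁ := by
    refine Cell.le_apex fun j hj => ?_
    have hj' : (TFace.Hom.dir m).sign j = 0 := hj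
    change _ = (Face.proj _ _).sign j
    rw [Face.proj_sign, if_pos hj', h₁ j hj']
    rfl
  have hc₂ : TFace.Hom.cell₂ m C ≤ Cell.apex D₂ := by
    refine Cell.le_apex fun j hj => ?_
    have hj' : (TFace.Hom.dir m).sign j = 0 := hj
    change _ = (Face.proj _ _).sign j
    rw [Face.proj_sign, if_pos hj', h₂ j hj']
    rfl
  have key : ∀ (D E : Chamber F.arr) (c : Cell F.arr) (h : Cell.vertex E ≤ c)
      (h' : c ≤ Cell.apex D),
      coneClass F D E.1 = arrowClass (arrow F h) + arrowClass (arrow F h') := by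
    intro D E c h h'
    rw [← arrowClass_arrow_trans]
    exact arrowClass_arrow F _ _ (edge_chamber_eq_vertex _ _) rfl
  rw [key D₁ _ _ (Cell.vertex_le (TFace.Hom.dir_le_side₁ m C)) hc₁,
    key D₂ (TFace.Hom.side₁ m C) _ (Cell.vertex_le (TFace.Hom.dir_le_side₁ m C)) hc₂,
    key D₁ _ _ (Cell.vertex_le (TFace.Hom.dir_le_side₂ m C)) hc₁,
    key D₂ (TFace.Hom.side₂ m C) _ (Cell.vertex_le (TFace.Hom.dir_le_side₂ m C)) hc₂]
  abel

theorem IsFacet.dir_eq_zero_iff {i : ι} {F G : A.TFace} (hG : IsFacet i G) (m : F ⟶ G) (j : F.Loc) :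
    (TFace.Hom.dir m).sign j = 0 ↔ j.1 = i :=
  (TFace.Hom.dir_eq_zero_iff m j).trans (hG j.1)

/-- Two facets of a hypertorus with a common face give homologous circles. -/
theorem chainClass_circleChain_eq_of_hom {i : ι} {F G₁ G₂ : A.TFace} (m₁ : F ⟶ G₁) (m₂ : F ⟶ G₂)
    (h₁ : IsFacet i G₁) (h₂ : IsFacet i G₂) (C : Chamber A.linear) :
    chainClass (TFace.Hom.circleChain m₁ C) = chainClass (TFace.Hom.circleChain m₂ C) := by
  have hi : F.carrier ⊆ A.hyp i := TFace.Hom.loc m₁ ((h₁ i).2 rfl)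
  have hs₁ : ∀ {G : A.TFace} (m : F ⟶ G), IsFacet i G → ∀ j : F.Loc, j.1 = i →
      (TFace.Hom.side₁ m C).1.sign j = C.1.sign j.1 := by
    intro G m hG j hj
    change (Face.proj _ _).sign j = _
    rw [Face.proj_sign, if_pos ((hG.dir_eq_zero_iff m j).2 hj)]
    rfl
  have hs₂ : ∀ {G : A.TFace} (m : F ⟶ G), IsFacet i G → ∀ j : F.Loc, j.1 = i →
      (TFace.Hom.side₂ m C).1.sign j = - C.1.sign j.1 := by
    intro G m hG j hj
    change (Face.proj _ _).sign j = _
    rw [Face.proj_sign, if_pos ((hG.dir_eq_zero_iff m j).2 hj)]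
    rfl
  have hD : ∀ j : F.Loc, j ≠ ⟨i, hi⟩ →
      (TFace.Hom.side₁ m₁ C).1.sign j = (TFace.Hom.side₂ m₁ C).1.sign j := by
    intro j hj
    have hj' : (TFace.Hom.dir m₁).sign j ≠ 0 :=
      fun h => hj (Subtype.ext ((h₁.dir_eq_zero_iff m₁ j).1 h))
    change (Face.proj _ _).sign j = (Face.proj _ _).sign j
    rw [Face.proj_sign, Face.proj_sign, if_neg hj', if_neg hj']
  rw [chainClass_circleChain_eq_coneClass m₁ C (D₁ := TFace.Hom.side₁ m₁ C)
      (D₂ := TFace.Hom.side₂ m₁ C) (fun j hj => hs₁ m₁ h₁ j ((h₁.dir_eq_zero_iff m₁ j).1 hj))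
      (fun j hj => hs₂ m₁ h₁ j ((h₁.dir_eq_zero_iff m₁ j).1 hj)),
    chainClass_circleChain_eq_coneClass m₂ C (D₁ := TFace.Hom.side₁ m₁ C)
      (D₂ := TFace.Hom.side₂ m₁ C) (fun j hj => hs₁ m₁ h₁ j ((h₂.dir_eq_zero_iff m₂ j).1 hj))
      (fun j hj => hs₂ m₁ h₁ j ((h₂.dir_eq_zero_iff m₂ j).1 hj)),
    coneClass_sub_eq (i := ⟨i, hi⟩) hD ((TFace.Hom.side₁ m₁ C).2 _)
      ((hs₁ m₁ h₁ ⟨i, hi⟩ rfl).trans (hs₁ m₂ h₂ ⟨i, hi⟩ rfl).symm),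
    coneClass_sub_eq (i := ⟨i, hi⟩) hD ((TFace.Hom.side₂ m₁ C).2 _)
      ((hs₂ m₁ h₁ ⟨i, hi⟩ rfl).trans (hs₂ m₂ h₂ ⟨i, hi⟩ rfl).symm)]

omit [Finite ι] in
theorem faceAt_add {x γ : V} (hγ : γ ∈ Γ) : A.faceAt (x + γ) = A.faceAt x := by
  choose n hn using fun i => exists_int (A := A) i hγ
  have key : ∀ (w : V) i (k : ℤ), A.lifted (i, k) (w + γ) = A.lifted (i, k - n i) w := by
    intro w i k
    rw [lifted_apply, lifted_apply, map_add, hn]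
    push_cast
    ring
  apply TFace.ext
  apply Set.Subset.antisymm
  · rintro _ ⟨w, hw, rfl⟩
    refine ⟨w - γ, ?_, ?_⟩
    · rintro ⟨i, k⟩
      have h1 := hw (i, k + n i)
      rw [Face.ofPoint_sign, key, add_sub_cancel_right] at h1
      have h2 := key (w - γ) i (k + n i)
      rw [sub_add_cancel, add_sub_cancel_right] at h2
      rw [Face.ofPoint_sign, ← h1, h2]
    · rw [map_sub, sub_eq_self]
      exact (Submodule.Quotient.mk_eq_zero _).2 hγ
  · rintro _ ⟨w, hw, rfl⟩
    refine ⟨w + γ, ?_, ?_⟩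
    · rintro ⟨i, k⟩
      rw [key, Face.ofPoint_sign, key]
      exact hw _
    · rw [map_add, add_eq_left]
      exact (Submodule.Quotient.mk_eq_zero _).2 hγ

omit [Finite ι] in
theorem exists_faceAt_of_subset_hyp {i : ι} {F : A.TFace} (hF : F.carrier ⊆ A.hyp i) :
    ∃ x, A.χ i x = A.a i ∧ A.faceAt x = F := by
  obtain ⟨x, rfl⟩ := F.exists_point
  obtain ⟨k, hk⟩ := (faceAt_subset_hyp_iff x i).1 hF
  obtain ⟨γ, hγ, hγi⟩ : (k : ℝ) ∈ (fun γ => A.χ i γ) '' (Γ : Set V) := by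
    rw [A.primitive i]
    exact ⟨k, rfl⟩
  have hγi' : A.χ i γ = k := hγi
  refine ⟨x + -γ, ?_, faceAt_add (Γ.neg_mem hγ)⟩
  rw [map_add, map_neg, hγi', hk]
  ring

/-- All morphisms to facets of a hypertorus give homologous circles: the class of such a circle is a
locally constant function on the hypertorus. -/
theorem chainClass_circleChain_eq {i : ι} {F G F' G' : A.TFace} (m : F ⟶ G) (m' : F' ⟶ G')
    (hG : IsFacet i G) (hG' : IsFacet i G') (C : Chamber A.linear) :
    chainClass (TFace.Hom.circleChain m C) = chainClass (TFace.Hom.circleChain m' C) := by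
  obtain ⟨x, hx, rfl⟩ := exists_faceAt_of_subset_hyp (TFace.Hom.loc m ((hG i).2 rfl))
  obtain ⟨x', hx', rfl⟩ := exists_faceAt_of_subset_hyp (TFace.Hom.loc m' ((hG' i).2 rfl))
  have hconv : Convex ℝ {v | A.χ i v = A.a i} := convex_hyperplane (A.χ i).isLinear _
  have h := A.locallyFiniteOnLines_lifted.eq_of_face_le hconv
    (Q := fun y => {z | ∃ (G : A.TFace) (n : A.faceAt y ⟶ G), IsFacet i G ∧
      z = chainClass (TFace.Hom.circleChain n C)}) (by
      intro y hy z hz hyz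
      ext c
      constructor
      · rintro ⟨G, n, hG, rfl⟩
        obtain ⟨G', n', hG'⟩ := exists_hom_facet
          ((faceAt_subset_hyp_iff (A := A) z i).2 ⟨0, by rw [Int.cast_zero, add_zero]; exact hz⟩)
        refine ⟨G', n', hG', ?_⟩
        rw [← chainClass_circleChain_comp (faceHom y z hyz) n']
        exact chainClass_circleChain_eq_of_hom _ _ hG hG' C
      · rintro ⟨G, n, hG, rfl⟩
        exact ⟨G, faceHom y z hyz ≫ n, hG, (chainClass_circleChain_comp _ _ _).symm⟩) hx hx'
  have hmem : chainClass (TFace.Hom.circleChain m C) ∈ {z | ∃ (G : A.TFace) (n : A.faceAt x ⟶ G),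
      IsFacet i G ∧ z = chainClass (TFace.Hom.circleChain n C)} := ⟨G, m, hG, rfl⟩
  have h' := h.subset hmem
  obtain ⟨G'', n, hG'', e⟩ := h'
  rw [e]
  exact chainClass_circleChain_eq_of_hom _ _ hG'' hG' C

end
end ToricArrangement

theorem Face.convex_carrier {J V : Type*} [AddCommGroup V] [Module ℝ V] {ℓ : J → V →ᵃ[ℝ] ℝ}
    (F : Face ℓ) : Convex ℝ F.carrier := by
  have h : F.carrier = ⋂ j, ℓ j ⁻¹' (SignType.sign ⁻¹' {F.sign j}) := by
    ext x
    simp [Face.carrier]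
  rw [h]
  refine convex_iInter fun j => Convex.affine_preimage (ℓ j) ?_
  generalize F.sign j = s
  have hs : s = 0 ∨ s = -1 ∨ s = 1 := by revert s; decide
  rcases hs with rfl | rfl | rfl
  · have e : SignType.sign ⁻¹' {0} = ({0} : Set ℝ) := by ext; simp
    rw [e]
    exact convex_singleton 0
  · have e : SignType.sign ⁻¹' {-1} = Set.Iio (0 : ℝ) := by
      ext
      exact sign_eq_neg_one_iff
    rw [e]
    exact convex_Iio 0
  · have e : SignType.sign ⁻¹' {1} = Set.Ioi (0 : ℝ) := by
      ext
      exact sign_eq_one_iff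
    rw [e]
    exact convex_Ioi 0

namespace ToricArrangement

/-! ### Layers and faces -/

section
variable {V : Type u} [AddCommGroup V] [Module ℝ V] {Γ : Submodule ℤ V} {ι : Type v}
  {A : ToricArrangement Γ ι}

theorem mkQ_mem_hyp_iff (x : V) (i : ι) :
    Γ.mkQ x ∈ A.hyp i ↔ ∃ k : ℤ, A.χ i x = A.a i + k := by
  constructor
  · rintro ⟨y, ⟨k, hk⟩, e⟩
    have hγ : x - y ∈ Γ := (Submodule.Quotient.eq Γ).1 e.symm
    obtain ⟨n, hn⟩ := exists_int (A := A) i hγ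
    refine ⟨k + n, ?_⟩
    rw [map_sub] at hn
    push_cast
    linarith
  · exact fun h => ⟨x, h, rfl⟩

theorem faceAt_subset_hyp_iff_mem (x : V) (i : ι) :
    (A.faceAt x).carrier ⊆ A.hyp i ↔ Γ.mkQ x ∈ A.hyp i := by
  rw [faceAt_subset_hyp_iff, mkQ_mem_hyp_iff]

theorem mkQ_mem_faceAt (x : V) : Γ.mkQ x ∈ (A.faceAt x).carrier := ⟨x, fun _ => rfl, rfl⟩

theorem TFace.eq_faceAt {F : A.TFace} {x : V} (h : Γ.mkQ x ∈ F.carrier) : F = A.faceAt x := by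
  obtain ⟨y, rfl⟩ := F.exists_point
  obtain ⟨z, hz, e⟩ := h
  have hγ : x - z ∈ Γ := (Submodule.Quotient.eq Γ).1 e.symm
  have h1 : A.faceAt z = A.faceAt y := by
    have : Face.ofPoint A.lifted z = Face.ofPoint A.lifted y := Face.ext (funext hz)
    simp only [faceAt, this]
  rw [← h1, ← faceAt_add hγ, add_sub_cancel]

theorem TFace.subset_hyp_of_mem {F : A.TFace} {p : V ⧸ Γ} {i : ι} (hF : p ∈ F.carrier)
    (hp : p ∈ A.hyp i) : F.carrier ⊆ A.hyp i := by
  obtain ⟨x, rfl⟩ := Submodule.mkQ_surjective Γ p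
  rw [TFace.eq_faceAt hF, faceAt_subset_hyp_iff_mem]
  exact hp

variable [TopologicalSpace V] [IsTopologicalAddGroup V] [ContinuousSMul ℝ V]

theorem TFace.isPreconnected (F : A.TFace) : IsPreconnected F.carrier := by
  obtain ⟨f, hf⟩ := F.isFace
  rw [hf]
  exact f.convex_carrier.isPreconnected.image _ continuous_quot_mk.continuousOn

omit [IsTopologicalAddGroup V] [ContinuousSMul ℝ V] in
theorem IsLayer.nonempty {L : Set (V ⧸ Γ)} (hL : A.IsLayer L) : L.Nonempty := by
  obtain ⟨S, x, hx, rfl⟩ := hL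
  exact ⟨x, mem_connectedComponentIn hx⟩

/-- A face that meets a layer is contained in it. -/
theorem IsLayer.face_subset {L : Set (V ⧸ Γ)} (hL : A.IsLayer L) {F : A.TFace} {p : V ⧸ Γ}
    (hpF : p ∈ F.carrier) (hpL : p ∈ L) : F.carrier ⊆ L := by
  obtain ⟨S, x, -, rfl⟩ := hL
  rw [connectedComponentIn_eq hpL]
  refine F.isPreconnected.subset_connectedComponentIn hpF ?_
  refine Set.subset_iInter₂ fun i hi => TFace.subset_hyp_of_mem hpF ?_
  exact Set.mem_iInter₂.1 (connectedComponentIn_subset _ _ hpL) i hi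

/-- A face whose support is a hypertorus lies in no other hypertorus, as this would contain the
support. -/
theorem isFacet_of_supp_eq {i : ι} {F : A.TFace} (h : F.supp = A.hyp i) : IsFacet i F := by
  have hF : F.carrier ⊆ A.hyp i := by
    rw [← h]
    exact Set.subset_sInter fun L hL => hL.2
  refine fun j => ⟨fun hj => ?_, fun e => e ▸ hF⟩
  obtain ⟨x, rfl⟩ := F.exists_point
  have hxF := mkQ_mem_faceAt (A := A) x
  -- the layer of the hypertorus `j` that contains `F` contains the support of `F`
  have hxj : Γ.mkQ x ∈ ⋂ l ∈ ({j} : Set ι), A.hyp l := by simpa using hj hxF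
  have hL : A.IsLayer (connectedComponentIn (⋂ l ∈ ({j} : Set ι), A.hyp l) (Γ.mkQ x)) :=
    ⟨{j}, _, hxj, rfl⟩
  have hij : A.hyp i ⊆ A.hyp j := by
    rw [← h]
    have hmem : _ ∈ {L | A.IsLayer L ∧ (A.faceAt x).carrier ⊆ L} :=
      ⟨hL, hL.face_subset hxF (mem_connectedComponentIn hxj)⟩
    refine (Set.sInter_subset_of_mem hmem).trans ?_
    exact (connectedComponentIn_subset _ _).trans
      (Set.iInter₂_subset j (Set.mem_singleton j))
  obtain ⟨k, hk⟩ := (mkQ_mem_hyp_iff x i).1 (hF hxF)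
  obtain ⟨l, hl⟩ := (mkQ_mem_hyp_iff x j).1 (hj hxF)
  refine (eq_of_ker_le (fun w hw => ?_) hk hl).symm
  by_contra hw'
  rw [LinearMap.mem_ker] at hw hw'
  have hmem : Γ.mkQ (x + (1 / (2 * A.χ j w)) • w) ∈ A.hyp i :=
    (mkQ_mem_hyp_iff _ i).2 ⟨k, by rw [map_add, map_smul, hw, smul_zero, add_zero, hk]⟩
  obtain ⟨n, hn⟩ := (mkQ_mem_hyp_iff _ j).1 (hij hmem)
  have h2 : 1 / (2 * A.χ j w) * A.χ j w = 1 / 2 := by field_simp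
  rw [map_add, map_smul, smul_eq_mul, h2, hl] at hn
  have h3 : (2 * (n - l) : ℤ) = 1 := by
    have : (2 * ((n : ℝ) - l)) = 1 := by linarith
    exact_mod_cast this
  omega

end

/-! ### Images of full subcomplexes -/

theorem _root_.ToricSalvetti.image_fullSubcomplex_le {C D : Type u} [Category.{v} C]
    [Category.{v} D] (Ψ : C ⥤ D) {S : Set C} {T : Set D} (h : ∀ x ∈ S, Ψ.obj x ∈ T) :
    (fullSubcomplex S).image (nerveMap Ψ) ≤ fullSubcomplex T := by
  rintro n _ ⟨s, hs, rfl⟩ i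
  exact h _ (hs i)

section
variable {V : Type u} [AddCommGroup V] [Module ℝ V] {Γ : Submodule ℤ V} {ι : Type v}
  {A : ToricArrangement Γ ι} [Finite ι] (L : Set (V ⧸ Γ))

omit [Finite ι] in
/-- If all hypertori containing `F` contain `L`, the local arrangements at `F` and at `π_L(F)` have
the same hyperplanes, so that `π_L^F` reflects the order. -/
theorem le_of_projCell_le {F : A.TFace} (hF : ∀ i : ι, F.carrier ⊆ A.hyp i → L ⊆ A.hyp i)
    {x y : Cell F.arr} (h : A.projCell L F x ≤ A.projCell L F y) : x ≤ y := by
  have key : ∀ j : F.Loc, ∃ i : (A.projFace L F).Loc, A.locMap L F i = j := fun j =>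
    ⟨⟨⟨j.1, hF j.1 j.2⟩, (A.projFace_subset_iff L F _).2 j.2⟩, rfl⟩
  constructor
  · intro j
    obtain ⟨i, rfl⟩ := key j
    exact h.1 i
  · intro j
    obtain ⟨i, rfl⟩ := key j
    exact h.2 i

/-- If all hypertori containing `F` contain `L`, then `Φ_L` is an isomorphism of the fibre over `F`
onto its image. -/
theorem fullSubcomplex_le_image {F : A.TFace}
    (hF : ∀ i : ι, F.carrier ⊆ A.hyp i → L ⊆ A.hyp i) (T : Set (Cell F.arr)) :
    fullSubcomplex ((fun y => obj (A.projFace L F) (A.projCell L F y)) '' T) ≤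
      (fullSubcomplex ((fun y => obj F y) '' T)).image (A.Phi L) := by
  intro n s hs
  let s' : ComposableArrows (A.quot L).SalCat n.unop.len := s
  choose y hyT hy using hs
  have hy' : ∀ a, obj (A.projFace L F) (A.projCell L F (y a)) = s'.obj a := hy
  have hle : ∀ {a b}, a ≤ b → y a ≤ y b := by
    intro a b hab
    refine le_of_projCell_le L hF (le_of_hom ?_)
    exact eqToHom (hy' a) ≫ s'.map (homOfLE hab) ≫ eqToHom (hy' b).symm
  let t : ComposableArrows A.SalCat n.unop.len :=
    { obj := fun a => obj F (y a)
      map := fun f => arrow F (hle (leOfHom f))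
      map_id := fun _ => (subsingleton_hom_obj _ _).elim _ _
      map_comp := fun _ _ => (subsingleton_hom_obj _ _).elim _ _ }
  refine ⟨t, fun i => ⟨y i, hyT i, rfl⟩, ?_⟩
  refine CategoryTheory.Functor.ext (F := t ⋙ A.PhiFunctor L) (G := s') hy' fun a b f => ?_
  have h := (subsingleton_hom_obj (F := A.projFace L F) (A.projCell L F (y a))
    (A.projCell L F (y b))).elim ((t ⋙ A.PhiFunctor L).map f)
    (eqToHom (hy' a) ≫ s'.map f ≫ eqToHom (hy' b).symm)
  exact h

theorem circle_eq {F G : A.TFace} (m : F ⟶ G) (C : Chamber A.linear) :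
    TFace.Hom.circle m C = fullSubcomplex ((fun y => obj F y) ''
      {Cell.vertex (TFace.Hom.side₁ m C), TFace.Hom.cell₁ m C,
        Cell.vertex (TFace.Hom.side₂ m C), TFace.Hom.cell₂ m C}) := by
  rw [Set.image_insert_eq, Set.image_insert_eq, Set.image_pair]
  rfl

theorem image_circle {F G : A.TFace} (m : F ⟶ G) (C : Chamber A.linear)
    (hF : ∀ i : ι, F.carrier ⊆ A.hyp i → L ⊆ A.hyp i) :
    (TFace.Hom.circle m C).image (A.Phi L) =
      TFace.Hom.circle ((A.projFunctor L).map m) (A.projChamber L C) := by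
  have e : TFace.Hom.circle ((A.projFunctor L).map m) (A.projChamber L C) =
      fullSubcomplex ((fun y => obj (A.projFace L F) (A.projCell L F y)) ''
        {Cell.vertex (TFace.Hom.side₁ m C), TFace.Hom.cell₁ m C,
          Cell.vertex (TFace.Hom.side₂ m C), TFace.Hom.cell₂ m C}) := by
    rw [Set.image_insert_eq, Set.image_insert_eq, Set.image_pair]
    rfl
  rw [e, circle_eq]
  refine le_antisymm (image_fullSubcomplex_le _ ?_) (fullSubcomplex_le_image L hF _)
  rintro _ ⟨y, hy, rfl⟩
  exact ⟨y, hy, rfl⟩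

theorem circleClass_Phi {F G : A.TFace} (m : F ⟶ G) (C : Chamber A.linear) :
    TFace.Hom.circleClass m C ≫ H₁map (A.Phi L) =
      TFace.Hom.circleClass ((A.projFunctor L).map m) (A.projChamber L C) := by
  unfold TFace.Hom.circleClass
  rw [homologyClass_map]
  exact homologyClass_congr _ _ (congrArg chainClass (circleChain_Phi L m C))

omit [Finite ι] in
theorem IsFacet.projFace {i : ι} {G : A.TFace} (hG : IsFacet i G) (hi : L ⊆ A.hyp i) :
    IsFacet (A := A.quot L) ⟨i, hi⟩ (A.projFace L G) := fun j => by
  rw [A.projFace_subset_iff, hG, Subtype.ext_iff]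

/-- If `F_m` is a chamber, the circle is degenerate: both chambers adjacent to `F_m` are `F_m`. -/
theorem circleClass_eq_zero {F G : A.TFace} (m : F ⟶ G) (C : Chamber A.linear)
    (h : ∀ j, (TFace.Hom.dir m).sign j ≠ 0) : TFace.Hom.circleClass m C = 0 := by
  refine homologyClass_eq_zero _ ?_
  have key : ∀ D : Chamber F.arr, D.1.proj (TFace.Hom.dir m) = TFace.Hom.dir m := by
    intro D
    ext j
    rw [Face.proj_sign, if_neg (h j)]
  have h1 : (TFace.Hom.side₁ m C).1 = TFace.Hom.dir m := key (F.localizeChamber C)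
  have h2 : (TFace.Hom.side₂ m C).1 = TFace.Hom.dir m := key (F.localizeChamber C).neg
  have hz : ∀ {x y : Cell F.arr} (h : x ≤ y), x = y → arrowClass (arrow F h) = 0 :=
    fun h e => arrowClass_eq_zero _ (congrArg (obj F) e)
  have e₁ := hz (x := Cell.vertex (TFace.Hom.side₁ m C)) (y := TFace.Hom.cell₁ m C)
    (Cell.vertex_le (TFace.Hom.dir_le_side₁ m C)) (Cell.ext h1 rfl)
  have e₂ := hz (x := Cell.vertex (TFace.Hom.side₂ m C)) (y := TFace.Hom.cell₁ m C)
    (Cell.vertex_le (TFace.Hom.dir_le_side₂ m C)) (Cell.ext h2 (h2.trans h1.symm))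
  have e₃ := hz (x := Cell.vertex (TFace.Hom.side₂ m C)) (y := TFace.Hom.cell₂ m C)
    (Cell.vertex_le (TFace.Hom.dir_le_side₂ m C)) (Cell.ext h2 rfl)
  have e₄ := hz (x := Cell.vertex (TFace.Hom.side₁ m C)) (y := TFace.Hom.cell₂ m C)
    (Cell.vertex_le (TFace.Hom.dir_le_side₁ m C)) (Cell.ext h1 (h1.trans h2.symm))
  rw [chainClass_circleChain, e₁, e₂, e₃, e₄]
  simp

/-- If the hypertorus of a circle is not among those of the quotient arrangement, the circle is
collapsed to a vertex. -/
theorem circleClass_Phi_eq_zero {i : ι} {F G : A.TFace} (m : F ⟶ G) (hG : IsFacet i G)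
    (hi : ¬ L ⊆ A.hyp i) (C : Chamber A.linear) :
    TFace.Hom.circleClass m C ≫ H₁map (A.Phi L) = 0 := by
  rw [circleClass_Phi]
  refine circleClass_eq_zero _ _ fun j hj => hi ?_
  have h : (TFace.Hom.dir m).sign (A.locMap L F j) = 0 := hj
  have h' := (hG.dir_eq_zero_iff m _).1 h
  rw [← h']
  exact j.1.2

theorem circleClass_eq {i : ι} {F G F' G' : A.TFace} (m : F ⟶ G) (m' : F' ⟶ G')
    (hG : IsFacet i G) (hG' : IsFacet i G') (C : Chamber A.linear) :
    TFace.Hom.circleClass m C = TFace.Hom.circleClass m' C :=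
  homologyClass_congr _ _ (chainClass_circleChain_eq m m' hG hG' C)

/-! ### The subcomplexes `𝒮_{Y, F₀}` and the projections -/

omit [Finite ι] in
theorem projFace_faceAt (x : V) : A.projFace L (A.faceAt x) =
    (A.quot L).faceAt ((A.tangent L).mkQ x) :=
  A.projFace_eq L (F := A.faceAt x) rfl (fun _ => rfl)

theorem projCell_mem_star {F : A.TFace} {F₀ : Face A.linear} {y : Cell F.arr}
    (hy : y ∈ Cell.star (F.localize F₀)) :
    A.projCell L F y ∈ Cell.star ((A.projFace L F).localize (A.projLinear L F₀)) := by
  obtain ⟨C, hC, hyC⟩ := hy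
  have hyC' : y.chamber = C.1.proj y.face := hyC
  refine ⟨⟨A.projLocal L F C.1, fun i => C.2 _⟩, fun i => hC (A.locMap L F i), ?_⟩
  change A.projLocal L F y.chamber = _
  rw [hyC']
  rfl

theorem image_starComplex_le [TopologicalSpace V] [IsTopologicalAddGroup V] [ContinuousSMul ℝ V]
    (Y : Set (V ⧸ Γ)) (F₀ : Face A.linear) :
    (A.starComplex Y F₀).image (A.Phi L) ≤
      (A.quot L).starComplex (A.projLayer L Y) (A.projLinear L F₀) := by
  refine image_fullSubcomplex_le _ ?_
  rintro _ ⟨F, hF, y, hy, rfl⟩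
  refine ⟨A.projFace L F, Set.subset_sInter fun Z hZ => ?_, _, projCell_mem_star L hy, rfl⟩
  obtain ⟨x, rfl⟩ := F.exists_point
  rw [projFace_faceAt]
  exact hZ.1.face_subset (mkQ_mem_faceAt _) (hZ.2 ⟨x, hF (mkQ_mem_faceAt x), rfl⟩)

end

/-! ### Finiteness of the stratification of the torus -/

section
variable {V : Type u} [NormedAddCommGroup V] [NormedSpace ℝ V] [FiniteDimensional ℝ V]
    {Γ : Submodule ℤ V} {ι : Type v} [Finite ι] (A : ToricArrangement Γ ι)

/-- There are finitely many faces: each one contains the class of a point of a fundamental domain,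
on which all but finitely many hyperplanes of the periodic arrangement have a constant sign. -/
theorem finite_tFace [DiscreteTopology Γ] [IsZLattice ℝ Γ] : Finite A.TFace := by
  have := ZLattice.module_free ℝ Γ
  have := ZLattice.module_finite ℝ Γ
  let b := (Module.Free.chooseBasis ℤ Γ).ofZLatticeBasis ℝ Γ
  have hb : Submodule.span ℤ (Set.range b) = Γ :=
    (Module.Free.chooseBasis ℤ Γ).ofZLatticeBasis_span ℝ
  have hrep : ∀ F : A.TFace, ∃ x ∈ ZSpan.fundamentalDomain b, A.faceAt x = F := by
    intro F
    obtain ⟨x, rfl⟩ := F.exists_point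
    refine ⟨ZSpan.fract b x, ZSpan.fract_mem_fundamentalDomain b x, ?_⟩
    rw [ZSpan.fract_apply, sub_eq_add_neg]
    exact faceAt_add (Γ.neg_mem (hb.le (ZSpan.floor b x).2))
  choose x hxD hx using hrep
  have hbound : ∀ i, ∃ N : ℤ, ∀ y ∈ ZSpan.fundamentalDomain b, |A.χ i y - A.a i| < N := by
    intro i
    have hc : Continuous fun y => A.χ i y - A.a i :=
      (A.χ i).continuous_of_finiteDimensional.sub continuous_const
    have hcomp : IsCompact (closure (ZSpan.fundamentalDomain b)) :=
      (ZSpan.fundamentalDomain_isBounded b).isCompact_closure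
    obtain ⟨R, hR⟩ := hcomp.exists_bound_of_continuousOn hc.continuousOn
    obtain ⟨N, hN⟩ := exists_nat_gt R
    exact ⟨N, fun y hy => (hR y (subset_closure hy)).trans_lt (by exact_mod_cast hN)⟩
  choose N hN using hbound
  let f : A.TFace → (i : ι) → Set.Icc (-N i) (N i) → SignType :=
    fun F i k => SignType.sign (A.lifted (i, k.1) (x F))
  refine Finite.of_injective f fun F G hFG => ?_
  rw [← hx F, ← hx G]
  have e : Face.ofPoint A.lifted (x F) = Face.ofPoint A.lifted (x G) := by
    ext ⟨i, k⟩
    by_cases hk : k ∈ Set.Icc (-N i) (N i)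
    · exact congrFun (congrFun hFG i) ⟨k, hk⟩
    · have h1 := abs_lt.1 (hN i _ (hxD F))
      have h2 := abs_lt.1 (hN i _ (hxD G))
      rw [Face.ofPoint_sign, Face.ofPoint_sign, lifted_apply, lifted_apply]
      rw [Set.mem_Icc, not_and_or, not_le, not_le] at hk
      rcases hk with hk | hk
      · have hk' : (k : ℝ) < -N i := by exact_mod_cast hk
        rw [sign_pos (by linarith), sign_pos (by linarith)]
      · have hk' : (N i : ℝ) < k := by exact_mod_cast hk
        rw [sign_neg (by linarith), sign_neg (by linarith)]
  simp only [faceAt, e]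

/-! ### The tangent space of a layer -/

variable {A}

/-- Nearby points over a layer differ by a tangent vector, hence so do, modulo the lattice, any two
points over the layer. -/
theorem IsLayer.sub_mem_tangent {M : Set (V ⧸ Γ)} (hM : A.IsLayer M) {x y : V}
    (hx : Γ.mkQ x ∈ M) (hy : Γ.mkQ y ∈ M) : ∃ γ ∈ Γ, y + γ - x ∈ A.tangent M := by
  have hpre : IsPreconnected M := by
    obtain ⟨S, p, -, rfl⟩ := hM
    exact isPreconnected_connectedComponentIn
  obtain ⟨x', y', hx', hy', h⟩ := hpre.induction₂
    (fun p q => ∃ x y : V, Γ.mkQ x = p ∧ Γ.mkQ y = q ∧ y - x ∈ A.tangent M)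
    (fun p hp => by
      obtain ⟨x, rfl⟩ := Submodule.mkQ_surjective Γ p
      have hev : ∀ᶠ y in nhds x, ∀ i, |A.χ i y - A.χ i x| < 1 := by
        refine Filter.eventually_all.2 fun i => ?_
        have hc : Continuous fun y => |A.χ i y - A.χ i x| :=
          ((A.χ i).continuous_of_finiteDimensional.sub continuous_const).abs
        have := hc.tendsto x
        simp only [sub_self, abs_zero] at this
        exact this.eventually (gt_mem_nhds one_pos)
      have hop : IsOpenMap Γ.mkQ := QuotientAddGroup.isOpenMap_coe (N := Γ.toAddSubgroup)
      have hmap := hop.image_mem_nhds hev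
      filter_upwards [self_mem_nhdsWithin, nhdsWithin_le_nhds hmap] with q hq hq'
      obtain ⟨y, hy, rfl⟩ := hq'
      refine ⟨x, y, rfl, rfl, ?_⟩
      refine (Submodule.mem_iInf _).2 fun i => (Submodule.mem_iInf _).2 fun hi => ?_
      obtain ⟨k, hk⟩ := (mkQ_mem_hyp_iff x i).1 (hi hp)
      obtain ⟨l, hl⟩ := (mkQ_mem_hyp_iff y i).1 (hi hq)
      have h1 : |A.χ i y - A.χ i x| < 1 := hy i
      rw [hk, hl] at h1
      have h2 : |((l - k : ℤ) : ℝ)| < 1 := by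
        push_cast
        convert h1 using 2
        ring
      have h3 : l - k = 0 := Int.abs_lt_one_iff.1 (by exact_mod_cast h2)
      rw [LinearMap.mem_ker, map_sub, hk, hl]
      have h4 : (l : ℝ) = k := by exact_mod_cast sub_eq_zero.1 h3
      rw [h4, sub_self])
    (fun p q r _ _ _ ⟨x, y, hx, hy, h⟩ ⟨y', z, hy', hz, h'⟩ => by
      have hγ : y - y' ∈ Γ := (Submodule.Quotient.eq Γ).1 (hy.trans hy'.symm)
      refine ⟨x, z + (y - y'), hx, ?_, ?_⟩
      · rw [map_add, hz, add_eq_left]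
        exact (Submodule.Quotient.mk_eq_zero _).2 hγ
      · have e : z + (y - y') - x = (y - x) + (z - y') := by abel
        rw [e]
        exact add_mem h h')
    (fun p q _ _ ⟨x, y, hx, hy, h⟩ => ⟨y, x, hy, hx, by rw [← neg_sub]; exact neg_mem h⟩) hx hy
  have h1 : x - x' ∈ Γ := (Submodule.Quotient.eq Γ).1 hx'.symm
  have h2 : y' - y ∈ Γ := (Submodule.Quotient.eq Γ).1 hy'
  refine ⟨(y' - y) + (x - x'), add_mem h2 h1, ?_⟩
  have e : y + (y' - y + (x - x')) - x = y' - x' := by abel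
  rw [e]
  exact h

omit [FiniteDimensional ℝ V] [Finite ι] in
/-- A layer is invariant under translations by tangent vectors. -/
theorem IsLayer.add_mem {M : Set (V ⧸ Γ)} (hM : A.IsLayer M) {x w : V}
    (hx : Γ.mkQ x ∈ M) (hw : w ∈ A.tangent M) : Γ.mkQ (x + w) ∈ M := by
  have hw' : ∀ i, M ⊆ A.hyp i → A.χ i w = 0 := fun i hi => tangent_le_ker hi hw
  obtain ⟨S, p, hp, rfl⟩ := hM
  have hseg : IsPreconnected ((fun v => Γ.mkQ v) '' segment ℝ x (x + w)) :=
    (convex_segment _ _).isPreconnected.image _ continuous_quot_mk.continuousOn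
  have hsub : (fun v => Γ.mkQ v) '' segment ℝ x (x + w) ⊆ ⋂ i ∈ S, A.hyp i := by
    rintro _ ⟨y, hy, rfl⟩
    refine Set.mem_iInter₂.2 fun i hi => ?_
    have hSi : connectedComponentIn (⋂ i ∈ S, A.hyp i) p ⊆ A.hyp i :=
      (connectedComponentIn_subset _ _).trans (Set.iInter₂_subset i hi)
    obtain ⟨k, hk⟩ := (mkQ_mem_hyp_iff x i).1 (hSi hx)
    rw [segment_eq_image'] at hy
    obtain ⟨t, -, rfl⟩ := hy
    refine (mkQ_mem_hyp_iff _ i).2 ⟨k, ?_⟩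
    rw [add_sub_cancel_left, map_add, map_smul, hw' i hSi, smul_zero, add_zero, hk]
  have h := hseg.subset_connectedComponentIn ⟨x, left_mem_segment ℝ _ _, rfl⟩ hsub
  rw [connectedComponentIn_eq hx]
  exact h ⟨x + w, right_mem_segment ℝ _ _, rfl⟩

/-- The projection along `X_L` takes the same value on all faces of a layer `M` with
`X_M ⊆ X_L`. -/
theorem IsLayer.projFace_eq {M L : Set (V ⧸ Γ)} (hM : A.IsLayer M)
    (hML : A.tangent M ≤ A.tangent L) {F G : A.TFace} (hF : F.carrier ⊆ M) (hG : G.carrier ⊆ M) :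
    A.projFace L F = A.projFace L G := by
  obtain ⟨x, rfl⟩ := F.exists_point
  obtain ⟨y, rfl⟩ := G.exists_point
  obtain ⟨γ, hγ, h⟩ := hM.sub_mem_tangent (hF (mkQ_mem_faceAt x)) (hG (mkQ_mem_faceAt y))
  rw [projFace_faceAt, projFace_faceAt]
  have e : (A.tangent L).mkQ x = (A.tangent L).mkQ y + (A.tangent L).mkQ γ := by
    rw [← map_add, eq_comm, ← sub_eq_zero, ← map_sub]
    exact (Submodule.Quotient.mk_eq_zero _).2 (hML h)
  rw [e]
  exact faceAt_add ⟨γ, hγ, rfl⟩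

end

/-! ### Vertices and edges of a one-dimensional layer -/

section
variable {V : Type u} [AddCommGroup V] [Module ℝ V] {Γ : Submodule ℤ V} {ι : Type v}
  {A : ToricArrangement Γ ι}

theorem ofPoint_add_le {x y γ : V} (hγ : γ ∈ Γ)
    (h : Face.ofPoint A.lifted x ≤ Face.ofPoint A.lifted y) :
    Face.ofPoint A.lifted (x + γ) ≤ Face.ofPoint A.lifted (y + γ) := by
  rintro ⟨i, k⟩
  obtain ⟨n, hn⟩ := exists_int (A := A) i hγ
  have key : ∀ w : V, A.lifted (i, k) (w + γ) = A.lifted (i, k - n) w := by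
    intro w
    rw [lifted_apply, lifted_apply, map_add, hn]
    push_cast
    ring
  rw [Face.ofPoint_sign, Face.ofPoint_sign, key, key]
  exact h (i, k - n)

/-- If `q` lies in a bigger face than `p`, any hypertorus through `q` contains the segment from `p`
to `q`. -/
theorem apply_sub_eq_zero_of_le {p q : V} (h : Face.ofPoint A.lifted p ≤ Face.ofPoint A.lifted q)
    {i : ι} (hq : Γ.mkQ q ∈ A.hyp i) : A.χ i (q - p) = 0 := by
  obtain ⟨k, hk⟩ := (mkQ_mem_hyp_iff q i).1 hq
  have h1 : (Face.ofPoint A.lifted q).sign (i, k) = 0 := by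
    rw [Face.ofPoint_sign, sign_eq_zero_iff, lifted_apply, hk, sub_self]
  have h2 : (Face.ofPoint A.lifted p).sign (i, k) = 0 := by
    rcases h (i, k) with h | h
    · exact h
    · exact h.trans h1
  rw [Face.ofPoint_sign, sign_eq_zero_iff, lifted_apply, sub_eq_zero] at h2
  rw [map_sub, hk, h2, sub_self]

theorem faceAt_congr {x y : V} (h : Face.ofPoint A.lifted x = Face.ofPoint A.lifted y) :
    A.faceAt x = A.faceAt y := by
  simp only [faceAt, h]

/-- `P` is a vertex of the layer `M` in direction `u`: some hypertorus through `P` is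
transversal. -/
def IsVertexOf (M : Set (V ⧸ Γ)) (u : V) (P : A.TFace) : Prop :=
  P.carrier ⊆ M ∧ ∃ i, A.χ i u ≠ 0 ∧ P.carrier ⊆ A.hyp i

/-- `G` is an edge of the layer `M` in direction `u`: no hypertorus through `G` is transversal. -/
def IsEdgeOf (M : Set (V ⧸ Γ)) (u : V) (G : A.TFace) : Prop :=
  G.carrier ⊆ M ∧ ∀ i, G.carrier ⊆ A.hyp i → A.χ i u = 0

theorem isEdgeOf_iff {M : Set (V ⧸ Γ)} {u : V} {G : A.TFace} :
    IsEdgeOf M u G ↔ G.carrier ⊆ M ∧ ¬ IsVertexOf M u G := by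
  unfold IsEdgeOf IsVertexOf
  refine and_congr_right fun h => ?_
  push Not
  exact ⟨fun h' _ i hi hG => hi (h' i hG), fun h' i hG => by
    by_contra hi
    exact h' h i hi hG⟩

variable [Finite ι]

/-- The edge `G` of the layer `M` starts at `P`, in the direction of the chamber `D`: some morphism
`m : P → G` points from `P` into a face of `D(P)`. -/
def Starts (M : Set (V ⧸ Γ)) (D : Chamber A.linear) (G P : A.TFace) : Prop :=
  G.carrier ⊆ M ∧ P.carrier ⊆ M ∧ G ≠ P ∧ ∃ m : P ⟶ G, TFace.Hom.dir m ≤ P.localize D.1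

variable {M : Set (V ⧸ Γ)} {u : V} {D : Chamber A.linear}

/-- Lifts `p` and `q` of points of `P` and of an edge starting there differ by a positive multiple
of the direction vector `u`. -/
theorem Starts.exists_pos (hu : A.tangent M = Submodule.span ℝ {u})
    (hD : ∀ i, A.χ i u ≠ 0 → D.1.sign i = SignType.sign (A.χ i u)) {G P : A.TFace}
    (hGP : Starts M D G P) :
    ∃ f g : Face A.lifted, P.carrier = Γ.mkQ '' f.carrier ∧ G.carrier = Γ.mkQ '' g.carrier ∧
      ∀ p ∈ f.carrier, ∀ q ∈ g.carrier, ∃ s : ℝ, 0 < s ∧ q = p + s • u ∧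
        Face.ofPoint A.lifted p ≤ Face.ofPoint A.lifted q ∧ IsVertexOf M u P := by
  obtain ⟨hG, hP, hne, m, hm⟩ := hGP
  obtain ⟨f, g, hfg, hPf, hGg, hd⟩ := TFace.Hom.lifts m
  refine ⟨f, g, hPf, hGg, fun p hp q hq => ?_⟩
  have hf : f = Face.ofPoint A.lifted p := Face.ext (funext fun j => (hp j).symm)
  have hg : g = Face.ofPoint A.lifted q := Face.ext (funext fun j => (hq j).symm)
  subst hf hg
  have hqM : Γ.mkQ q ∈ M := hG (hGg ▸ ⟨q, hq, rfl⟩)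
  have hqp : q - p ∈ A.tangent M :=
    (Submodule.mem_iInf _).2 fun i => (Submodule.mem_iInf _).2 fun hi =>
      apply_sub_eq_zero_of_le hfg (hi hqM)
  rw [hu, Submodule.mem_span_singleton] at hqp
  obtain ⟨s, hs⟩ := hqp
  have hval : ∀ i, A.χ i q = A.χ i p + s * A.χ i u := by
    intro i
    rw [← sub_eq_iff_eq_add', ← map_sub, ← hs, map_smul, smul_eq_mul]
  have hne' : Face.ofPoint A.lifted p ≠ Face.ofPoint A.lifted q := by
    intro e
    exact hne (TFace.ext (by rw [hGg, hPf, e]))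
  have hvert : IsVertexOf M u P := by
    by_contra hcon
    refine hne' (Face.ext (funext fun ⟨i, k⟩ => ?_))
    rcases hfg (i, k) with h | h
    · have hi : P.carrier ⊆ A.hyp i := by
        rw [hPf, subset_hyp_iff]
        exact ⟨k, h⟩
      have hi' := (isEdgeOf_iff.2 ⟨hP, hcon⟩).2 i hi
      rw [Face.ofPoint_sign, Face.ofPoint_sign, lifted_apply, lifted_apply, hval, hi', mul_zero,
        add_zero]
    · exact h
  have hs0 : s ≠ 0 := by
    rintro rfl
    rw [zero_smul, eq_comm, sub_eq_zero] at hs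
    exact hne' (by rw [hs])
  obtain ⟨i, hi, hPi⟩ := hvert.2
  refine ⟨s, ?_, by rw [hs]; abel, hfg, hvert⟩
  have hPi' := hPi
  rw [hPf, subset_hyp_iff] at hPi'
  obtain ⟨k, hk⟩ := hPi'
  have h1 := hd ⟨i, hPi⟩ k hk
  rw [Face.ofPoint_sign, sign_eq_zero_iff, lifted_apply] at hk
  rw [Face.ofPoint_sign, lifted_apply, hval] at h1
  have h2 : A.χ i p + s * A.χ i u - (A.a i + k) = s * A.χ i u := by linarith
  rw [h2] at h1
  rcases hm ⟨i, hPi⟩ with h | h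
  · rw [h, sign_eq_zero_iff] at h1
    exact absurd h1 (mul_ne_zero hs0 hi)
  · have h3 : (P.localize D.1).sign ⟨i, hPi⟩ = SignType.sign (A.χ i u) := hD i hi
    rw [h, h3, sign_mul] at h1
    have h4 : SignType.sign (A.χ i u) ≠ 0 := by rwa [Ne, sign_eq_zero_iff]
    have h5 : SignType.sign s = 1 := by
      revert h1 h4
      generalize SignType.sign (A.χ i u) = b
      generalize SignType.sign s = c
      revert b c
      decide
    exact sign_eq_one_iff.1 h5

theorem Starts.exists_of_edge (hu : A.tangent M = Submodule.span ℝ {u})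
    (hD : ∀ i, A.χ i u ≠ 0 → D.1.sign i = SignType.sign (A.χ i u)) {q : V} {P : A.TFace}
    (hGP : Starts M D (A.faceAt q) P) : ∃ s : ℝ, 0 < s ∧ P = A.faceAt (q - s • u) ∧
      Face.ofPoint A.lifted (q - s • u) ≤ Face.ofPoint A.lifted q ∧ IsVertexOf M u P := by
  obtain ⟨f, g, hPf, hGg, h⟩ := hGP.exists_pos hu hD
  obtain ⟨q', hq', e⟩ : Γ.mkQ q ∈ Γ.mkQ '' g.carrier := hGg ▸ mkQ_mem_faceAt q
  obtain ⟨p, hp⟩ := f.realized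
  obtain ⟨s, hs, e', hle, hv⟩ := h p hp q' hq'
  have hγ : q - q' ∈ Γ := (Submodule.Quotient.eq Γ).1 e.symm
  have ep : p + (q - q') = q - s • u := by rw [e']; abel
  refine ⟨s, hs, ?_, ?_, hv⟩
  · rw [← ep, faceAt_add hγ]
    exact TFace.eq_faceAt (hPf ▸ ⟨p, hp, rfl⟩)
  · have := ofPoint_add_le hγ hle
    rwa [ep, add_sub_cancel] at this

theorem Starts.exists_of_vertex (hu : A.tangent M = Submodule.span ℝ {u})
    (hD : ∀ i, A.χ i u ≠ 0 → D.1.sign i = SignType.sign (A.χ i u)) {p : V} {G : A.TFace}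
    (hGP : Starts M D G (A.faceAt p)) : ∃ s : ℝ, 0 < s ∧ G = A.faceAt (p + s • u) ∧
      Face.ofPoint A.lifted p ≤ Face.ofPoint A.lifted (p + s • u) := by
  obtain ⟨f, g, hPf, hGg, h⟩ := hGP.exists_pos hu hD
  obtain ⟨p', hp', e⟩ : Γ.mkQ p ∈ Γ.mkQ '' f.carrier := hPf ▸ mkQ_mem_faceAt p
  obtain ⟨q, hq⟩ := g.realized
  obtain ⟨s, hs, e', hle, -⟩ := h p' hp' q hq
  have hγ : p - p' ∈ Γ := (Submodule.Quotient.eq Γ).1 e.symm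
  have eq' : q + (p - p') = p + s • u := by rw [e']; abel
  refine ⟨s, hs, ?_, ?_⟩
  · rw [← eq', faceAt_add hγ]
    exact TFace.eq_faceAt (hGg ▸ ⟨q, hq, rfl⟩)
  · have := ofPoint_add_le hγ hle
    rwa [eq', add_sub_cancel] at this

theorem Starts.isVertexOf (hu : A.tangent M = Submodule.span ℝ {u})
    (hD : ∀ i, A.χ i u ≠ 0 → D.1.sign i = SignType.sign (A.χ i u)) {G P : A.TFace}
    (hGP : Starts M D G P) : IsVertexOf M u P := by
  obtain ⟨q, rfl⟩ := G.exists_point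
  obtain ⟨s, -, -, -, hv⟩ := hGP.exists_of_edge hu hD
  exact hv

theorem Starts.isEdgeOf (hu : A.tangent M = Submodule.span ℝ {u})
    (hD : ∀ i, A.χ i u ≠ 0 → D.1.sign i = SignType.sign (A.χ i u)) {G P : A.TFace}
    (hGP : Starts M D G P) : IsEdgeOf M u G := by
  obtain ⟨q, rfl⟩ := G.exists_point
  obtain ⟨s, hs, -, hle, -⟩ := hGP.exists_of_edge hu hD
  refine ⟨hGP.1, fun i hi => ?_⟩
  have h := apply_sub_eq_zero_of_le hle (hi (mkQ_mem_faceAt q))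
  rw [sub_sub_cancel, map_smul, smul_eq_mul] at h
  exact (mul_eq_zero.1 h).resolve_left hs.ne'

/-- At most one edge of a layer starts at a vertex in the given direction. -/
theorem Starts.edge_unique (hu : A.tangent M = Submodule.span ℝ {u})
    (hD : ∀ i, A.χ i u ≠ 0 → D.1.sign i = SignType.sign (A.χ i u)) {G G' P : A.TFace}
    (h : Starts M D G P) (h' : Starts M D G' P) : G = G' := by
  obtain ⟨p, rfl⟩ := P.exists_point
  obtain ⟨s, hs, rfl, hle⟩ := h.exists_of_vertex hu hD
  obtain ⟨s', hs', rfl, hle'⟩ := h'.exists_of_vertex hu hD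
  refine faceAt_congr (Face.ext (funext fun ⟨i, k⟩ => ?_))
  by_cases h0 : (Face.ofPoint A.lifted p).sign (i, k) = 0
  · rw [Face.ofPoint_sign, sign_eq_zero_iff, lifted_apply, sub_eq_zero] at h0
    rw [Face.ofPoint_sign, Face.ofPoint_sign, lifted_apply, lifted_apply, map_add (A.χ i),
      map_add (A.χ i), h0, add_sub_cancel_left, add_sub_cancel_left, map_smul (A.χ i),
      map_smul (A.χ i), smul_eq_mul, smul_eq_mul,
      sign_mul, sign_mul, sign_pos hs, sign_pos hs']
  · exact ((hle _).resolve_left h0).symm.trans ((hle' _).resolve_left h0)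

/-- An edge of a layer starts at one vertex only, as it ends when a transversal hypertorus is
met. -/
theorem Starts.vertex_unique (hu : A.tangent M = Submodule.span ℝ {u})
    (hD : ∀ i, A.χ i u ≠ 0 → D.1.sign i = SignType.sign (A.χ i u)) {G P P' : A.TFace}
    (h : Starts M D G P) (h' : Starts M D G P') : P = P' := by
  have hG := h.isEdgeOf hu hD
  obtain ⟨q, rfl⟩ := G.exists_point
  have key : ∀ s s' : ℝ, 0 < s → s < s' → IsVertexOf M u (A.faceAt (q - s • u)) →
      ¬ Face.ofPoint A.lifted (q - s' • u) ≤ Face.ofPoint A.lifted q := by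
    rintro s s' hs hss' ⟨-, i, hi, hsi⟩ hle
    obtain ⟨k, hk⟩ := (faceAt_subset_hyp_iff _ i).1 hsi
    rw [map_sub, map_smul, smul_eq_mul] at hk
    have h1 := hle (i, k)
    rw [Face.ofPoint_sign, Face.ofPoint_sign, lifted_apply, lifted_apply, map_sub (A.χ i),
      map_smul (A.χ i), smul_eq_mul] at h1
    have e1 : A.χ i q - s' * A.χ i u - (A.a i + k) = (s' - s) * - A.χ i u := by
      linear_combination hk
    have e2 : A.χ i q - (A.a i + k) = s * A.χ i u := by linear_combination hk
    rw [e1, e2, sign_mul, sign_mul, sign_pos hs, sign_pos (sub_pos.2 hss'), one_mul, one_mul,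
      Left.sign_neg] at h1
    have h2 : SignType.sign (A.χ i u) ≠ 0 := by rwa [Ne, sign_eq_zero_iff]
    revert h1 h2
    generalize SignType.sign (A.χ i u) = b
    revert b
    decide
  obtain ⟨s, hs, rfl, hle, hv⟩ := h.exists_of_edge hu hD
  obtain ⟨s', hs', rfl, hle', hv'⟩ := h'.exists_of_edge hu hD
  rcases lt_trichotomy s s' with hlt | rfl | hlt
  · exact absurd hle' (key s s' hs hlt hv)
  · rfl
  · exact absurd hle (key s' s hs' hlt hv')

/-- Two points on a line in direction `u`, in comparable faces of the layer, give a vertex and an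
edge starting there. -/
theorem starts_of_le (hD : ∀ i, A.χ i u ≠ 0 → D.1.sign i = SignType.sign (A.χ i u)) {p : V} {s : ℝ}
    (hs : 0 < s) (hle : Face.ofPoint A.lifted p ≤ Face.ofPoint A.lifted (p + s • u))
    (hP : IsVertexOf M u (A.faceAt p)) (hG : (A.faceAt (p + s • u)).carrier ⊆ M) :
    Starts M D (A.faceAt (p + s • u)) (A.faceAt p) := by
  refine ⟨hG, hP.1, fun e => ?_, faceHom _ _ hle, fun i => ?_⟩
  · obtain ⟨i, hi, hPi⟩ := hP.2
    rw [← e] at hPi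
    have h := apply_sub_eq_zero_of_le hle (hPi (mkQ_mem_faceAt _))
    rw [add_sub_cancel_left, map_smul, smul_eq_mul] at h
    exact hi ((mul_eq_zero.1 h).resolve_left hs.ne')
  · have e : (TFace.Hom.dir (faceHom _ _ hle)).sign i = SignType.sign (A.χ i u) := by
      change SignType.sign (A.χ i (p + s • u - p)) = _
      rw [add_sub_cancel_left, map_smul, smul_eq_mul, sign_mul, sign_pos hs, one_mul]
    rw [e]
    by_cases hi : A.χ i u = 0
    · exact Or.inl (by rw [hi, sign_zero])
    · exact Or.inr (hD i hi).symm

end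

section
variable {V : Type u} [NormedAddCommGroup V] [NormedSpace ℝ V] [FiniteDimensional ℝ V]
    {Γ : Submodule ℤ V} {ι : Type v} [Finite ι] {A : ToricArrangement Γ ι}
  {M : Set (V ⧸ Γ)} {u : V} {D : Chamber A.linear}

omit [FiniteDimensional ℝ V] in
theorem IsLayer.exists_starts_of_isVertexOf (hM : A.IsLayer M)
    (hu : A.tangent M = Submodule.span ℝ {u})
    (hD : ∀ i, A.χ i u ≠ 0 → D.1.sign i = SignType.sign (A.χ i u)) {P : A.TFace}
    (hP : IsVertexOf M u P) : ∃ G, Starts M D G P := by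
  obtain ⟨p, rfl⟩ := P.exists_point
  obtain ⟨t, ht, hle⟩ := exists_ofPoint_le (A := A) p u
  refine ⟨_, starts_of_le hD ht hle hP ?_⟩
  refine hM.face_subset (mkQ_mem_faceAt _) (hM.add_mem (hP.1 (mkQ_mem_faceAt p)) ?_)
  rw [hu]
  exact Submodule.smul_mem _ _ (Submodule.mem_span_singleton_self u)

omit [FiniteDimensional ℝ V] in
/-- Moving backwards from a point of an edge one reaches a transversal hypertorus, as the
arrangement is essential; the first such point is the vertex where the edge starts. -/
theorem IsLayer.exists_starts_of_isEdgeOf (hM : A.IsLayer M) (hA : A.Essential) (hu0 : u ≠ 0)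
    (hu : A.tangent M = Submodule.span ℝ {u})
    (hD : ∀ i, A.χ i u ≠ 0 → D.1.sign i = SignType.sign (A.χ i u)) {G : A.TFace}
    (hG : IsEdgeOf M u G) : ∃ P, Starts M D G P := by
  obtain ⟨q, rfl⟩ := G.exists_point
  let T : Set ℝ := Set.Ici 0 ∩ ⋃ i ∈ {i | A.χ i u ≠ 0},
    (fun t => A.χ i q - A.a i - t * A.χ i u) ⁻¹' Set.range (Int.cast : ℤ → ℝ)
  have hT : ∀ t, t ∈ T ↔ 0 ≤ t ∧ ∃ i, A.χ i u ≠ 0 ∧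
      ∃ k : ℤ, (k : ℝ) = A.χ i q - A.a i - t * A.χ i u := by
    intro t
    simp [T]
  have hclosed : IsClosed T := by
    refine isClosed_Ici.inter ((Set.toFinite _).isClosed_biUnion fun i _ => ?_)
    exact Int.isClosedEmbedding_coe_real.isClosed_range.preimage (by fun_prop)
  have hne : T.Nonempty := by
    obtain ⟨i, hi⟩ : ∃ i, A.χ i u ≠ 0 := by
      by_contra! hcon
      exact hu0 (hA u hcon)
    set c := A.χ i q - A.a i with hc
    rcases lt_or_gt_of_ne hi with h | h
    · refine ⟨(c - ⌈c⌉) / A.χ i u, (hT _).2 ⟨?_, i, hi, ⌈c⌉, by field_simp; ring⟩⟩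
      exact div_nonneg_of_nonpos (by linarith [Int.le_ceil c]) h.le
    · refine ⟨(c - ⌊c⌋) / A.χ i u, (hT _).2 ⟨?_, i, hi, ⌊c⌋, by field_simp; ring⟩⟩
      exact div_nonneg (by linarith [Int.floor_le c]) h.le
  have hbdd : BddBelow T := ⟨0, fun t ht => ht.1⟩
  have hmem := hclosed.csInf_mem hne hbdd
  set t₀ := sInf T with ht₀
  obtain ⟨h0, i₀, hi₀, k₀, hk₀⟩ := (hT _).1 hmem
  have hedge : ∀ i, A.χ i u ≠ 0 → ∀ k : ℤ, A.χ i q - (A.a i + k) ≠ 0 := by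
    intro i hi k hk
    exact hi (hG.2 i ((faceAt_subset_hyp_iff _ i).2 ⟨k, sub_eq_zero.1 hk⟩))
  have hpos : 0 < t₀ := by
    refine lt_of_le_of_ne h0 fun e => hedge i₀ hi₀ k₀ ?_
    rw [← e] at hk₀
    linarith
  have e : q - t₀ • u + t₀ • u = q := sub_add_cancel _ _
  have hle : Face.ofPoint A.lifted (q - t₀ • u) ≤ Face.ofPoint A.lifted (q - t₀ • u + t₀ • u) := by
    rw [e]
    rintro ⟨i, k⟩
    have hsgn : A.lifted (i, k) (q - t₀ • u) = A.χ i q - (A.a i + k) - t₀ * A.χ i u := by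
      rw [lifted_apply, map_sub, map_smul, smul_eq_mul]
      ring
    rw [Face.ofPoint_sign, Face.ofPoint_sign, hsgn, lifted_apply]
    by_cases hi : A.χ i u = 0
    · right
      rw [hi, mul_zero, sub_zero]
    · rcases sign_sub_mul_eq_or_exists_zero (b := A.χ i u) hpos (hedge i hi k) with h | h | h
      · exact Or.inl h
      · exact Or.inr h
      · obtain ⟨t, ht, htt, h⟩ := h
        have : t ∈ T := (hT t).2 ⟨ht.le, i, hi, k, by linarith⟩
        exact absurd (csInf_le hbdd this) (not_le.2 htt)
  have hqM : Γ.mkQ q ∈ M := hG.1 (mkQ_mem_faceAt q)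
  have hpM : (A.faceAt (q - t₀ • u)).carrier ⊆ M := by
    refine hM.face_subset (mkQ_mem_faceAt _) ?_
    rw [sub_eq_add_neg]
    refine hM.add_mem hqM (neg_mem ?_)
    rw [hu]
    exact Submodule.smul_mem _ _ (Submodule.mem_span_singleton_self u)
  have hv : IsVertexOf M u (A.faceAt (q - t₀ • u)) := by
    refine ⟨hpM, i₀, hi₀, (faceAt_subset_hyp_iff _ _).2 ⟨k₀, ?_⟩⟩
    rw [map_sub, map_smul, smul_eq_mul]
    linarith
  have h := starts_of_le hD hpos hle hv (by rw [e]; exact hG.1)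
  rw [e] at h
  exact ⟨_, h⟩

end

end ToricArrangement

/-! ### Sums of edges of a nerve -/

section
variable {𝒞 : Type w₁} [Category.{w₂} 𝒞]

theorem edgeOf_eq {x y : 𝒞} (hxy : Subsingleton (x ⟶ y)) (f : x ⟶ y) (e : (nerve 𝒞) _⦋1⦌)
    (hl : ComposableArrows.left (n := 1) e = x) (hr : ComposableArrows.right (n := 1) e = y) :
    edgeOf f = e :=
  ComposableArrows.ext₁ hl.symm hr.symm (hxy.elim _ _)

theorem edgeOf_hom (e : (nerve 𝒞) _⦋1⦌) : edgeOf (ComposableArrows.hom e) = e :=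
  ComposableArrows.ext₁ rfl rfl ((Category.id_comp _).trans (Category.comp_id _)).symm

theorem edgeOf_inj {x y x' y' : 𝒞} {f : x ⟶ y} {f' : x' ⟶ y'} (h : edgeOf f = edgeOf f') :
    x = x' ∧ y = y' :=
  ⟨congrArg (fun e : ComposableArrows 𝒞 1 => e.left) h,
    congrArg (fun e : ComposableArrows 𝒞 1 => e.right) h⟩

/-- The sum of a finite family of edges, as a family of coefficients. -/
noncomputable def edgeSum {I : Type*} [Fintype I] {x y : I → 𝒞} (f : ∀ a, x a ⟶ y a) :
    (nerve 𝒞) _⦋1⦌ →₀ ℤ :=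
  ∑ a, Finsupp.single (edgeOf (f a)) 1

open Classical in
theorem edgeSum_apply {I : Type*} [Fintype I] {x y : I → 𝒞} (f : ∀ a, x a ⟶ y a)
    (hf : Function.Injective fun a => edgeOf (f a)) (e : (nerve 𝒞) _⦋1⦌) {p : Prop}
    (hp : p ↔ ∃ a, edgeOf (f a) = e) : edgeSum f e = if p then 1 else 0 := by
  rw [edgeSum, Finsupp.finsetSum_apply]
  split_ifs with h
  · obtain ⟨a, rfl⟩ := hp.1 h
    rw [Finset.sum_eq_single a, Finsupp.single_eq_same]
    · intro b _ hb
      exact Finsupp.single_eq_of_ne fun e => hb (hf e.symm)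
    · exact fun h => absurd (Finset.mem_univ a) h
  · refine Finset.sum_eq_zero fun a _ => Finsupp.single_eq_of_ne fun e' => h (hp.2 ⟨a, e'.symm⟩)

/-- The chain with given coefficients, as an additive map. -/
noncomputable def chainHom (X : SSet) : (X _⦋1⦌ →₀ ℤ) →+ (intModule ⟶ Chain₁ X) :=
  (Finsupp.linearCombination ℤ X.ιChainComplex).toAddMonoidHom

theorem chainHom_apply {X : SSet} (c : X _⦋1⦌ →₀ ℤ) : chainHom X c = chain c :=
  Finsupp.linearCombination_apply _ _

theorem chainHom_edgeSum {I : Type*} [Fintype I] {x y : I → 𝒞} (f : ∀ a, x a ⟶ y a) :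
    chainHom (nerve 𝒞) (edgeSum f) = ∑ a, (nerve 𝒞).ιChainComplex (edgeOf (f a)) := by
  rw [edgeSum, map_sum]
  refine Finset.sum_congr rfl fun a _ => ?_
  exact (Finsupp.linearCombination_single _ _ _).trans (one_smul _ _)

/-- An object as a `0`-chain of the nerve. -/
noncomputable def pointChain (x : 𝒞) :
    intModule ⟶ ((nerve 𝒞).chainComplex intModule).X 0 :=
  (nerve 𝒞).ιChainComplex (n := 0) (ComposableArrows.mk₀ x)

theorem chainHom_edgeSum_d {I : Type*} [Fintype I] {x y : I → 𝒞} (f : ∀ a, x a ⟶ y a) :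
    chainHom (nerve 𝒞) (edgeSum f) ≫ ((nerve 𝒞).chainComplex intModule).d 1 0 =
      ∑ a, (pointChain (y a) - pointChain (x a)) := by
  rw [chainHom_edgeSum, Preadditive.sum_comp]
  exact Finset.sum_congr rfl fun a _ => edgeOf_d _

/-- A functor that takes the same value `x` on all objects of a nonempty set maps the full
subcomplex on this set to a vertex. -/
theorem image_fullSubcomplex_eq_ofSimplex {𝒟 : Type w₁} [Category.{w₂} 𝒟] (Ψ : 𝒞 ⥤ 𝒟)
    {S : Set 𝒞} (hS : S.Nonempty) {x : 𝒟} (hx : Subsingleton (x ⟶ x)) (h : ∀ z ∈ S, Ψ.obj z = x) :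
    (fullSubcomplex S).image (nerveMap Ψ) =
      SSet.Subcomplex.ofSimplex (X := nerve 𝒟) (n := 0) (ComposableArrows.mk₀ x) := by
  apply le_antisymm
  · rintro n _ ⟨s, hs, rfl⟩
    refine (SSet.Subcomplex.mem_ofSimplex_obj_iff (X := nerve 𝒟) (n := 0) _ _).2
      ⟨SimplexCategory.const _ _ 0, ?_⟩
    have hs' : ∀ i, (s : ComposableArrows 𝒞 _).obj i ∈ S := hs
    refine CategoryTheory.Functor.ext
      (F := (ComposableArrows.mk₀ x).whiskerLeft (SimplexCategory.toCat.map _).toFunctor)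
      (G := (s : ComposableArrows 𝒞 _) ⋙ Ψ) (fun i => (h _ (hs' i)).symm) fun i j f => ?_
    exact @Subsingleton.elim (x ⟶ x) hx _ _
  · refine (SSet.Subcomplex.ofSimplex_le_iff (X := nerve 𝒟) (n := 0) _ _).2 ?_
    obtain ⟨z, hz⟩ := hS
    refine ⟨ComposableArrows.mk₀ z, fun _ => hz, ?_⟩
    exact ComposableArrows.ext₀ (h z hz)

end

namespace ToricArrangement

section
variable {V : Type u} [AddCommGroup V] [Module ℝ V] {Γ : Submodule ℤ V} {ι : Type v} [Finite ι]
  {A : ToricArrangement Γ ι}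

/-- A chain supported on arrows whose ends are identified by `Φ_L` is mapped to a boundary, as the
images of these arrows are degenerate. -/
theorem chainClass_chain_Phi_eq_zero (L : Set (V ⧸ Γ)) {c : A.Sal _⦋1⦌ →₀ ℤ}
    (h : ∀ e : ComposableArrows A.SalCat 1, c e ≠ 0 →
      (A.PhiFunctor L).obj e.left = (A.PhiFunctor L).obj e.right) :
    chainClass (chain c ≫ (SSet.chainComplexMap (A.Phi L) intModule).f 1) = 0 := by
  have h1 : chain c ≫ (SSet.chainComplexMap (A.Phi L) intModule).f 1 =
      ∑ e ∈ c.support, c e • (A.Sal.ιChainComplex e ≫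
        (SSet.chainComplexMap (A.Phi L) intModule).f 1) := by
    rw [chain, Finsupp.sum, Preadditive.sum_comp]
    exact Finset.sum_congr rfl fun e _ => Preadditive.zsmul_comp _ _ _
  rw [h1]
  refine (map_sum (QuotientAddGroup.mk' (boundaries₁ (A.quot L).Sal)) _ _).trans
    (Finset.sum_eq_zero fun e he => ?_)
  refine ((QuotientAddGroup.mk' (boundaries₁ (A.quot L).Sal)).map_zsmul _ _).trans ?_
  have h2 : A.Sal.ιChainComplex e ≫ (SSet.chainComplexMap (A.Phi L) intModule).f 1 =
      (A.quot L).Sal.ιChainComplex (edgeOf ((A.PhiFunctor L).map (ComposableArrows.hom e))) := by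
    have h3 := ιChainComplex_edgeOf_map (A.PhiFunctor L) (ComposableArrows.hom e)
    rw [edgeOf_hom] at h3
    exact h3
  rw [h2]
  have h4 := arrowClass_eq_zero ((A.PhiFunctor L).map (ComposableArrows.hom e))
    (h e (Finsupp.mem_support_iff.1 he))
  have h5 : (QuotientAddGroup.mk' (boundaries₁ (A.quot L).Sal))
      ((A.quot L).Sal.ιChainComplex (edgeOf ((A.PhiFunctor L).map (ComposableArrows.hom e)))) = 0 :=
    h4
  rw [h5, smul_zero]

/-! ### Vertices and walls along a gallery -/

omit [Finite ι] in
theorem TFace.localizeChamber_eq_iff {F : A.TFace} {C D : Chamber A.linear} :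
    F.localizeChamber C = F.localizeChamber D ↔
      ∀ i, F.carrier ⊆ A.hyp i → C.1.sign i = D.1.sign i := by
  constructor
  · intro h i hi
    exact congrFun (congrArg (fun E : Chamber F.arr => E.1.sign) h) ⟨i, hi⟩
  · intro h
    exact Subtype.ext (Face.ext (funext fun i => h i.1 i.2))

theorem vertexObj_injective {F G : A.TFace} {C D : Chamber A.linear}
    (h : F.vertexObj C = G.vertexObj D) : F = G ∧ F.localizeChamber C = F.localizeChamber D := by
  obtain ⟨rfl, h'⟩ := obj_injective h
  exact ⟨rfl, Subtype.ext (congrArg Cell.face (eq_of_heq h'))⟩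

theorem le_of_hom_vertexObj {G P : A.TFace} {C D : Chamber A.linear}
    (f : G.vertexObj C ⟶ P.vertexObj D) (j : P.Loc) :
    D.1.sign j.1 = (TFace.Hom.incl (F := P) (G := G) f.base.unop (G.localize C.1)).sign j := by
  have h := (inclCell_le_of_hom f).1 j
  exact h.resolve_left (D.2 j.1)

/-- There is at most one arrow between two vertices. -/
theorem subsingleton_hom_vertexObj (G P : A.TFace) (C D : Chamber A.linear) :
    Subsingleton (G.vertexObj C ⟶ P.vertexObj D) := by
  refine ⟨fun f g => salCat_hom_ext (Quiver.Hom.unop_inj (TFace.Hom.ext (Face.ext ?_)))⟩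
  ext j
  have hf := le_of_hom_vertexObj f j
  have hg := le_of_hom_vertexObj g j
  rw [TFace.Hom.incl_sign] at hf hg
  by_cases h : G.carrier ⊆ A.hyp j.1
  · exact ((TFace.Hom.dir_eq_zero_iff (F := P) (G := G) _ j).2 h).trans
      ((TFace.Hom.dir_eq_zero_iff (F := P) (G := G) _ j).2 h).symm
  · rw [dif_neg h] at hf hg
    exact hf.symm.trans hg

/-- An arrow between vertices over different faces of a one-dimensional layer is the same as an edge
of the layer starting at a vertex. -/
theorem nonempty_hom_vertexObj_iff {M : Set (V ⧸ Γ)} {u : V} {C D : Chamber A.linear}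
    (hu : A.tangent M = Submodule.span ℝ {u})
    (hD : ∀ i, A.χ i u ≠ 0 → D.1.sign i = SignType.sign (A.χ i u))
    (hCD : ∀ i, A.χ i u = 0 → C.1.sign i = D.1.sign i) {G P : A.TFace} :
    Starts M D G P ↔ G.carrier ⊆ M ∧ P.carrier ⊆ M ∧ G ≠ P ∧
      Nonempty (G.vertexObj C ⟶ P.vertexObj D) := by
  constructor
  · intro h
    have hG := h.isEdgeOf hu hD
    obtain ⟨hGM, hPM, hne, m, hm⟩ := h
    refine ⟨hGM, hPM, hne, ?_⟩
    have e' : TFace.Hom.incl m (G.localize C.1) = P.localize D.1 := by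
      ext j
      rw [TFace.Hom.incl_sign]
      split_ifs with h
      · exact hCD j.1 (hG.2 j.1 h)
      · exact (hm j).resolve_left fun h' => h ((TFace.Hom.dir_eq_zero_iff m j).1 h')
    have e : TFace.Hom.inclCell m (Cell.vertex (G.localizeChamber C)) =
        Cell.vertex (P.localizeChamber D) := Cell.ext e' e'
    exact ⟨pushArrow m _ ≫ eqToHom (congrArg (obj P) e)⟩
  · rintro ⟨hGM, hPM, hne, ⟨f⟩⟩
    refine ⟨hGM, hPM, hne, f.base.unop, fun j => ?_⟩
    have hf := le_of_hom_vertexObj f j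
    rw [TFace.Hom.incl_sign] at hf
    by_cases h : G.carrier ⊆ A.hyp j.1
    · exact Or.inl ((TFace.Hom.dir_eq_zero_iff (F := P) (G := G) _ j).2 h)
    · rw [dif_neg h] at hf
      exact Or.inr hf.symm

/-- The hyperplanes containing the local wall of two adjacent chambers are those that separate
them. -/
theorem TFace.IsLocalWall.sign_eq_zero_iff {P : A.TFace} {C C' : Chamber A.linear} {W : Face P.arr}
    (h : P.IsLocalWall C C' W) (j : P.Loc) :
    W.sign j = 0 ↔ C.1.sign j.1 ≠ C'.1.sign j.1 := by
  have key : ∀ j : P.Loc, C.1.sign j.1 ≠ C'.1.sign j.1 → W.sign j = 0 := by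
    intro j hj
    by_contra hW
    exact hj (((h.2.1.le j).resolve_left hW).symm.trans ((h.2.2.le j).resolve_left hW))
  refine ⟨fun hj hcon => h.1 ?_, key j⟩
  refine TFace.localizeChamber_eq_iff.2 fun i hi => ?_
  by_contra hne
  refine hne ?_
  have hker := ker_eq_of_covBy (P.localizeChamber C).2 h.2.1 (key ⟨i, hi⟩ hne) hj
  exact Chamber.sign_eq_of_ker_eq (χ := fun i : P.Loc => A.χ i) (i := ⟨i, hi⟩)
    (C := (P.localizeChamber C).1) (D := (P.localizeChamber C').1) hker
    (P.localizeChamber C).2 (P.localizeChamber C').2 hcon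

theorem TFace.IsLocalWall.sign_eq {P : A.TFace} {C C' : Chamber A.linear} {W : Face P.arr}
    (h : P.IsLocalWall C C' W) {j : P.Loc} (hj : C.1.sign j.1 = C'.1.sign j.1) :
    W.sign j = C.1.sign j.1 :=
  (h.2.1.le j).resolve_left fun h' => (h.sign_eq_zero_iff j).1 h' hj

theorem TFace.IsLocalWall.unique {P : A.TFace} {C C' : Chamber A.linear} {W W' : Face P.arr}
    (h : P.IsLocalWall C C' W) (h' : P.IsLocalWall C C' W') : W = W' := by
  ext j
  by_cases hj : C.1.sign j.1 = C'.1.sign j.1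
  · rw [h.sign_eq hj, h'.sign_eq hj]
  · rw [(h.sign_eq_zero_iff j).2 hj, (h'.sign_eq_zero_iff j).2 hj]

/-- A wall of two chambers induces a wall of the chambers of a local arrangement, if these are
different. -/
theorem TFace.exists_isLocalWall {P : A.TFace} {C C' : Chamber A.linear} {W : Face A.linear}
    (hW : IsWall W C C') (hne : P.localizeChamber C ≠ P.localizeChamber C') :
    ∃ W' : Face P.arr, P.IsLocalWall C C' W' := by
  have hex : ∃ j, (P.localize W).sign j = 0 := by
    by_contra! hcon
    refine hne (TFace.localizeChamber_eq_iff.2 fun i hi => ?_)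
    have h := hcon ⟨i, hi⟩
    exact ((hW.1.le i).resolve_left h).symm.trans ((hW.2.le i).resolve_left h)
  have hker : ∀ i j, (P.localize W).sign i = 0 → (P.localize W).sign j = 0 →
      LinearMap.ker (A.χ i.1) = LinearMap.ker (A.χ j.1) :=
    fun i j hi hj => ker_eq_of_covBy C.2 hW.1 hi hj
  exact ⟨P.localize W, hne,
    covBy_of_ker_eq (P.localizeChamber C).2 (fun j => hW.1.le j.1) hex hker,
    covBy_of_ker_eq (P.localizeChamber C').2 (fun j => hW.2.le j.1) hex hker⟩

end

/-- A minimal gallery that crosses a hyperplane at the step `n` is on different sides of it before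
and after this step. -/
theorem _root_.ToricSalvetti.IsMinimalGallery.sign_ne {J V : Type*} [AddCommGroup V] [Module ℝ V]
    [Finite J] {χ : J → V →ₗ[ℝ] ℝ} {k : ℕ} {E : ℕ → Chamber (central χ)}
    (hE : IsMinimalGallery k E) {n : ℕ} {j : J}
    (hj : (E n).1.sign j ≠ (E (n + 1)).1.sign j) {a b : ℕ} (ha : a ≤ n) (hb : n < b) (hbk : b ≤ k) :
    (E a).1.sign j ≠ (E b).1.sign j := by
  have hother := (hE.crossing (hb.trans_le hbk) hj).2
  have h1 : (E a).1.sign j = (E n).1.sign j := by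
    by_contra h
    obtain ⟨p, -, hp, hpj⟩ := exists_step_of_sign_ne ha h
    exact hpj (hother p (by omega) (by omega))
  have h2 : (E (n + 1)).1.sign j = (E b).1.sign j := by
    by_contra h
    obtain ⟨p, hp, hp', hpj⟩ := exists_step_of_sign_ne hb h
    exact hpj (hother p (by omega) (by omega))
  rw [h1, ← h2]
  exact hj

section
variable {V : Type u} [AddCommGroup V] [Module ℝ V] {Γ : Submodule ℤ V} {ι : Type v} [Finite ι]
  {A : ToricArrangement Γ ι} {M : Set (V ⧸ Γ)} {k : ℕ} {C : ℕ → Chamber A.linear}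

omit [Finite ι] in
/-- The gallery of a loop `Λ_B^M` leads from the direction of `u` to that of `-u`, for a vector `u`
spanning `X_M`. -/
theorem IsLoopGallery.exists_direction (h : A.IsLoopGallery M k C)
    (h1 : Module.finrank ℝ (A.tangent M) = 1) :
    ∃ u : V, u ≠ 0 ∧ A.tangent M = Submodule.span ℝ {u} ∧
      (∀ i, A.χ i u ≠ 0 → (C 0).1.sign i = SignType.sign (A.χ i u)) ∧
      (∀ i, A.χ i (-u) ≠ 0 → (C k).1.sign i = SignType.sign (A.χ i (-u))) ∧
      ∀ i, A.χ i u = 0 → (C 0).1.sign i = (C k).1.sign i := by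
  obtain ⟨⟨R, hR, hRM⟩, hop, -⟩ := h
  obtain ⟨u, huR, hu0⟩ : ∃ u ∈ R.carrier, u ≠ 0 := by
    by_contra! hcon
    have hbot : R.hull = ⊥ := by
      rw [Face.hull, Submodule.span_eq_bot]
      exact hcon
    rw [← hRM, hbot, finrank_bot] at h1
    exact zero_ne_one h1
  have huM : u ∈ A.tangent M := hRM ▸ Submodule.subset_span huR
  have hspan : A.tangent M = Submodule.span ℝ {u} := by
    refine le_antisymm (fun w hw => ?_) ((Submodule.span_singleton_le_iff_mem _ _).2 huM)
    obtain ⟨c, hc⟩ := (finrank_eq_one_iff_of_nonzero' (⟨u, huM⟩ : A.tangent M)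
      (fun e => hu0 (congrArg Subtype.val e))).1 h1 ⟨w, hw⟩
    exact Submodule.mem_span_singleton.2 ⟨c, congrArg Subtype.val hc⟩
  have hC0 : ∀ i, A.χ i u ≠ 0 → (C 0).1.sign i = SignType.sign (A.χ i u) := by
    intro i hi
    have hs : SignType.sign (A.χ i u) = R.sign i := huR i
    rw [hs]
    refine ((hR i).resolve_left fun h0 => hi ?_).symm
    rw [h0, sign_eq_zero_iff] at hs
    exact hs
  have hle : ∀ i, A.tangent M ≤ LinearMap.ker (A.χ i) ↔ A.χ i u = 0 := by
    intro i
    rw [hspan, Submodule.span_singleton_le_iff_mem, LinearMap.mem_ker]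
  refine ⟨u, hu0, hspan, hC0, fun i hi => ?_, fun i hi => ?_⟩
  · rw [map_neg, neg_ne_zero] at hi
    rw [(hop i).2 (fun h => hi ((hle i).1 h)), map_neg, Left.sign_neg, ← hC0 i hi]
    rfl
  · rw [(hop i).1 ((hle i).2 hi)]
    exact (neg_neg _).symm

/-! ### The fundamental chain of the loop -/

/-- The pairs of a face `P` of `M` and a step of the gallery that changes the local chamber
at `P`. -/
abbrev CrossingIndex (M : Set (V ⧸ Γ)) (k : ℕ) (C : ℕ → Chamber A.linear) :=
  {x : A.TFace × Fin k // x.1.carrier ⊆ M ∧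
    x.1.localizeChamber (C x.2) ≠ x.1.localizeChamber (C (x.2 + 1))}

/-- The pairs of an edge of `M` and the vertex where it starts in the direction of `D`. -/
abbrev StartIndex (M : Set (V ⧸ Γ)) (D : Chamber A.linear) :=
  {x : A.TFace × A.TFace // Starts M D x.1 x.2}

theorem _root_.ToricSalvetti.IsMinimalGallery.exists_isLocalWall (hC : IsMinimalGallery k C)
    (x : CrossingIndex M k C) :
    ∃ W : Face x.1.1.arr, x.1.1.IsLocalWall (C x.1.2) (C (x.1.2 + 1)) W := by
  obtain ⟨W, hW⟩ := hC.1 x.1.2 x.1.2.2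
  exact TFace.exists_isLocalWall hW x.2.2

theorem _root_.ToricSalvetti.IsMinimalGallery.localizeChamber_ne (hC : IsMinimalGallery k C)
    {P : A.TFace} {n : ℕ} (hn : P.localizeChamber (C n) ≠ P.localizeChamber (C (n + 1))) {a b : ℕ} (ha : a ≤ n)
    (hb : n < b) (hbk : b ≤ k) : P.localizeChamber (C a) ≠ P.localizeChamber (C b) := by
  intro h
  rw [Ne, TFace.localizeChamber_eq_iff] at hn
  rw [TFace.localizeChamber_eq_iff] at h
  push Not at hn
  obtain ⟨i, hi, hne⟩ := hn
  exact hC.sign_ne hne ha hb hbk (h i hi)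

/-- Every edge of `M` starts at one vertex, and at every vertex one edge starts. -/
theorem sum_start_eq {G : Type*} [AddCommGroup G] {u : V} {D : Chamber A.linear}
    (φ ψ : A.TFace → G) [Fintype (StartIndex M D)] [Fintype {P : A.TFace // IsVertexOf M u P}]
    [Fintype {G : A.TFace // IsEdgeOf M u G}]
    (hu : A.tangent M = Submodule.span ℝ {u})
    (hD : ∀ i, A.χ i u ≠ 0 → D.1.sign i = SignType.sign (A.χ i u))
    (hv : ∀ P, IsVertexOf M u P → ∃ G, Starts M D G P)
    (he : ∀ G, IsEdgeOf M u G → ∃ P, Starts M D G P) :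
    ∑ x : StartIndex M D, (φ x.1.2 - ψ x.1.1) =
      ∑ P : {P : A.TFace // IsVertexOf M u P}, φ P.1 -
        ∑ G : {G : A.TFace // IsEdgeOf M u G}, ψ G.1 := by
  rw [Finset.sum_sub_distrib]
  refine congrArg₂ (fun a b : G => a - b) ?_ ?_
  · refine Fintype.sum_bijective
      (fun x : StartIndex M D =>
        (⟨x.1.2, x.2.isVertexOf hu hD⟩ : {P : A.TFace // IsVertexOf M u P}))
      ⟨?_, ?_⟩ _ _ fun _ => rfl
    · rintro ⟨⟨G, P⟩, h⟩ ⟨⟨G', P'⟩, h'⟩ e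
      obtain rfl : P = P' := congrArg Subtype.val e
      obtain rfl := Starts.edge_unique hu hD h h'
      rfl
    · rintro ⟨P, hP⟩
      obtain ⟨G, hG⟩ := hv P hP
      exact ⟨⟨⟨G, P⟩, hG⟩, rfl⟩
  · refine Fintype.sum_bijective
      (fun x : StartIndex M D =>
        (⟨x.1.1, x.2.isEdgeOf hu hD⟩ : {G : A.TFace // IsEdgeOf M u G}))
      ⟨?_, ?_⟩ _ _ fun _ => rfl
    · rintro ⟨⟨G, P⟩, h⟩ ⟨⟨G', P'⟩, h'⟩ e
      obtain rfl : G = G' := congrArg Subtype.val e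
      obtain rfl := Starts.vertex_unique hu hD h h'
      rfl
    · rintro ⟨G, hG⟩
      obtain ⟨P, hP⟩ := he G hG
      exact ⟨⟨⟨G, P⟩, hP⟩, rfl⟩

/-- Telescoping along the gallery: at an edge of `M` the local chambers of `C 0` and `C k` are the
same. -/
theorem sum_crossing_eq [Fintype A.TFace] {G : Type*} [AddCommGroup G] {u : V}
    [Fintype (CrossingIndex M k C)] [Fintype {P : A.TFace // IsVertexOf M u P}]
    (φ : A.SalCat → G) (hCk : ∀ i, A.χ i u = 0 → (C 0).1.sign i = (C k).1.sign i) :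
    ∑ x : CrossingIndex M k C,
      (φ (x.1.1.vertexObj (C (x.1.2 + 1))) - φ (x.1.1.vertexObj (C x.1.2))) =
      ∑ P : {P : A.TFace // IsVertexOf M u P},
        (φ (P.1.vertexObj (C k)) - φ (P.1.vertexObj (C 0))) := by
  classical
  rw [← Finset.sum_subtype (Finset.univ.filter fun x : A.TFace × Fin k =>
      x.1.carrier ⊆ M ∧ x.1.localizeChamber (C x.2) ≠ x.1.localizeChamber (C (x.2 + 1)))
      (fun x => by rw [Finset.mem_filter]; exact and_iff_right (Finset.mem_univ x))
      (fun x => φ (x.1.vertexObj (C (x.2 + 1))) - φ (x.1.vertexObj (C x.2))),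
    ← Finset.sum_subtype (Finset.univ.filter fun P : A.TFace => IsVertexOf M u P)
      (fun P => by rw [Finset.mem_filter]; exact and_iff_right (Finset.mem_univ P))
      (fun P => φ (P.vertexObj (C k)) - φ (P.vertexObj (C 0))),
    Finset.sum_filter, Finset.sum_filter, Fintype.sum_prod_type]
  refine Finset.sum_congr rfl fun P _ => ?_
  by_cases hP : P.carrier ⊆ M
  · have h1 : ∀ n : Fin k, (if P.carrier ⊆ M ∧
        P.localizeChamber (C n) ≠ P.localizeChamber (C (n + 1)) then
        φ (P.vertexObj (C (n + 1))) - φ (P.vertexObj (C n)) else 0) =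
        φ (P.vertexObj (C (n + 1))) - φ (P.vertexObj (C n)) := by
      intro n
      split_ifs with h
      · rfl
      · have e : P.localizeChamber (C n) = P.localizeChamber (C (n + 1)) := by
          by_contra h'
          exact h ⟨hP, h'⟩
        rw [TFace.vertexObj, TFace.vertexObj, e, sub_self]
    rw [Finset.sum_congr rfl fun n _ => h1 n,
      Fin.sum_univ_eq_sum_range (fun n => φ (P.vertexObj (C (n + 1))) - φ (P.vertexObj (C n))),
      Finset.sum_range_sub (fun n => φ (P.vertexObj (C n)))]
    split_ifs with hv
    · rfl
    · have e : P.localizeChamber (C 0) = P.localizeChamber (C k) := by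
        refine TFace.localizeChamber_eq_iff.2 fun i hi => hCk i ?_
        by_contra h
        exact hv ⟨hP, i, h, hi⟩
      rw [TFace.vertexObj, TFace.vertexObj, e, sub_self]
  · rw [if_neg fun h : IsVertexOf M u P => hP h.1]
    exact Finset.sum_eq_zero fun n _ => if_neg fun h => hP h.1

end

section
variable {V : Type u} [AddCommGroup V] [Module ℝ V] {Γ : Submodule ℤ V} {ι : Type v} [Finite ι]
  {A : ToricArrangement Γ ι} {M : Set (V ⧸ Γ)} {k : ℕ} {C : ℕ → Chamber A.linear}

/-- The wall of the local arrangement at `P` that the gallery crosses in a step. -/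
noncomputable def crossWall (hC : IsMinimalGallery k C) (x : CrossingIndex M k C) :
    Face x.1.1.arr :=
  (hC.exists_isLocalWall x).choose

theorem isLocalWall_crossWall (hC : IsMinimalGallery k C) (x : CrossingIndex M k C) :
    x.1.1.IsLocalWall (C x.1.2) (C (x.1.2 + 1)) (crossWall hC x) :=
  (hC.exists_isLocalWall x).choose_spec

theorem crossWall_le (hC : IsMinimalGallery k C) (x : CrossingIndex M k C) {δ : ℕ} (hδ : δ ≤ 1) :
    crossWall hC x ≤ (x.1.1.localizeChamber (C (x.1.2 + δ))).1 := by
  obtain rfl | rfl : δ = 0 ∨ δ = 1 := by omega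
  · exact (isLocalWall_crossWall hC x).2.1.le
  · exact (isLocalWall_crossWall hC x).2.2.le

/-- The arrow `(P, v_{n+δ}) → (P, e_n)`, where `δ` is `0` or `1`. -/
noncomputable def crossArrow (hC : IsMinimalGallery k C) (B : Chamber A.linear) {δ : ℕ} (hδ : δ ≤ 1)
    (x : CrossingIndex M k C) :
    x.1.1.vertexObj (C (x.1.2 + δ)) ⟶ x.1.1.edgeObj (crossWall hC x) B :=
  arrow x.1.1 (x := Cell.vertex _) (y := Cell.edge _ _) (Cell.vertex_le (crossWall_le hC x hδ))

theorem crossArrow_injective (hC : IsMinimalGallery k C) (B : Chamber A.linear) {δ : ℕ}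
    (hδ : δ ≤ 1) :
    Function.Injective fun x : CrossingIndex M k C => edgeOf (crossArrow hC B hδ x) := by
  have key : ∀ (P : A.TFace) (n n' : ℕ), n < n' → n' < k →
      P.localizeChamber (C n) ≠ P.localizeChamber (C (n + 1)) →
      P.localizeChamber (C n') ≠ P.localizeChamber (C (n' + 1)) →
      P.localizeChamber (C (n + δ)) ≠ P.localizeChamber (C (n' + δ)) := by
    intro P n n' hlt hk h h'
    obtain rfl | rfl : δ = 0 ∨ δ = 1 := by omega
    · exact hC.localizeChamber_ne h le_rfl hlt hk.le
    · exact hC.localizeChamber_ne h' hlt (Nat.lt_succ_self n') hk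
  rintro ⟨⟨P, n⟩, hP, h⟩ ⟨⟨P', n'⟩, hP', h'⟩ e
  obtain ⟨rfl, hCe⟩ := vertexObj_injective (edgeOf_inj e).1
  obtain hlt | heq | hlt := lt_trichotomy n.1 n'.1
  · exact absurd hCe (key P n n' hlt n'.2 h h')
  · obtain rfl := Fin.ext heq
    rfl
  · exact absurd hCe.symm (key P n' n hlt n.2 h' h)

theorem exists_crossArrow_iff (hC : IsMinimalGallery k C) (B : Chamber A.linear) {δ : ℕ}
    (hδ : δ ≤ 1) (e : ComposableArrows A.SalCat 1) :
    (∃ P : A.TFace, P.carrier ⊆ M ∧ ∃ n < k, ∃ W : Face P.arr,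
      P.IsLocalWall (C n) (C (n + 1)) W ∧ e.left = P.vertexObj (C (n + δ)) ∧
        e.right = P.edgeObj W B) ↔
      ∃ x : CrossingIndex M k C, edgeOf (crossArrow hC B hδ x) = e := by
  constructor
  · rintro ⟨P, hP, n, hn, W, hW, hl, hr⟩
    let x : CrossingIndex M k C := ⟨⟨P, ⟨n, hn⟩⟩, hP, hW.1⟩
    have hWx : W = crossWall hC x := hW.unique (isLocalWall_crossWall hC x)
    exact ⟨x, edgeOf_eq (subsingleton_hom_obj _ _) _ e hl (hr.trans (by rw [hWx]))⟩
  · rintro ⟨x, rfl⟩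
    exact ⟨x.1.1, x.2.1, x.1.2, x.1.2.2, _, isLocalWall_crossWall hC x, rfl, rfl⟩

/-- The arrow `(G, [C(G), C(G)]) → (P, [D(P), D(P)])`, for an edge `G` that starts at `P` in the
direction of `D`. -/
noncomputable def startArrow {u : V} {C D : Chamber A.linear}
    (hu : A.tangent M = Submodule.span ℝ {u})
    (hD : ∀ i, A.χ i u ≠ 0 → D.1.sign i = SignType.sign (A.χ i u))
    (hCD : ∀ i, A.χ i u = 0 → C.1.sign i = D.1.sign i) (x : StartIndex M D) :
    x.1.1.vertexObj C ⟶ x.1.2.vertexObj D :=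
  ((nonempty_hom_vertexObj_iff hu hD hCD).1 x.2).2.2.2.some

theorem startArrow_injective {u : V} {C D : Chamber A.linear}
    (hu : A.tangent M = Submodule.span ℝ {u})
    (hD : ∀ i, A.χ i u ≠ 0 → D.1.sign i = SignType.sign (A.χ i u))
    (hCD : ∀ i, A.χ i u = 0 → C.1.sign i = D.1.sign i) :
    Function.Injective fun x : StartIndex M D => edgeOf (startArrow hu hD hCD x) := by
  rintro ⟨⟨G, P⟩, h⟩ ⟨⟨G', P'⟩, h'⟩ e
  obtain ⟨hl, hr⟩ := edgeOf_inj e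
  obtain rfl := (vertexObj_injective hl).1
  obtain rfl := (vertexObj_injective hr).1
  rfl

theorem exists_startArrow_iff {u : V} {C D : Chamber A.linear}
    (hu : A.tangent M = Submodule.span ℝ {u})
    (hD : ∀ i, A.χ i u ≠ 0 → D.1.sign i = SignType.sign (A.χ i u))
    (hCD : ∀ i, A.χ i u = 0 → C.1.sign i = D.1.sign i) (e : ComposableArrows A.SalCat 1) :
    (∃ G P : A.TFace, G.carrier ⊆ M ∧ P.carrier ⊆ M ∧ G ≠ P ∧ e.left = G.vertexObj C ∧
      e.right = P.vertexObj D) ↔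
      ∃ x : StartIndex M D, edgeOf (startArrow hu hD hCD x) = e := by
  constructor
  · rintro ⟨G, P, hG, hP, hne, hl, hr⟩
    have f : G.vertexObj C ⟶ P.vertexObj D := eqToHom hl.symm ≫ e.hom ≫ eqToHom hr
    exact ⟨⟨⟨G, P⟩, (nonempty_hom_vertexObj_iff hu hD hCD).2 ⟨hG, hP, hne, ⟨f⟩⟩⟩,
      edgeOf_eq (subsingleton_hom_vertexObj _ _ _ _) _ e hl hr⟩
  · rintro ⟨x, rfl⟩
    exact ⟨x.1.1, x.1.2, x.2.1, x.2.2.1, x.2.2.2.1, rfl, rfl⟩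

end

section
variable {V : Type u} [NormedAddCommGroup V] [NormedSpace ℝ V] [FiniteDimensional ℝ V]
  {Γ : Submodule ℤ V} [DiscreteTopology Γ] [IsZLattice ℝ Γ] {ι : Type v} [Finite ι]
  {A : ToricArrangement Γ ι} {M : Set (V ⧸ Γ)} {k : ℕ} {C : ℕ → Chamber A.linear}

/-- The fundamental chain of the loop has finite support, and it is a cycle: every edge of `M`
starts at one vertex in the direction of `C 0` and at one in the opposite direction, that of
`C k`. -/
theorem IsLoopGallery.exists_isLoopChain (hA : A.Essential) (hM : A.IsLayer M)
    (h1 : Module.finrank ℝ (A.tangent M) = 1) (h : A.IsLoopGallery M k C)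
    (B : Chamber A.linear) :
    ∃ c : A.Sal _⦋1⦌ →₀ ℤ, A.IsLoopChain M k C B c ∧ IsCycle (chain c) := by
  classical
  obtain ⟨u, hu0, hu, hD0, hDk, hCk⟩ := h.exists_direction h1
  have hu' : A.tangent M = Submodule.span ℝ {-u} := by
    rw [hu, ← Set.neg_singleton, Submodule.span_neg]
  have hCk' : ∀ i, A.χ i (-u) = 0 → (C 0).1.sign i = (C k).1.sign i := fun i hi =>
    hCk i (by rwa [map_neg, neg_eq_zero] at hi)
  have hC := h.2.2
  have := finite_tFace A
  have := Fintype.ofFinite A.TFace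
  have hv : ∀ P : A.TFace, IsVertexOf M (-u) P ↔ IsVertexOf M u P := fun P => by
    simp only [IsVertexOf, map_neg, neg_ne_zero]
  have he : ∀ P : A.TFace, IsEdgeOf M (-u) P ↔ IsEdgeOf M u P := fun P => by
    simp only [IsEdgeOf, map_neg, neg_eq_zero]
  refine ⟨edgeSum (crossArrow (M := M) hC B zero_le_one) -
    edgeSum (crossArrow (M := M) hC B le_rfl) +
    edgeSum (startArrow hu hD0 fun _ _ => rfl) - edgeSum (startArrow hu' hDk hCk'), fun e => ?_, ?_⟩
  · have a1 := edgeSum_apply _ (crossArrow_injective hC B _) e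
      (exists_crossArrow_iff (M := M) hC B zero_le_one e)
    have a2 := edgeSum_apply _ (crossArrow_injective hC B _) e
      (exists_crossArrow_iff (M := M) hC B le_rfl e)
    have a3 := edgeSum_apply _ (startArrow_injective hu hD0 _) e
      (exists_startArrow_iff hu hD0 (fun _ _ => rfl) e)
    have a4 := edgeSum_apply _ (startArrow_injective hu' hDk _) e
      (exists_startArrow_iff hu' hDk hCk' e)
    exact congrArg₂ (fun a b : ℤ => a - b) (congrArg₂ (fun a b : ℤ => a + b)
      (congrArg₂ (fun a b : ℤ => a - b) a1 a2) a3) a4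
  · rw [IsCycle, ← chainHom_apply, map_sub, map_add, map_sub, Preadditive.sub_comp,
      Preadditive.add_comp, Preadditive.sub_comp]
    have e1 := chainHom_edgeSum_d (crossArrow (M := M) hC B zero_le_one)
    have e2 := chainHom_edgeSum_d (crossArrow (M := M) hC B le_rfl)
    have e3 := chainHom_edgeSum_d (startArrow (M := M) hu hD0 fun _ _ => rfl)
    have e4 := chainHom_edgeSum_d (startArrow (M := M) hu' hDk hCk')
    have s1 := sum_crossing_eq (M := M) (k := k) (C := C) (u := u) (pointChain (𝒞 := A.SalCat)) hCk
    have s3 := sum_start_eq (fun P : A.TFace => pointChain (P.vertexObj (C 0)))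
      (fun P : A.TFace => pointChain (P.vertexObj (C 0))) hu hD0
      (fun P hP => hM.exists_starts_of_isVertexOf hu hD0 hP)
      (fun G hG => hM.exists_starts_of_isEdgeOf hA hu0 hu hD0 hG)
    have s4 := sum_start_eq (fun P : A.TFace => pointChain (P.vertexObj (C k)))
      (fun P : A.TFace => pointChain (P.vertexObj (C 0))) hu' hDk
      (fun P hP => hM.exists_starts_of_isVertexOf hu' hDk hP)
      (fun G hG => hM.exists_starts_of_isEdgeOf hA (neg_ne_zero.2 hu0) hu' hDk hG)
    -- the vertices and edges of `M` do not depend on the orientation of `u`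
    have s4v : ∑ P : {P : A.TFace // IsVertexOf M (-u) P}, pointChain (P.1.vertexObj (C k)) =
        ∑ P : {P : A.TFace // IsVertexOf M u P}, pointChain (P.1.vertexObj (C k)) :=
      Fintype.sum_equiv (Equiv.subtypeEquivRight hv) _ _ fun _ => rfl
    have s4e : ∑ G : {G : A.TFace // IsEdgeOf M (-u) G}, pointChain (G.1.vertexObj (C 0)) =
        ∑ G : {G : A.TFace // IsEdgeOf M u G}, pointChain (G.1.vertexObj (C 0)) :=
      Fintype.sum_equiv (Equiv.subtypeEquivRight he) _ _ fun _ => rfl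
    rw [s4v, s4e] at s4
    -- the vertices `(P, e_n)` cancel, the others telescope
    have t12 : chainHom _ (edgeSum (crossArrow (M := M) hC B zero_le_one)) ≫
          (A.Sal.chainComplex intModule).d 1 0 -
        chainHom _ (edgeSum (crossArrow (M := M) hC B le_rfl)) ≫
          (A.Sal.chainComplex intModule).d 1 0 =
        ∑ P : {P : A.TFace // IsVertexOf M u P}, pointChain (P.1.vertexObj (C k)) -
          ∑ P : {P : A.TFace // IsVertexOf M u P}, pointChain (P.1.vertexObj (C 0)) := by
      rw [e1, e2, ← Finset.sum_sub_distrib]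
      refine Eq.trans (Finset.sum_congr rfl fun x _ => ?_)
        (s1.trans (Finset.sum_sub_distrib _ _))
      exact sub_sub_sub_cancel_left _ _ _
    rw [t12, e3.trans s3, e4.trans s4]
    abel

end

section
variable {V : Type u} [AddCommGroup V] [Module ℝ V] {Γ : Submodule ℤ V} {ι : Type v} [Finite ι]
  {A : ToricArrangement Γ ι} {L M : Set (V ⧸ Γ)} {k : ℕ} {C : ℕ → Chamber A.linear}

/-- The gallery of a loop does not cross the hyperplanes containing `X_M`. -/
theorem IsLoopGallery.sign_eq (h : A.IsLoopGallery M k C) {i : ι}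
    (hi : A.tangent M ≤ LinearMap.ker (A.χ i)) {n : ℕ} (hn : n ≤ k) :
    (C n).1.sign i = (C 0).1.sign i := by
  refine h.2.2.sign_eq ?_ hn
  rw [(h.2.1 i).1 hi]
  exact (neg_neg _).symm

/-- The chambers of the gallery agree on the hyperplanes containing `X_L`, and no wall between them
lies in such a hyperplane. -/
theorem IsLoopGallery.PhiFunctor_obj_eq (h : A.IsLoopGallery M k C)
    (hML : A.tangent M ≤ A.tangent L) (B : Chamber A.linear) {x : A.SalCat}
    (hx : x ∈ A.loopObjects M k C B) :
    ∃ F : A.TFace, F.carrier ⊆ M ∧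
      (A.PhiFunctor L).obj x = (A.projFace L F).vertexObj (A.projChamber L (C 0)) := by
  have key : ∀ n ≤ k, ∀ i, L ⊆ A.hyp i → (C n).1.sign i = (C 0).1.sign i := fun n hn i hi =>
    h.sign_eq (hML.trans (tangent_le_ker hi)) hn
  obtain ⟨F, hF, ⟨n, hn, rfl⟩ | ⟨n, hn, W, hW, rfl⟩⟩ := hx
  · refine ⟨F, hF, congrArg (obj (A.projFace L F)) (Cell.ext ?_ ?_)⟩ <;>
    · ext i
      exact key n hn _ i.1.2
  · have hWi : ∀ i : (A.projFace L F).Loc,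
        W.sign (A.locMap L F i) = (C 0).1.sign i.1.1 := fun i =>
      (hW.sign_eq (j := A.locMap L F i)
        ((key n hn.le _ i.1.2).trans (key (n + 1) hn _ i.1.2).symm)).trans (key n hn.le _ i.1.2)
    refine ⟨F, hF, congrArg (obj (A.projFace L F)) (Cell.ext ?_ ?_)⟩
    · ext i
      exact hWi i
    · ext i
      refine Eq.trans (if_neg fun h0 => ?_) (hWi i)
      rw [hWi i] at h0
      exact (C 0).2 _ h0

/-- The arrows in the support of the fundamental chain lie in the loop. -/
theorem IsLoopChain.mem_loopObjects {B : Chamber A.linear} {c : A.Sal _⦋1⦌ →₀ ℤ}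
    (hc : A.IsLoopChain M k C B c) {e : ComposableArrows A.SalCat 1} (he : c e ≠ 0) :
    e.left ∈ A.loopObjects M k C B ∧ e.right ∈ A.loopObjects M k C B := by
  rw [hc e, loopCoeff] at he
  by_contra hcon
  refine he ?_
  rw [if_neg, if_neg, if_neg, if_neg]
  · rfl
  · rintro ⟨G, P, hG, hP, -, hl, hr⟩
    exact hcon ⟨⟨G, hG, Or.inl ⟨0, k.zero_le, hl⟩⟩, ⟨P, hP, Or.inl ⟨k, le_rfl, hr⟩⟩⟩
  · rintro ⟨G, P, hG, hP, -, hl, hr⟩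
    exact hcon ⟨⟨G, hG, Or.inl ⟨0, k.zero_le, hl⟩⟩, ⟨P, hP, Or.inl ⟨0, k.zero_le, hr⟩⟩⟩
  · rintro ⟨P, hP, n, hn, W, hW, hl, hr⟩
    exact hcon ⟨⟨P, hP, Or.inl ⟨n + 1, hn, hl⟩⟩, ⟨P, hP, Or.inr ⟨n, hn, W, hW, hr⟩⟩⟩
  · rintro ⟨P, hP, n, hn, W, hW, hl, hr⟩
    exact hcon ⟨⟨P, hP, Or.inl ⟨n, hn.le, hl⟩⟩, ⟨P, hP, Or.inr ⟨n, hn, W, hW, hr⟩⟩⟩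

end

/-! ### Images under the projection -/

section
variable {V : Type u} [NormedAddCommGroup V] [NormedSpace ℝ V] [FiniteDimensional ℝ V]
  {Γ : Submodule ℤ V} {ι : Type v} [Finite ι]
  {A : ToricArrangement Γ ι} {L M : Set (V ⧸ Γ)} {k : ℕ} {C : ℕ → Chamber A.linear}

/-- The functor inducing `Φ_L` is constant on the objects of a loop `Λ_B^M` with `X_M ⊆ X_L`. -/
theorem IsLoopGallery.exists_PhiFunctor_obj_eq (hM : A.IsLayer M)
    (hML : A.tangent M ≤ A.tangent L) (h : A.IsLoopGallery M k C) (B : Chamber A.linear) :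
    ∃ F : A.TFace, F.carrier ⊆ M ∧ ∀ x ∈ A.loopObjects M k C B,
      (A.PhiFunctor L).obj x = (A.projFace L F).vertexObj (A.projChamber L (C 0)) := by
  obtain ⟨p, hp⟩ := hM.nonempty
  obtain ⟨v, rfl⟩ := Submodule.mkQ_surjective Γ p
  have hF : (A.faceAt v).carrier ⊆ M := hM.face_subset (mkQ_mem_faceAt v) hp
  refine ⟨A.faceAt v, hF, fun x hx => ?_⟩
  obtain ⟨G, hG, e⟩ := h.PhiFunctor_obj_eq hML B hx
  rw [e, hM.projFace_eq hML hG hF]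

theorem IsLoopGallery.image_loopComplex (hM : A.IsLayer M)
    (hML : A.tangent M ≤ A.tangent L) (h : A.IsLoopGallery M k C) (B : Chamber A.linear) :
    ∃ x : (A.quot L).SalCat, (A.loopComplex M k C B).image (A.Phi L) =
      SSet.Subcomplex.ofSimplex (X := (A.quot L).Sal) (n := 0) (ComposableArrows.mk₀ x) := by
  obtain ⟨F, hF, hx⟩ := h.exists_PhiFunctor_obj_eq (L := L) hM hML B
  have hne : (A.loopObjects M k C B).Nonempty :=
    ⟨F.vertexObj (C 0), F, hF, Or.inl ⟨0, k.zero_le, rfl⟩⟩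
  exact ⟨_, image_fullSubcomplex_eq_ofSimplex (A.PhiFunctor L) hne (subsingleton_hom_obj _ _) hx⟩

theorem IsLoopGallery.homologyClass_Phi_eq_zero (hM : A.IsLayer M)
    (hML : A.tangent M ≤ A.tangent L) (h : A.IsLoopGallery M k C) {B : Chamber A.linear}
    {c : A.Sal _⦋1⦌ →₀ ℤ} (hc : A.IsLoopChain M k C B c) (hz : IsCycle (chain c)) :
    homologyClass (chain c) hz ≫ H₁map (A.Phi L) = 0 := by
  obtain ⟨F, -, hx⟩ := h.exists_PhiFunctor_obj_eq (L := L) hM hML B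
  rw [homologyClass_map]
  refine homologyClass_eq_zero _ (chainClass_chain_Phi_eq_zero L fun e he => ?_)
  obtain ⟨hl, hr⟩ := hc.mem_loopObjects he
  rw [hx _ hl, hx _ hr]

end

section
variable {V : Type u} [AddCommGroup V] [Module ℝ V] [TopologicalSpace V]
  [IsTopologicalAddGroup V] [ContinuousSMul ℝ V] {Γ : Submodule ℤ V} {ι : Type v} [Finite ι]
  {A : ToricArrangement Γ ι} {L : Set (V ⧸ Γ)} {i : ι}

theorem image_circle_id {G : A.TFace} (hG : G.supp = A.hyp i) (hi : L ⊆ A.hyp i)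
    (C : Chamber A.linear) :
    (TFace.Hom.circle (𝟙 G) C).image (A.Phi L) =
      TFace.Hom.circle (𝟙 (A.projFace L G)) (A.projChamber L C) := by
  have h := image_circle L (𝟙 G) C fun j hj => by
    rwa [(isFacet_of_supp_eq hG j).1 hj]
  rw [CategoryTheory.Functor.map_id] at h
  exact h

theorem IsOmegaHat.comp_Phi {C : Chamber A.linear} {w : intModule ⟶ H₁ A.Sal}
    (h : A.IsOmegaHat i C w) (hi : L ⊆ A.hyp i) {w' : intModule ⟶ H₁ (A.quot L).Sal}
    (h' : (A.quot L).IsOmegaHat ⟨i, hi⟩ (A.projChamber L C) w') :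
    w ≫ H₁map (A.Phi L) = w' := by
  obtain ⟨F, G, m, hG, rfl⟩ := h
  obtain ⟨F', G', m', hG', rfl⟩ := h'
  rw [circleClass_Phi]
  exact circleClass_eq _ _ ((isFacet_of_supp_eq hG).projFace L hi) (isFacet_of_supp_eq hG') _

theorem IsOmegaHat.comp_Phi_eq_zero {C : Chamber A.linear} {w : intModule ⟶ H₁ A.Sal}
    (h : A.IsOmegaHat i C w) (hi : ¬ L ⊆ A.hyp i) : w ≫ H₁map (A.Phi L) = 0 := by
  obtain ⟨F, G, m, hG, rfl⟩ := h
  exact circleClass_Phi_eq_zero L m (isFacet_of_supp_eq hG) hi C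

end

end ToricArrangement
end ToricSalvetti

theorem mainTheorem7 {V : Type u} [NormedAddCommGroup V] [NormedSpace ℝ V] [FiniteDimensional ℝ V]
    (Γ : Submodule ℤ V) [DiscreteTopology Γ] [IsZLattice ℝ Γ] {ι : Type v} [Finite ι]
    (A : ToricArrangement Γ ι) (hA : A.Essential) (L : Set (V ⧸ Γ)) (hL : A.IsLayer L) :
    -- (1) the loops `Λ_B^M` with `X_M ⊆ X_L` are collapsed to a vertex, and their fundamental
    -- classes are mapped to zero
    (∀ M : Set (V ⧸ Γ), A.IsLayer M → Module.finrank ℝ (A.tangent M) = 1 →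
      A.tangent M ≤ A.tangent L →
      ∀ (k : ℕ) (C : ℕ → Chamber A.linear), A.IsLoopGallery M k C → ∀ B : Chamber A.linear,
        (∃ x : (A.quot L).SalCat, (A.loopComplex M k C B).image (A.Phi L) =
          SSet.Subcomplex.ofSimplex (X := (A.quot L).Sal) (n := 0) (ComposableArrows.mk₀ x)) ∧
        ∃ c : A.Sal _⦋1⦌ →₀ ℤ, A.IsLoopChain M k C B c ∧
          ∃ hc : IsCycle (chain c), homologyClass (chain c) hc ≫ H₁map (A.Phi L) = 0) ∧
    -- (2) the circles `Ω^{(id_G)}` and the classes of loops around hypertori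
    (∀ C : ι → Chamber A.linear,
      (∀ (i : ι) (G : A.TFace), G.supp = A.hyp i → L ⊆ A.hyp i →
        (ToricArrangement.TFace.Hom.circle (𝟙 G) (C i)).image (A.Phi L) =
          ToricArrangement.TFace.Hom.circle (𝟙 (A.projFace L G)) (A.projChamber L (C i))) ∧
      ∀ (i : ι) (w : intModule ⟶ H₁ A.Sal), A.IsOmegaHat i (C i) w →
        (∀ (hi : L ⊆ A.hyp i) (w' : intModule ⟶ H₁ (A.quot L).Sal),
          (A.quot L).IsOmegaHat ⟨i, hi⟩ (A.projChamber L (C i)) w' → w ≫ H₁map (A.Phi L) = w') ∧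
        (¬ L ⊆ A.hyp i → w ≫ H₁map (A.Phi L) = 0)) ∧
    -- (3) the subcomplexes `𝒮_{Y, F₀}`
    (∀ Y : Set (V ⧸ Γ), A.IsLayer Y → ∀ F₀ : Face A.linear,
      (A.starComplex Y F₀).image (A.Phi L) ≤
        (A.quot L).starComplex (A.projLayer L Y) (A.projLinear L F₀)) := by
  refine ⟨fun M hM h1 hML k C h B => ?_, fun C => ⟨fun i G hG hi => ?_, fun i w hw => ?_⟩,
    fun Y _ F₀ => ToricArrangement.image_starComplex_le L Y F₀⟩
  · obtain ⟨c, hc, hz⟩ := h.exists_isLoopChain hA hM h1 B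
    exact ⟨h.image_loopComplex hM hML B, c, hc, hz, h.homologyClass_Phi_eq_zero hM hML hc hz⟩
  · exact ToricArrangement.image_circle_id hG hi (C i)
  · exact ⟨fun hi w' hw' => hw.comp_Phi hi hw', fun hi => hw.comp_Phi_eq_zero hi⟩
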